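/- **Notation.** For $n=3,4$ let $\mathsf S^n=(\mathbb R^{n+1}\smallsetminus\{0\})/\mathbb R_{>0}$ be the projective sphere (with the quotient topology); a tuple $(\alpha_0:\dots:\alpha_n)$ denotes the half-space $\mathbf H=\{[x]:\sum_i\alpha_ix_i\le 0\}$ and $\partial\mathbf H=\{[x]:\sum_i\alpha_ix_i=0\}$. Put $q_c(x)=-x_0^2+x_1^2+x_2^2+x_3^2+c\,x_4^2$ on $\mathbb R^5$ and $$\mathbb H^4=\{q_1<0,\ x_0>0\},\qquad \mathbb A\mathrm d\mathbb S^4=\{q_{-1}<0\},\qquad \mathsf{HP}^4=\{q_0<0,\ x_0\ge 0\}\subset\mathsf S^4,$$ $$\mathbb X_t=\{q_{t|t|}<0,\ x_0>0\}\ (t>0),\qquad \mathbb X_t=\{q_{t|t|}<0\}\ (t<0),\qquad \mathbb X_0=\mathsf{HP}^4,$$ and $\mathbb H^3=\{-x_0^2+x_1^2+x_2^2+x_3^2<0,\ x_0>0\}\subset\mathsf S^3$. Let $I=(-1,1/\sqrt3\,]$. **The polytopes.** Let $\sigma_0,\dots,\sigma_7\in\{\pm1\}^3$ be $(1,1,1)$,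 $(1,-1,1)$, $(1,-1,-1)$, $(1,1,-1)$, $(-1,1,-1)$, $(-1,1,1)$, $(-1,-1,1)$, $(-1,-1,-1)$. For $t\in I$ consider the 22 half-spaces of $\mathsf S^4$ $$\mathbf i^+=\bigl(-\sqrt2|t|:|t|\sigma_i:(-1)^i\bigr),\qquad \mathbf i^-=\bigl(-\sqrt2:\sigma_i:-(-1)^i t\bigr)\qquad(i=0,\dots,7),$$ $$\mathbf A,\mathbf F=(-1:\pm\sqrt2:0:0:0),\qquad \mathbf B,\mathbf E=(-1:0:\pm\sqrt2:0:0),\qquad \mathbf C,\mathbf D=(-1:0:0:\pm\sqrt2:0).$$ Let $\overline{\mathcal P}_t$ be their intersection, and let $\mathcal P_t=\overline{\mathcal P}_t\cap\mathbb H^4$ if $t\ge0$ and $\mathcal P_t=\overline{\mathcal P}_t\cap\mathbb A\mathrm d\mathbb S^4$ if $t<0$. The facets of $\mathcal P_t$ ($t\ne 0$) are $\mathcal F_{\mathbf H}=\partial\mathbf H\cap\mathcal P_t$ for $\mathbf H$ in this list. The rescaled polytope $\mathfrak r_{|t|}(\mathcal P_t)$ is defined in the same way for all $t\in I$, as the intersection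 of $\mathbb X_t$ with the half-spaces obtained from the list by replacing $\mathbf i^+$ with $(-\sqrt2:\sigma_i:(-1)^i)$ and $\mathbf i^-$ with $(-\sqrt2:\sigma_i:-(-1)^i\,t|t|)$. For $t\ne0$ it is the image of $\mathcal P_t$ under the projective map $\mathfrak r_{|t|}$ induced by $\mathrm{diag}(1,1,1,1,1/|t|)$; for $t=0$ the half-spaces are the limits of those for $t\neq 0$, and the result is a polytope in $\mathsf{HP}^4$. **The cuboctahedron.** Let $\mathcal C\subset\mathbb H^3$ be the ideal right-angled cuboctahedron, i.e. the intersection of $\mathbb H^3$ with the eight half-spaces $(-\sqrt2:\sigma_i)$, bounding triangular faces labelled $\mathbf i$, and the six half-spaces $(-1:\pm\sqrt2:0:0)$, $(-1:0:\pm\sqrt2:0)$, $(-1:0:0:\pm\sqrt2)$, bounding quadrilateral faces labelled $\mathbf A,\dots,\mathbf F$ as above. (Via $x_4=0$ it is identified with $\mathcal P_0$.) Let $\Gamma_{\mathrm{co}}<\mathrm{Isom}(\mathbb H^3)$ be the group generated by the reflections in the 14 planes bounding $\mathcal C$, let $\Gamma<\Gamma_{\mathrm{co}}$ be any torsion-free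 subgroup, and let $\mathcal N=\mathbb H^3/\Gamma$, which orbifold-covers $\mathbb H^3/\Gamma_{\mathrm{co}}=\mathcal C$ and is tessellated by copies of $\mathcal C$, namely the images of the translates $g\mathcal C$, $g\in\Gamma_{\mathrm{co}}$. **The glued spaces.** Take one copy of $\mathcal P_t$ for each copy of $\mathcal C$ in $\mathcal N$. If two copies of $\mathcal C$ are adjacent along a quadrilateral face $\mathbf X\in\{\mathbf A,\dots,\mathbf F\}$ (resp. a triangular face $\mathbf i$), glue the corresponding copies of $\mathcal P_t$ along the facet $\mathcal F_{\mathbf X}$ (resp. $\mathcal F_{\mathbf i^-}$) by the identity. Let $\mathcal X_t$ be the double of the resulting space along its unpaired facets, i.e. the copies of $\mathcal F_{\mathbf 0^+},\dots,\mathcal F_{\mathbf 7^+}$. Let $\mathfrak r_{|t|}(\mathcal X_t)$ be the space obtained in the same way from copies of $\mathfrak r_{|t|}(\mathcal P_t)$ and its facets. **Proposition.** For all $t\in I\smallsetminus\{0\}$, the space $\mathcal X_t$ is homeomorphic to $\mathcal N\times S^1$. Moreover, for all $t\in I$ (including $t=0$), the space $\mathfrak r_{|t|}(\mathcal X_t)$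 is homeomorphic to $\mathcal N\times S^1$. -/

import Mathlib

/-! Kerckhoff–Storm polytopes in projective `4`-space, the ideal right-angled cuboctahedron and its
reflection group, and the spaces obtained by gluing copies of the polytopes. -/

namespace Transition

/-! ### The projective spheres

The projective sphere `𝖲ⁿ` is the space of rays `Module.Ray ℝ (Fin (n + 1) → ℝ)`: the nonzero vectors
modulo positive scaling, with the quotient topology. -/

/-- The topology of the space of rays, as a quotient of the space of nonzero vectors. -/
instance rayTopology (M : Type*) [AddCommGroup M] [Module ℝ M] [TopologicalSpace M] :
    TopologicalSpace (Module.Ray ℝ M) :=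
  TopologicalSpace.coinduced
    (fun v : {v : M // v ≠ 0} => rayOfNeZero ℝ v.1 v.2) inferInstance

/-- The projective sphere of dimension three. -/
abbrev S3 : Type := Module.Ray ℝ (Fin 4 → ℝ)

/-- The projective sphere of dimension four. -/
abbrev S4 : Type := Module.Ray ℝ (Fin 5 → ℝ)

/-- The image in the projective sphere of a set of vectors (the zero vector is ignored). -/
def proj {m : ℕ} (S : Set (Fin m → ℝ)) : Set (Module.Ray ℝ (Fin m → ℝ)) :=
  {p | ∃ (x : Fin m → ℝ) (hx : x ≠ 0), x ∈ S ∧ rayOfNeZero ℝ x hx = p}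

theorem mem_proj {m : ℕ} {S : Set (Fin m → ℝ)} (hS : ∀ c : ℝ, 0 < c → ∀ x ∈ S, c • x ∈ S)
    {x : Fin m → ℝ} (hx : x ≠ 0) : rayOfNeZero ℝ x hx ∈ proj S ↔ x ∈ S := by
  constructor
  · rintro ⟨y, hy, hyS, h⟩
    rw [ray_eq_iff] at h
    obtain ⟨c, hc, rfl⟩ := h.exists_pos_left hy hx
    exact hS c hc y hyS
  · exact fun h => ⟨x, hx, h, rfl⟩

open scoped Matrix in
/-- The half-space `α₀ x₀ + … + αₙ xₙ ≤ 0` of the projective sphere. -/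
def halfSpace {m : ℕ} (α : Fin m → ℝ) : Set (Module.Ray ℝ (Fin m → ℝ)) :=
  proj {x | α ⬝ᵥ x ≤ 0}

open scoped Matrix in
/-- The hyperplane `α₀ x₀ + … + αₙ xₙ = 0` of the projective sphere. -/
def hyperplane {m : ℕ} (α : Fin m → ℝ) : Set (Module.Ray ℝ (Fin m → ℝ)) :=
  proj {x | α ⬝ᵥ x = 0}

/-! ### The model geometries -/

/-- The quadratic form `-x₀² + x₁² + x₂² + x₃²`. -/
def quad3 (x : Fin 4 → ℝ) : ℝ := -x 0 ^ 2 + x 1 ^ 2 + x 2 ^ 2 + x 3 ^ 2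

/-- The quadratic form `-x₀² + x₁² + x₂² + x₃² + c x₄²`. -/
def quad4 (c : ℝ) (x : Fin 5 → ℝ) : ℝ := -x 0 ^ 2 + x 1 ^ 2 + x 2 ^ 2 + x 3 ^ 2 + c * x 4 ^ 2

/-- Hyperbolic three-space. -/
def H3 : Set S3 := proj {x | quad3 x < 0 ∧ 0 < x 0}

/-- Hyperbolic four-space. -/
def H4 : Set S4 := proj {x | quad4 1 x < 0 ∧ 0 < x 0}

/-- Anti-de Sitter four-space (the double cover living in the projective sphere). -/
def AdS4 : Set S4 := proj {x | quad4 (-1) x < 0}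

/-- Half-pipe four-space. -/
def HP4 : Set S4 := proj {x | quad4 0 x < 0 ∧ 0 ≤ x 0}

/-- The rescaled model spaces `𝕏_t`, which interpolate between `ℍ⁴` (for `t = 1`), half-pipe space
(for `t = 0`) and Anti-de Sitter space (for `t = -1`). -/
noncomputable def modelSpace (t : ℝ) : Set S4 :=
  if 0 < t then proj {x | quad4 (t * |t|) x < 0 ∧ 0 < x 0}
  else if t < 0 then proj {x | quad4 (t * |t|) x < 0}
  else HP4

/-! ### The polytopes -/

/-- The signs `(±1, ±1, ±1)` of the entries of the walls `0^±, …, 7^±`. -/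
def cubeSign : Fin 8 → Fin 3 → ℝ :=
  ![![1, 1, 1], ![1, -1, 1], ![1, -1, -1], ![1, 1, -1],
    ![-1, 1, -1], ![-1, 1, 1], ![-1, -1, 1], ![-1, -1, -1]]

/-- The labels of the faces of the cuboctahedron: eight triangles `0, …, 7`, and six
quadrilaterals `A, …, F`. -/
inductive Side : Type
  | tri (i : Fin 8)
  | quad (X : Fin 6)

/-- The labels of the walls of the four-dimensional polytopes: the walls `0⁺, …, 7⁺` are `pos i`,
the walls `0⁻, …, 7⁻` are `side (tri i)`, and the walls `A, …, F` are `side (quad X)`. -/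
inductive Wall : Type
  | pos (i : Fin 8)
  | side (s : Side)

/-- The unit spacelike vectors defining the walls `A, …, F`, without their last entry `0`. -/
noncomputable def quadNormal : Fin 6 → Fin 4 → ℝ :=
  ![![-1, √2, 0, 0], ![-1, 0, √2, 0], ![-1, 0, 0, √2],
    ![-1, 0, 0, -√2], ![-1, 0, -√2, 0], ![-1, -√2, 0, 0]]

/-- The walls of the polytope at time `t`, as linear forms. -/
noncomputable def wall (t : ℝ) : Wall → Fin 5 → ℝ
  | .pos i => ![-√2 * |t|, |t| * cubeSign i 0, |t| * cubeSign i 1, |t| * cubeSign i 2,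
      (-1) ^ (i : ℕ)]
  | .side (.tri i) => ![-√2, cubeSign i 0, cubeSign i 1, cubeSign i 2, -(-1) ^ (i : ℕ) * t]
  | .side (.quad X) =>
      ![quadNormal X 0, quadNormal X 1, quadNormal X 2, quadNormal X 3, 0]

/-- The intersection of the 22 half-spaces at time `t` in the projective sphere. -/
noncomputable def closedPolytope (t : ℝ) : Set S4 := ⋂ w, halfSpace (wall t w)

/-- The polytope `P_t`, in `ℍ⁴` when `t ≥ 0` and in Anti-de Sitter space when `t < 0`. -/
noncomputable def polytope (t : ℝ) : Set S4 :=
  closedPolytope t ∩ (if 0 ≤ t then H4 else AdS4)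

/-- The facets of `P_t`. -/
noncomputable def facet (t : ℝ) (w : Wall) : Set S4 := hyperplane (wall t w) ∩ polytope t

/-- The rescaled walls. For `t ≠ 0` these are the images of the walls under the projective map
`𝔯_|t| = [diag(1, 1, 1, 1, 1/|t|)]`; the formulas extend continuously to `t = 0`. -/
noncomputable def rescaledWall (t : ℝ) : Wall → Fin 5 → ℝ
  | .pos i => ![-√2, cubeSign i 0, cubeSign i 1, cubeSign i 2, (-1) ^ (i : ℕ)]
  | .side (.tri i) =>
      ![-√2, cubeSign i 0, cubeSign i 1, cubeSign i 2, -(-1) ^ (i : ℕ) * (t * |t|)]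
  | .side (.quad X) =>
      ![quadNormal X 0, quadNormal X 1, quadNormal X 2, quadNormal X 3, 0]

/-- The rescaled polytope `𝔯_|t|(P_t)` for `t ≠ 0`, and its limit in half-pipe space for `t = 0`. -/
noncomputable def rescaledPolytope (t : ℝ) : Set S4 :=
  (⋂ w, halfSpace (rescaledWall t w)) ∩ modelSpace t

/-- The facets of the rescaled polytope. -/
noncomputable def rescaledFacet (t : ℝ) (w : Wall) : Set S4 :=
  hyperplane (rescaledWall t w) ∩ rescaledPolytope t

/-! ### The cuboctahedron and its reflection group -/

/-- The outward unit normals to the faces of the ideal right-angled cuboctahedron. -/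
noncomputable def sideNormal : Side → Fin 4 → ℝ
  | .tri i => ![-√2, cubeSign i 0, cubeSign i 1, cubeSign i 2]
  | .quad X => quadNormal X

/-- The ideal right-angled cuboctahedron in `ℍ³`; see `mem_polytope_zero`. -/
noncomputable def cuboctahedron : Set S3 := (⋂ s, halfSpace (sideNormal s)) ∩ H3

/-- The faces of the cuboctahedron. -/
noncomputable def face (s : Side) : Set S3 := hyperplane (sideNormal s) ∩ cuboctahedron

open scoped Matrix in
/-- The linear form `x ↦ 2 αᵀ x`. -/
noncomputable def twiceForm (α : Fin 4 → ℝ) : Module.Dual ℝ (Fin 4 → ℝ) where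
  toFun x := 2 * (α ⬝ᵥ x)
  map_add' x y := by simp [mul_add]
  map_smul' c x := by simp [mul_left_comm]

/-- The vector `J α`, for `J = diag(-1, 1, 1, 1)`. -/
def dualVec (α : Fin 4 → ℝ) : Fin 4 → ℝ := ![-α 0, α 1, α 2, α 3]

theorem twiceForm_sideNormal (s : Side) :
    twiceForm (sideNormal s) (dualVec (sideNormal s)) = 2 := by
  have h : √2 * √2 = 2 := Real.mul_self_sqrt (by norm_num)
  rcases s with i | X
  · fin_cases i <;>
      simp [twiceForm, dualVec, sideNormal, cubeSign, dotProduct, Fin.sum_univ_four] <;>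
      linarith
  · fin_cases X <;>
      simp [twiceForm, dualVec, sideNormal, quadNormal, dotProduct, Fin.sum_univ_four] <;>
      linarith

/-- The reflection `id - 2 J v vᵀ` in the plane of the side `s`, where `v` is the unit normal. -/
noncomputable def sideReflection (s : Side) : (Fin 4 → ℝ) ≃ₗ[ℝ] (Fin 4 → ℝ) :=
  Module.reflection (twiceForm_sideNormal s)

/-- The group generated by the reflections in the planes bounding the cuboctahedron. Isometries of
`ℍ³` are represented by linear isometries of the Lorentzian form. -/
noncomputable def cuboctGroup : Subgroup ((Fin 4 → ℝ) ≃ₗ[ℝ] (Fin 4 → ℝ)) :=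
  Subgroup.closure (Set.range sideReflection)

/-- The quotient `ℍ³ / Γ`. -/
def QuotientManifold (Γ : Subgroup cuboctGroup) : Type :=
  Quotient ((MulAction.orbitRel Γ S3).comap (Subtype.val : H3 → S3))

instance (Γ : Subgroup cuboctGroup) : TopologicalSpace (QuotientManifold Γ) :=
  inferInstanceAs (TopologicalSpace (Quotient _))

/-! ### Gluing -/

/-- The copies of the cuboctahedron in `ℍ³ / Γ`: the translates `g C` of the cuboctahedron tessellate
`ℍ³`, and the copy of index `Γ g` is the image of `g C`. -/
def Copy (Γ : Subgroup cuboctGroup) : Type := Quotient (QuotientGroup.rightRel Γ)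

/-- Two copies are adjacent along the face `s` if they lift to distinct translates `g C` and `h C` in
`ℍ³` whose faces `g F` and `h F`, for `F` the face `s` of `C`, agree (pointwise: the identification of
both faces with `F` is the same). -/
def Adjacent (Γ : Subgroup cuboctGroup) (s : Side) (c d : Copy Γ) : Prop :=
  ∃ g h : cuboctGroup, (Quotient.mk _ g : Copy Γ) = c ∧ (Quotient.mk _ h : Copy Γ) = d ∧
    g ≠ h ∧ ∀ x ∈ face s, g • x = h • x

/-- One copy of `P` for each copy of the cuboctahedron in `ℍ³ / Γ`. -/
def Pieces (Γ : Subgroup cuboctGroup) (P : Set S4) : Type := Σ _ : Copy Γ, P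

instance (Γ : Subgroup cuboctGroup) (P : Set S4) : TopologicalSpace (Pieces Γ P) :=
  inferInstanceAs (TopologicalSpace (Σ _ : Copy Γ, P))

/-- If two copies of the cuboctahedron are adjacent along a face `s`, the corresponding copies of
`P` are glued along the facet `F (side s)`, through the identity. -/
def GlueRel (Γ : Subgroup cuboctGroup) (P : Set S4) (F : Wall → Set S4) (a b : Pieces Γ P) : Prop :=
  ∃ s : Side, Adjacent Γ s a.1 b.1 ∧ (a.2 : S4) ∈ F (.side s) ∧ (b.2 : S4) = a.2

/-- The space obtained by gluing copies of `P` along the facets which are not of type `pos i`. -/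
def Glued (Γ : Subgroup cuboctGroup) (P : Set S4) (F : Wall → Set S4) : Type :=
  Quot (GlueRel Γ P F)

instance (Γ : Subgroup cuboctGroup) (P : Set S4) (F : Wall → Set S4) :
    TopologicalSpace (Glued Γ P F) :=
  inferInstanceAs (TopologicalSpace (Quot _))

/-- The union of the unpaired facets in the glued space. -/
def unpaired (Γ : Subgroup cuboctGroup) (P : Set S4) (F : Wall → Set S4) : Set (Glued Γ P F) :=
  {y | ∃ a : Pieces Γ P, (Quot.mk _ a : Glued Γ P F) = y ∧ ∃ i, (a.2 : S4) ∈ F (.pos i)}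

/-- The double of `Y` along a subset `A`: two copies of `Y`, glued along `A` by the identity. -/
def Double (Y : Type) (A : Set Y) : Type :=
  Quot fun p q : Y × Bool => p.1 = q.1 ∧ p.1 ∈ A

instance (Y : Type) [TopologicalSpace Y] (A : Set Y) : TopologicalSpace (Double Y A) :=
  inferInstanceAs (TopologicalSpace (Quot _))

/-- The space `X_t`. -/
abbrev ConeSpace (Γ : Subgroup cuboctGroup) (t : ℝ) : Type :=
  Double (Glued Γ (polytope t) (facet t)) (unpaired Γ (polytope t) (facet t))

/-- The rescaled space `𝔯_|t|(X_t)`. -/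
abbrev RescaledConeSpace (Γ : Subgroup cuboctGroup) (t : ℝ) : Type :=
  Double (Glued Γ (rescaledPolytope t) (rescaledFacet t))
    (unpaired Γ (rescaledPolytope t) (rescaledFacet t))

/-! ### The definitions agree -/

theorem mem_halfSpace {m : ℕ} (α : Fin m → ℝ) {x : Fin m → ℝ} (hx : x ≠ 0) :
    rayOfNeZero ℝ x hx ∈ halfSpace α ↔ dotProduct α x ≤ 0 := by
  refine mem_proj (S := {x | dotProduct α x ≤ 0}) ?_ hx
  intro c hc x (h : dotProduct α x ≤ 0)
  change dotProduct α (c • x) ≤ 0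
  rw [dotProduct_smul, smul_eq_mul]
  exact mul_nonpos_of_nonneg_of_nonpos hc.le h

theorem mem_hyperplane {m : ℕ} (α : Fin m → ℝ) {x : Fin m → ℝ} (hx : x ≠ 0) :
    rayOfNeZero ℝ x hx ∈ hyperplane α ↔ dotProduct α x = 0 := by
  refine mem_proj (S := {x | dotProduct α x = 0}) ?_ hx
  intro c hc x (h : dotProduct α x = 0)
  change dotProduct α (c • x) = 0
  rw [dotProduct_smul, h, smul_zero]

theorem quad4_smul (k c : ℝ) (x : Fin 5 → ℝ) : quad4 k (c • x) = c ^ 2 * quad4 k x := by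
  simp only [quad4, Pi.smul_apply, smul_eq_mul]
  ring

theorem mem_H3 {x : Fin 4 → ℝ} (hx : x ≠ 0) :
    rayOfNeZero ℝ x hx ∈ H3 ↔ quad3 x < 0 ∧ 0 < x 0 := by
  refine mem_proj (S := {x | quad3 x < 0 ∧ 0 < x 0}) ?_ hx
  rintro c hc x ⟨h, h0⟩
  refine ⟨?_, mul_pos hc h0⟩
  have : quad3 (c • x) = c ^ 2 * quad3 x := by
    simp only [quad3, Pi.smul_apply, smul_eq_mul]
    ring
  rw [this]
  exact mul_neg_of_pos_of_neg (by positivity) h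

theorem mem_cone_pos (k : ℝ) {x : Fin 5 → ℝ} (hx : x ≠ 0) :
    rayOfNeZero ℝ x hx ∈ proj {x : Fin 5 → ℝ | quad4 k x < 0 ∧ 0 < x 0} ↔
      quad4 k x < 0 ∧ 0 < x 0 := by
  refine mem_proj (S := {x | quad4 k x < 0 ∧ 0 < x 0}) ?_ hx
  rintro c hc x ⟨h, h0⟩
  refine ⟨?_, mul_pos hc h0⟩
  rw [quad4_smul]
  exact mul_neg_of_pos_of_neg (by positivity) h

theorem mem_cone (k : ℝ) {x : Fin 5 → ℝ} (hx : x ≠ 0) :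
    rayOfNeZero ℝ x hx ∈ proj {x : Fin 5 → ℝ | quad4 k x < 0} ↔ quad4 k x < 0 := by
  refine mem_proj (S := {x | quad4 k x < 0}) ?_ hx
  intro c hc x (h : quad4 k x < 0)
  change quad4 k (c • x) < 0
  rw [quad4_smul]
  exact mul_neg_of_pos_of_neg (by positivity) h

/-- The cuboctahedron is the polytope at time zero, in the hyperplane `x₄ = 0`. -/
theorem mem_polytope_zero {x : Fin 5 → ℝ} (hx : x ≠ 0) :
    rayOfNeZero ℝ x hx ∈ polytope 0 ↔
      x 4 = 0 ∧ ∃ hy : ![x 0, x 1, x 2, x 3] ≠ 0, rayOfNeZero ℝ _ hy ∈ cuboctahedron := by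
  simp only [polytope, closedPolytope, cuboctahedron, le_refl, if_true, H4, Set.mem_inter_iff,
    Set.mem_iInter, mem_halfSpace, mem_cone_pos, mem_H3]
  constructor
  · rintro ⟨hw, hq, h0⟩
    have h4 : x 4 = 0 := by
      have e0 := hw (.pos 0)
      have e1 := hw (.pos 1)
      simp [wall, dotProduct, Fin.sum_univ_five] at e0 e1
      linarith
    refine ⟨h4, ?_, ?_, ?_, h0⟩
    · intro h
      have := congrFun h 0
      simp at this
      linarith
    · intro s
      have := hw (.side s)
      rcases s with i | X <;>
        simpa [wall, sideNormal, dotProduct, Fin.sum_univ_five, Fin.sum_univ_four] using this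
    · simpa [quad4, quad3, h4] using hq
  · rintro ⟨h4, hy, hs, hq, h0⟩
    refine ⟨?_, ?_, h0⟩
    · rintro (i | s)
      · simp [wall, dotProduct, Fin.sum_univ_five, h4]
      · have := hs s
        rcases s with i | X <;>
          simpa [wall, sideNormal, dotProduct, Fin.sum_univ_five, Fin.sum_univ_four] using this
    · simpa [quad4, quad3, h4] using hq

/-- The linear map `diag(1, 1, 1, 1, 1/|t|)`, which induces the projective map `𝔯_|t|`. -/
noncomputable def rescaling (t : ℝ) (ht : t ≠ 0) : (Fin 5 → ℝ) ≃ₗ[ℝ] (Fin 5 → ℝ) :=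
  LinearEquiv.piCongrRight fun i : Fin 5 =>
    if i = 4 then LinearEquiv.smulOfNeZero ℝ ℝ (1 / |t|) (by positivity)
    else LinearEquiv.refl ℝ ℝ

theorem rescaling_apply (t : ℝ) (ht : t ≠ 0) (x : Fin 5 → ℝ) :
    rescaling t ht x = ![x 0, x 1, x 2, x 3, 1 / |t| * x 4] := by
  funext i
  fin_cases i <;> simp [rescaling]

theorem rescaledWall_dot (t : ℝ) (ht : t ≠ 0) (w : Wall) : ∃ c : ℝ, 0 < c ∧ ∀ x,
    dotProduct (wall t w) x = c * dotProduct (rescaledWall t w) (rescaling t ht x) := by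
  have ht' : |t| ≠ 0 := abs_ne_zero.2 ht
  rcases w with i | i | X
  · refine ⟨|t|, by positivity, fun x => ?_⟩
    simp [rescaling_apply, wall, rescaledWall, dotProduct, Fin.sum_univ_five]
    field_simp
  · refine ⟨1, one_pos, fun x => ?_⟩
    simp [rescaling_apply, wall, rescaledWall, dotProduct, Fin.sum_univ_five]
    field_simp
  · refine ⟨1, one_pos, fun x => ?_⟩
    simp [rescaling_apply, wall, rescaledWall, dotProduct, Fin.sum_univ_five]

/-- For `t ≠ 0`, the rescaled polytope is the image of `P_t` under `𝔯_|t|`. -/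
theorem rescaledPolytope_eq (t : ℝ) (ht : t ≠ 0) :
    rescaledPolytope t = Module.Ray.map (rescaling t ht) '' polytope t := by
  rw [Equiv.image_eq_preimage_symm, eq_comm, ← Set.preimage_eq_preimage
    (Module.Ray.map (rescaling t ht)).surjective, ← Set.preimage_comp]
  have : ((Module.Ray.map (rescaling t ht)).symm ∘ Module.Ray.map (rescaling t ht)) = id :=
    Equiv.symm_comp_self _
  rw [this, Set.preimage_id]
  ext p
  induction p using Module.Ray.ind with
  | h x hx =>
    have hq : quad4 (t * |t|) (rescaling t ht x) = quad4 (if 0 < t then 1 else -1) x := by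
      rw [rescaling_apply]
      rcases lt_or_gt_of_ne ht with h | h
      · simp [quad4, abs_of_neg h, h.not_gt]
        field_simp
      · simp [quad4, abs_of_pos h, h]
        field_simp
    have hr0 : rescaling t ht x 0 = x 0 := by rw [rescaling_apply]; rfl
    have hw : ∀ w, dotProduct (wall t w) x ≤ 0 ↔
        dotProduct (rescaledWall t w) (rescaling t ht x) ≤ 0 := by
      intro w
      obtain ⟨c, hc, h⟩ := rescaledWall_dot t ht w
      rw [h x, mul_nonpos_iff_pos_imp_nonpos]
      constructor
      · exact fun h => h.1 hc
      · intro h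
        exact ⟨fun _ => h, fun h' => hc.le⟩
    simp only [Set.mem_preimage, Module.Ray.map_apply, polytope, closedPolytope, rescaledPolytope,
      Set.mem_inter_iff, Set.mem_iInter, mem_halfSpace, hw]
    refine and_congr_right fun _ => ?_
    rcases lt_or_gt_of_ne ht with h | h
    · simp only [modelSpace, h.not_ge, h.not_gt, h, if_true, if_false, AdS4, mem_cone, hq]
    · simp only [modelSpace, h.le, h, if_true, H4, mem_cone_pos, hq, hr0]

/-- For `t ≠ 0`, the rescaled facets are the images of the facets under `𝔯_|t|`. -/
theorem rescaledFacet_eq (t : ℝ) (ht : t ≠ 0) (w : Wall) :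
    rescaledFacet t w = Module.Ray.map (rescaling t ht) '' facet t w := by
  rw [rescaledFacet, facet, Set.image_inter (Module.Ray.map (rescaling t ht)).injective,
    ← rescaledPolytope_eq]
  congr 1
  rw [Equiv.image_eq_preimage_symm, eq_comm, ← Set.preimage_eq_preimage
    (Module.Ray.map (rescaling t ht)).surjective, ← Set.preimage_comp]
  have : ((Module.Ray.map (rescaling t ht)).symm ∘ Module.Ray.map (rescaling t ht)) = id :=
    Equiv.symm_comp_self _
  rw [this, Set.preimage_id]
  ext p
  induction p using Module.Ray.ind with
  | h x hx =>
    obtain ⟨c, hc, h⟩ := rescaledWall_dot t ht w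
    simp only [Set.mem_preimage, Module.Ray.map_apply, mem_hyperplane, h x, mul_eq_zero, hc.ne',
      false_or]

/-- The rescaled walls depend continuously on `t`, also at `t = 0`. -/
theorem continuous_rescaledWall (w : Wall) : Continuous fun t => rescaledWall t w := by
  refine continuous_pi fun j => ?_
  rcases w with i | i | X <;> fin_cases j <;> simp [rescaledWall] <;> fun_prop

end Transition

namespace Transition

/-! Put `s = t * |t|`, so that `-1 < s ≤ 1/3`, and let `y` and `ω` be the spatial coordinates and
the last coordinate divided by `√2`. The sign `(-1)^i` is the product of the entries of `σ_i`, so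
among the forms `σ_i · y` of given parity `ε = ±1` the largest has value `topTwo y + ε * signedMin
y`. With `d = signedMin y` and `e = x₀ - topTwo y`, the 22 rescaled walls therefore say `|d + ω| ≤
e`, `|d - s ω| ≤ e` and `2 |y_j| ≤ x₀`; inside them, a point lies in the model space exactly when `e
> 0` (`quad_neg_iff`).

Normalize `e = 1` and take `h = d + ω ∈ [-1, 1]` as height. The section at height `h` is described
like the cuboctahedron `C`, except that `d` ranges over `[(s h - 1)/(1 + s), (s h + 1)/(1 + s)]`
instead of `[-1, 1]`. Stretching the positive and the negative values of `d` separately, while the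
differences of the `|y_j|` are kept (`fold`), gives a homeomorphism with `C × [-1, 1]` that takes
the glued facets to the sides and the unpaired ones to top and bottom
(`nonempty_prismChart_rescaled`). Nothing degenerates at `t = 0`, and for `t ≠ 0` the polytope
itself is projectively equivalent to the rescaled one.

It remains to glue prisms. `C` is a strict fundamental domain of the reflection group, point
stabilizers are generated by the reflections in the faces through the point (`eq_and_mem_closure`),
and the translates of `C` are locally finite (`isProperMap_tile`). Hence the prisms glue to `𝒩 ×
[-1, 1]`, and doubling along top and bottom closes the interval up to a circle
(`PrismChart.nonempty_homeomorph`).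

The fundamental domain is obtained arithmetically. The group preserves the lattice `ℤ ⊕ √2 ℤ³` and
acts trivially on it modulo 2. Congruences then show that no mirror cuts `C` (`root_sign`), and that
the centre of `C` has trivial stabilizer and is the only point of its orbit in `C`. Every group
element can thus be reduced to the identity by reflections that lower the integral height of the
image of the centre (`descent_induction`). -/

/-! ### The reflection group of the cuboctahedron preserves a lattice -/

/-- The Lorentzian bilinear form. -/
def lorentz (x y : Fin 4 → ℝ) : ℝ := -(x 0 * y 0) + x 1 * y 1 + x 2 * y 2 + x 3 * y 3

theorem lorentz_comm (x y : Fin 4 → ℝ) : lorentz x y = lorentz y x := by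
  unfold lorentz; ring

theorem lorentz_self (x : Fin 4 → ℝ) : lorentz x x = quad3 x := by
  unfold lorentz quad3; ring

theorem lorentz_smul_left (c : ℝ) (x y : Fin 4 → ℝ) : lorentz (c • x) y = c * lorentz x y := by
  simp only [lorentz, Pi.smul_apply, smul_eq_mul]; ring

theorem lorentz_smul_right (c : ℝ) (x y : Fin 4 → ℝ) : lorentz x (c • y) = c * lorentz x y := by
  simp only [lorentz, Pi.smul_apply, smul_eq_mul]; ring

theorem lorentz_sub_left (x y z : Fin 4 → ℝ) :
    lorentz (x - y) z = lorentz x z - lorentz y z := by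
  simp only [lorentz, Pi.sub_apply]; ring

theorem lorentz_sub_right (x y z : Fin 4 → ℝ) :
    lorentz x (y - z) = lorentz x y - lorentz x z := by
  simp only [lorentz, Pi.sub_apply]; ring

/-- The outward unit normal vector to a side of the cuboctahedron. -/
noncomputable def sideVec (s : Side) : Fin 4 → ℝ := dualVec (sideNormal s)

theorem lorentz_sideVec (s : Side) (x : Fin 4 → ℝ) :
    lorentz (sideVec s) x = dotProduct (sideNormal s) x := by
  simp [lorentz, sideVec, dualVec, dotProduct, Fin.sum_univ_four]

theorem lorentz_sideVec_self (s : Side) : lorentz (sideVec s) (sideVec s) = 1 := by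
  have := twiceForm_sideNormal s
  rw [lorentz_sideVec]
  have h : twiceForm (sideNormal s) (dualVec (sideNormal s)) =
    2 * dotProduct (sideNormal s) (sideVec s) := rfl
  linarith

theorem sideReflection_apply (s : Side) (x : Fin 4 → ℝ) :
    sideReflection s x = x - (2 * lorentz (sideVec s) x) • sideVec s := by
  rw [lorentz_sideVec]
  rfl

theorem lorentz_sideReflection (s : Side) (x y : Fin 4 → ℝ) :
    lorentz (sideReflection s x) (sideReflection s y) = lorentz x y := by
  rw [sideReflection_apply, sideReflection_apply]
  simp only [lorentz_sub_left, lorentz_sub_right, lorentz_smul_left, lorentz_smul_right,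
    lorentz_sideVec_self, lorentz_comm x (sideVec s)]
  ring

theorem sideReflection_sideReflection (s : Side) (x : Fin 4 → ℝ) :
    sideReflection s (sideReflection s x) = x := by
  rw [sideReflection_apply, sideReflection_apply]
  simp only [lorentz_sub_right, lorentz_smul_right, lorentz_sideVec_self]
  module

theorem sideReflection_mul_self (s : Side) : sideReflection s * sideReflection s = 1 :=
  LinearEquiv.ext fun x => sideReflection_sideReflection s x

theorem sideReflection_inv (s : Side) : (sideReflection s)⁻¹ = sideReflection s :=
  inv_eq_of_mul_eq_one_left (sideReflection_mul_self s)

theorem sideReflection_mem (s : Side) : sideReflection s ∈ cuboctGroup :=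
  Subgroup.subset_closure ⟨s, rfl⟩

/-- The generators are involutions, so no separate case for inverses is needed. -/
theorem cuboctGroup_induction {p : ((Fin 4 → ℝ) ≃ₗ[ℝ] (Fin 4 → ℝ)) → Prop} (one : p 1)
    (mul : ∀ s g, p g → p (sideReflection s * g)) {g} (hg : g ∈ cuboctGroup) : p g := by
  induction hg using Subgroup.closure_induction_left with
  | one => exact one
  | mul_left x hx y _ hy =>
    obtain ⟨s, rfl⟩ := hx
    exact mul s y hy
  | inv_mul_cancel x hx y _ hy =>
    obtain ⟨s, rfl⟩ := hx
    rw [sideReflection_inv]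
    exact mul s y hy

theorem lorentz_map {g} (hg : g ∈ cuboctGroup) (x y : Fin 4 → ℝ) :
    lorentz (g x) (g y) = lorentz x y := by
  refine cuboctGroup_induction (p := fun g => lorentz (g x) (g y) = lorentz x y) rfl ?_ hg
  exact fun s g hg => (lorentz_sideReflection s (g x) (g y)).trans hg

theorem lorentz_map_left {g} (hg : g ∈ cuboctGroup) (x y : Fin 4 → ℝ) :
    lorentz (g x) y = lorentz x (g⁻¹ y) := by
  rw [← lorentz_map (inv_mem hg) (g x) y]
  congr 1
  exact g.symm_apply_apply x

/-- The points with integral coordinates after dividing the spatial coordinates by `√2`. -/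
noncomputable def latticeVec (v : Fin 4 → ℤ) : Fin 4 → ℝ :=
  ![v 0, √2 * v 1, √2 * v 2, √2 * v 3]

theorem lorentz_latticeVec (v w : Fin 4 → ℤ) : lorentz (latticeVec v) (latticeVec w) =
    ((-(v 0 * w 0) + 2 * (v 1 * w 1 + v 2 * w 2 + v 3 * w 3) : ℤ) : ℝ) := by
  have h : √2 * √2 = 2 := Real.mul_self_sqrt (by norm_num)
  simp only [lorentz, latticeVec, Matrix.cons_val]
  push_cast
  linear_combination (v 1 * w 1 + v 2 * w 2 + v 3 * w 3 : ℝ) * h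

/-- The entries of the sign vectors as integers. -/
def intSign : Fin 8 → Fin 3 → ℤ :=
  ![![1, 1, 1], ![1, -1, 1], ![1, -1, -1], ![1, 1, -1],
    ![-1, 1, -1], ![-1, 1, 1], ![-1, -1, 1], ![-1, -1, -1]]

theorem cast_intSign (i : Fin 8) (j : Fin 3) : (intSign i j : ℝ) = cubeSign i j := by
  fin_cases i <;> fin_cases j <;> simp [intSign, cubeSign]

/-- The primitive lattice vectors on the lines spanned by the normals. -/
def sideInt : Side → Fin 4 → ℤ
  | .tri i => ![2, intSign i 0, intSign i 1, intSign i 2]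
  | .quad X => ![1, ![1, 0, 0, 0, 0, -1] X, ![0, 1, 0, 0, -1, 0] X, ![0, 0, 1, -1, 0, 0] X]

/-- The ratio between the primitive lattice vector and the unit normal. -/
noncomputable def sideScale : Side → ℝ
  | .tri _ => √2
  | .quad _ => 1

theorem sideScale_pos (s : Side) : 0 < sideScale s := by
  cases s <;> simp [sideScale]

theorem sideScale_smul (s : Side) : sideScale s • sideVec s = latticeVec (sideInt s) := by
  have h : √2 * √2 = 2 := Real.mul_self_sqrt (by norm_num)
  rcases s with i | X
  · funext j
    fin_cases j <;> simp [sideScale, sideVec, dualVec, sideNormal, latticeVec, sideInt,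
      cast_intSign, h]
  · funext j
    fin_cases X <;> fin_cases j <;> simp [sideScale, sideVec, dualVec, sideNormal, quadNormal,
      latticeVec, sideInt]

/-- Half of the integral matrix `r - 1`, for the reflection `r` in a side. -/
def sideMatrix (s : Side) : Matrix (Fin 4) (Fin 4) ℤ :=
  Matrix.of fun i j => -(sideInt s i *
    match s with
    | .tri _ => ![-1, sideInt s 1, sideInt s 2, sideInt s 3] j
    | .quad _ => ![-1, 2 * sideInt s 1, 2 * sideInt s 2, 2 * sideInt s 3] j)

-- The coefficient `2 / sideScale s ^ 2` is 2 for quadrilaterals and 1 for triangles. In the latter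
-- case the pairing with `sideInt s` is even, because its time entry is 2. Either way the
-- displacement is twice an integral vector.
open scoped Matrix in
theorem sideReflection_latticeVec (s : Side) (v : Fin 4 → ℤ) :
    sideReflection s (latticeVec v) = latticeVec (v + 2 • (sideMatrix s *ᵥ v)) := by
  have h : √2 * √2 = 2 := Real.mul_self_sqrt (by norm_num)
  have key : sideReflection s (latticeVec v) = latticeVec v -
      (2 / sideScale s ^ 2 * lorentz (latticeVec (sideInt s)) (latticeVec v)) •
        latticeVec (sideInt s) := by
    rw [sideReflection_apply, ← sideScale_smul, lorentz_smul_left, smul_smul]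
    congr 2
    have := (sideScale_pos s).ne'
    field_simp
  rw [key, lorentz_latticeVec]
  rcases s with i | X
  · have h2 : (2 : ℝ) / sideScale (.tri i) ^ 2 = 1 := by
      rw [sideScale, sq, h]; norm_num
    rw [h2]
    funext j
    fin_cases j <;> simp [latticeVec, sideMatrix, sideInt, Matrix.mulVec, dotProduct,
      Fin.sum_univ_four] <;> ring
  · have h2 : (2 : ℝ) / sideScale (.quad X) ^ 2 = 2 := by
      rw [sideScale]; norm_num
    rw [h2]
    funext j
    fin_cases j <;> simp [latticeVec, sideMatrix, sideInt, Matrix.mulVec, dotProduct,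
      Fin.sum_univ_four] <;> ring

/-- For triangles the spatial entries are products of signs, hence all odd; for quadrilaterals they
carry a factor 2. That diagonal and off-diagonal entries have the same parity is what later excludes
changing the sign of a coordinate. -/
theorem sideMatrix_mod_two (s : Side) :
    ∃ κ : ℤ, ∀ i j : Fin 3, (2 : ℤ) ∣ sideMatrix s i.succ j.succ - κ := by
  rcases s with i | X
  · refine ⟨1, ?_⟩
    revert i
    decide
  · refine ⟨0, ?_⟩
    revert X
    decide

open scoped Matrix in
/-- The elements of the group preserve the lattice, and satisfy congruences modulo four. -/
theorem exists_matrix {g} (hg : g ∈ cuboctGroup) : ∃ (K : Matrix (Fin 4) (Fin 4) ℤ) (κ : ℤ),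
    (∀ v, g (latticeVec v) = latticeVec (v + 2 • (K *ᵥ v))) ∧
    ∀ i j : Fin 3, (2 : ℤ) ∣ K i.succ j.succ - κ := by
  refine cuboctGroup_induction (p := fun g => ∃ (K : Matrix (Fin 4) (Fin 4) ℤ) (κ : ℤ),
    (∀ v, g (latticeVec v) = latticeVec (v + 2 • (K *ᵥ v))) ∧
    ∀ i j : Fin 3, (2 : ℤ) ∣ K i.succ j.succ - κ) ⟨0, 0, by simp, by simp⟩ ?_ hg
  rintro s g ⟨K, κ, hK, hκ⟩
  obtain ⟨κ', hκ'⟩ := sideMatrix_mod_two s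
  -- From `(1 + 2S)(1 + 2K) = 1 + 2(K + S + 2SK)`; the last term is invisible modulo 2.
  refine ⟨K + sideMatrix s + 2 • (sideMatrix s * K), κ + κ', fun v => ?_, fun i j => ?_⟩
  · rw [LinearEquiv.mul_apply, hK, sideReflection_latticeVec]
    congr 1
    simp only [Matrix.add_mulVec, Matrix.mulVec_add, Matrix.smul_mulVec, Matrix.mulVec_smul,
      Matrix.mulVec_mulVec]
    module
  · have e : (K + sideMatrix s + 2 • (sideMatrix s * K)) i.succ j.succ - (κ + κ') =
        (K i.succ j.succ - κ) + (sideMatrix s i.succ j.succ - κ') +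
          2 * (sideMatrix s * K) i.succ j.succ := by
      simp only [Matrix.add_apply, Matrix.smul_apply]
      simp only [nsmul_eq_mul]
      push_cast
      ring
    rw [e]
    exact dvd_add (dvd_add (hκ i j) (hκ' i j)) (dvd_mul_right _ _)

theorem exists_latticeVec {g} (hg : g ∈ cuboctGroup) (v : Fin 4 → ℤ) :
    ∃ w, g (latticeVec v) = latticeVec w ∧ ∀ i, (2 : ℤ) ∣ w i - v i := by
  obtain ⟨K, κ, hK, -⟩ := exists_matrix hg
  exact ⟨_, hK v, fun i => by simp⟩

/-! ### Roots do not cut the cuboctahedron -/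

/-- The cone over the cuboctahedron. -/
def sideCone : Set (Fin 4 → ℝ) := {x | ∀ s, lorentz (sideVec s) x ≤ 0}

theorem sideCone_quad {x : Fin 4 → ℝ} (hx : x ∈ sideCone) :
    √2 * |x 1| ≤ x 0 ∧ √2 * |x 2| ≤ x 0 ∧ √2 * |x 3| ≤ x 0 := by
  have h0 := hx (.quad 0)
  have h1 := hx (.quad 1)
  have h2 := hx (.quad 2)
  have h3 := hx (.quad 3)
  have h4 := hx (.quad 4)
  have h5 := hx (.quad 5)
  simp only [lorentz_sideVec, sideNormal, quadNormal, dotProduct, Fin.sum_univ_four,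
    Matrix.cons_val] at h0 h1 h2 h3 h4 h5
  refine ⟨?_, ?_, ?_⟩
  · rcases abs_cases (x 1) with ⟨h, -⟩ | ⟨h, -⟩ <;> rw [h] <;> linarith
  · rcases abs_cases (x 2) with ⟨h, -⟩ | ⟨h, -⟩ <;> rw [h] <;> linarith
  · rcases abs_cases (x 3) with ⟨h, -⟩ | ⟨h, -⟩ <;> rw [h] <;> linarith

theorem sideCone_tri {x : Fin 4 → ℝ} (hx : x ∈ sideCone) :
    |x 1| + |x 2| + |x 3| ≤ √2 * x 0 := by
  have h := fun i => hx (.tri i)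
  simp only [lorentz_sideVec, sideNormal, dotProduct, Fin.sum_univ_four,
    Matrix.cons_val] at h
  have h0 := h 0
  have h1 := h 1
  have h2 := h 2
  have h3 := h 3
  have h4 := h 4
  have h5 := h 5
  have h6 := h 6
  have h7 := h 7
  simp only [cubeSign, Matrix.cons_val] at h0 h1 h2 h3 h4 h5 h6 h7
  cases abs_cases (x 1) <;> cases abs_cases (x 2) <;> cases abs_cases (x 3) <;> linarith

/-- The pairwise sums of the weights are, up to scale, the values of the form at the ideal vertices
`(√2 : ±1 : ±1 : 0)` and their permutations, which span the cone. For `q₁ ≥ q₂ ≥ q₃` and `y_j = √2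
|x_j|`, write the sum as `(q₁ - q₂) y₁ + q₂ (y₁ + y₂ + y₃) - (q₂ - q₃) y₃` and use `y₁ ≤ x₀` and `y₁
+ y₂ + y₃ ≤ 2 x₀`. -/
theorem sideCone_bound {x : Fin 4 → ℝ} (hx : x ∈ sideCone) {p q₁ q₂ q₃ : ℝ} (h₁ : 0 ≤ q₁)
    (h₂ : 0 ≤ q₂) (h₃ : 0 ≤ q₃) (h₁₂ : q₁ + q₂ ≤ p) (h₁₃ : q₁ + q₃ ≤ p) (h₂₃ : q₂ + q₃ ≤ p) :
    √2 * (q₁ * |x 1| + q₂ * |x 2| + q₃ * |x 3|) ≤ p * x 0 := by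
  have h : √2 * √2 = 2 := Real.mul_self_sqrt (by norm_num)
  obtain ⟨a₁, a₂, a₃⟩ := sideCone_quad hx
  have a := mul_le_mul_of_nonneg_left (sideCone_tri hx) (Real.sqrt_nonneg 2)
  rw [← mul_assoc, h, mul_add, mul_add] at a
  have n₁ := mul_nonneg (Real.sqrt_nonneg 2) (abs_nonneg (x 1))
  have n₂ := mul_nonneg (Real.sqrt_nonneg 2) (abs_nonneg (x 2))
  have n₃ := mul_nonneg (Real.sqrt_nonneg 2) (abs_nonneg (x 3))
  have e : √2 * (q₁ * |x 1| + q₂ * |x 2| + q₃ * |x 3|) =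
    q₁ * (√2 * |x 1|) + q₂ * (√2 * |x 2|) + q₃ * (√2 * |x 3|) := by ring
  rw [e]
  generalize √2 * |x 1| = y₁ at *
  generalize √2 * |x 2| = y₂ at *
  generalize √2 * |x 3| = y₃ at *
  have sorted : ∀ {q₁ q₂ q₃ y₁ y₂ y₃ : ℝ}, 0 ≤ q₃ → q₃ ≤ q₂ → q₂ ≤ q₁ → 0 ≤ y₁ → 0 ≤ y₂ → 0 ≤ y₃ →
      y₁ ≤ x 0 → y₁ + y₂ + y₃ ≤ 2 * x 0 → q₁ + q₂ ≤ p →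
      q₁ * y₁ + q₂ * y₂ + q₃ * y₃ ≤ p * x 0 := by
    intro q₁ q₂ q₃ y₁ y₂ y₃ h₃ h₃₂ h₂₁ n₁ n₂ n₃ a₁ a hp
    have i₁ := mul_le_mul_of_nonneg_left a₁ (sub_nonneg.2 h₂₁)
    have i₂ := mul_le_mul_of_nonneg_left a (h₃.trans h₃₂)
    have i₃ := mul_le_mul_of_nonneg_right h₃₂ n₃
    have i₄ := mul_le_mul_of_nonneg_right hp (n₁.trans a₁)
    linarith
  rcases le_total q₁ q₂ with u | u <;> rcases le_total q₁ q₃ with v | v <;>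
    rcases le_total q₂ q₃ with w | w
  · linarith [sorted h₁ u w n₃ n₂ n₁ a₃ (by linarith) (by linarith)]
  · linarith [sorted h₁ v w n₂ n₃ n₁ a₂ (by linarith) (by linarith)]
  · linarith [sorted h₁ u w n₃ n₂ n₁ a₃ (by linarith) (by linarith)]
  · linarith [sorted h₃ v u n₂ n₁ n₃ a₂ (by linarith) (by linarith)]
  · linarith [sorted h₂ u v n₃ n₁ n₂ a₃ (by linarith) (by linarith)]
  · linarith [sorted h₂ u v n₃ n₁ n₂ a₃ (by linarith) (by linarith)]
  · linarith [sorted h₂ w v n₁ n₃ n₂ a₁ (by linarith) (by linarith)]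
  · linarith [sorted h₃ w u n₁ n₂ n₃ a₁ (by linarith) (by linarith)]

theorem lorentz_latticeVec_nonpos {x : Fin 4 → ℝ} (hx : x ∈ sideCone) {v : Fin 4 → ℤ}
    (h₁₂ : |v 1| + |v 2| ≤ v 0) (h₁₃ : |v 1| + |v 3| ≤ v 0) (h₂₃ : |v 2| + |v 3| ≤ v 0) :
    lorentz (latticeVec v) x ≤ 0 := by
  have b := sideCone_bound hx (p := v 0) (abs_nonneg (v 1 : ℝ)) (abs_nonneg (v 2 : ℝ))
    (abs_nonneg (v 3 : ℝ)) (by exact_mod_cast h₁₂) (by exact_mod_cast h₁₃) (by exact_mod_cast h₂₃)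
  rw [← abs_mul, ← abs_mul, ← abs_mul] at b
  have i := mul_le_mul_of_nonneg_left (add_le_add (add_le_add (le_abs_self (v 1 * x 1 : ℝ))
    (le_abs_self (v 2 * x 2 : ℝ))) (le_abs_self (v 3 * x 3 : ℝ))) (Real.sqrt_nonneg 2)
  simp only [lorentz, latticeVec, Matrix.cons_val]
  linarith

/-- This is `(|a| + |b|)² = 2(a² + b²) - (|a| - |b|)²`. It is applied to the integral vectors on the
lines of the roots, with `p` the time coordinate. -/
theorem abs_add_abs_le {p a b : ℤ} (h : 2 * (a ^ 2 + b ^ 2) ≤ p ^ 2 + (|a| - |b|) ^ 2) :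
    |a| + |b| ≤ |p| := by
  refine (le_abs_self _).trans (sq_le_sq.1 ?_)
  have ha := sq_abs a
  have hb := sq_abs b
  linarith [show (|a| + |b|) ^ 2 = 2 * (|a| ^ 2 + |b| ^ 2) - (|a| - |b|) ^ 2 by ring]

theorem abs_add_abs_le_of_odd {p a b c : ℤ} (h : 2 * (a ^ 2 + b ^ 2 + c ^ 2) = 2 + p ^ 2)
    (hc : Odd c) : |a| + |b| ≤ |p| := by
  refine abs_add_abs_le ?_
  have hc0 : c ≠ 0 := by
    rintro rfl
    simp at hc
  have : 1 ≤ c ^ 2 := Int.one_le_abs (pow_ne_zero 2 hc0) |>.trans_eq (abs_of_nonneg (sq_nonneg c))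
  nlinarith [sq_nonneg (|a| - |b|)]

/-- The norm leaves an excess of 1 to absorb. If `c ≠ 0`, the term `2c²` does it; if `c = 0`, then
`a + b` is odd, so `|a| ≠ |b|` and `(|a| - |b|)² ≥ 1`. -/
theorem abs_add_abs_le_of_odd_add {p a b c : ℤ} (h : 2 * (a ^ 2 + b ^ 2 + c ^ 2) = 1 + p ^ 2)
    (ho : Odd (a + b + c)) : |a| + |b| ≤ |p| := by
  refine abs_add_abs_le ?_
  rcases eq_or_ne c 0 with rfl | hc
  · have hne : |a| - |b| ≠ 0 := by
      intro h0
      rw [sub_eq_zero, abs_eq_abs] at h0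
      rcases h0 with rfl | rfl <;> rw [Int.odd_iff] at ho <;> omega
    have : 1 ≤ (|a| - |b|) ^ 2 :=
      Int.one_le_abs (pow_ne_zero 2 hne) |>.trans_eq (abs_of_nonneg (sq_nonneg _))
    linarith
  · have : 1 ≤ c ^ 2 :=
      Int.one_le_abs (pow_ne_zero 2 hc) |>.trans_eq (abs_of_nonneg (sq_nonneg c))
    nlinarith [sq_nonneg (|a| - |b|)]

theorem sideInt_sq (s : Side) :
    -(sideInt s 0 * sideInt s 0) + 2 * (sideInt s 1 * sideInt s 1 +
      sideInt s 2 * sideInt s 2 + sideInt s 3 * sideInt s 3) = 2 ∧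
      Odd (sideInt s 1) ∧ Odd (sideInt s 2) ∧ Odd (sideInt s 3) ∨
    -(sideInt s 0 * sideInt s 0) + 2 * (sideInt s 1 * sideInt s 1 +
      sideInt s 2 * sideInt s 2 + sideInt s 3 * sideInt s 3) = 1 ∧
      Odd (sideInt s 1 + sideInt s 2 + sideInt s 3) := by
  rcases s with i | X
  · refine Or.inl ?_
    revert i; decide
  · refine Or.inr ?_
    revert X; decide

theorem odd_of_two_dvd_sub {a b : ℤ} (h : (2 : ℤ) ∣ a - b) (hb : Odd b) : Odd a := by
  obtain ⟨k, hk⟩ := h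
  obtain ⟨l, hl⟩ := hb
  exact ⟨k + l, by linarith⟩

theorem latticeVec_neg (v : Fin 4 → ℤ) : latticeVec (-v) = -latticeVec v := by
  funext i
  fin_cases i <;> simp [latticeVec]

/-- No mirror of the group cuts the cuboctahedron. The scaled root is a lattice vector of norm 2 or
1 with the parities of `sideInt s`. These force `|v_i| + |v_j| ≤ |v_0|`, so the root has constant
sign at the ideal vertices, the sign being decided by `v 0`. -/
theorem root_sign {g} (hg : g ∈ cuboctGroup) (s : Side) :
    (∀ x ∈ sideCone, lorentz (g (sideVec s)) x ≤ 0) ∨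
      (∀ x ∈ sideCone, 0 ≤ lorentz (g (sideVec s)) x) := by
  obtain ⟨v, hv, hmod⟩ := exists_latticeVec hg (sideInt s)
  have hq : lorentz (latticeVec v) (latticeVec v) =
      lorentz (latticeVec (sideInt s)) (latticeVec (sideInt s)) := by
    rw [← hv, lorentz_map hg]
  rw [lorentz_latticeVec, lorentz_latticeVec, Int.cast_inj] at hq
  have key : |v 1| + |v 2| ≤ |v 0| ∧ |v 1| + |v 3| ≤ |v 0| ∧ |v 2| + |v 3| ≤ |v 0| := by
    rcases sideInt_sq s with ⟨hs, o₁, o₂, o₃⟩ | ⟨hs, o⟩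
    · rw [hs] at hq
      exact ⟨abs_add_abs_le_of_odd (c := v 3) (by linarith) (odd_of_two_dvd_sub (hmod 3) o₃),
        abs_add_abs_le_of_odd (c := v 2) (by linarith) (odd_of_two_dvd_sub (hmod 2) o₂),
        abs_add_abs_le_of_odd (c := v 1) (by linarith) (odd_of_two_dvd_sub (hmod 1) o₁)⟩
    · rw [hs] at hq
      have o' : Odd (v 1 + v 2 + v 3) := by
        refine odd_of_two_dvd_sub ?_ o
        have h1 := hmod 1
        have h2 := hmod 2
        have h3 := hmod 3
        omega
      exact ⟨abs_add_abs_le_of_odd_add (c := v 3) (by linarith) o',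
        abs_add_abs_le_of_odd_add (c := v 2) (by linarith) (by convert o' using 1; ring),
        abs_add_abs_le_of_odd_add (c := v 1) (by linarith) (by convert o' using 1; ring)⟩
  have hc := sideScale_pos s
  have hsc : ∀ x, sideScale s * lorentz (g (sideVec s)) x = lorentz (latticeVec v) x := by
    intro x
    rw [← lorentz_smul_left, ← map_smul, sideScale_smul, hv]
  rcases le_total 0 (v 0) with h0 | h0
  · rw [abs_of_nonneg h0] at key
    left
    intro x hx
    have := lorentz_latticeVec_nonpos hx key.1 key.2.1 key.2.2
    rw [← hsc] at this
    nlinarith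
  · rw [abs_of_nonpos h0] at key
    right
    intro x hx
    have := lorentz_latticeVec_nonpos (v := -v) hx (by simpa using key.1) (by simpa using key.2.1)
      (by simpa using key.2.2)
    rw [latticeVec_neg, ← neg_one_smul ℝ, lorentz_smul_left, ← hsc] at this
    nlinarith

/-! ### The orbit of the centre -/

/-- The centre of the cuboctahedron. -/
def center : Fin 4 → ℤ := ![1, 0, 0, 0]

theorem lorentz_center (x : Fin 4 → ℝ) : lorentz (latticeVec center) x = -x 0 := by
  simp [lorentz, latticeVec, center]

/-! ### Timelike vectors and the reversed Cauchy–Schwarz inequality. -/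

/-- The cone of future timelike vectors. -/
def future : Set (Fin 4 → ℝ) := {x | quad3 x < 0 ∧ 0 < x 0}

theorem center_mem_future : latticeVec center ∈ future := by
  simp [future, quad3, latticeVec, center]

theorem sqrt_sum_lt_of_mem_future {x : Fin 4 → ℝ} (hx : x ∈ future) :
    √(x 1 ^ 2 + x 2 ^ 2 + x 3 ^ 2) < x 0 := by
  rw [Real.sqrt_lt' hx.2]
  have := hx.1
  unfold quad3 at this
  linarith

theorem dot_le_sqrt_mul_sqrt (x y : Fin 4 → ℝ) : x 1 * y 1 + x 2 * y 2 + x 3 * y 3 ≤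
    √(x 1 ^ 2 + x 2 ^ 2 + x 3 ^ 2) * √(y 1 ^ 2 + y 2 ^ 2 + y 3 ^ 2) := by
  rw [← Real.sqrt_mul (by positivity)]
  refine Real.le_sqrt_of_sq_le ?_
  nlinarith [sq_nonneg (x 1 * y 2 - x 2 * y 1), sq_nonneg (x 1 * y 3 - x 3 * y 1),
    sq_nonneg (x 2 * y 3 - x 3 * y 2)]

/-- The first vector is arbitrary so that the bound can be used quantitatively: when it is timelike,
a bounded pairing with `y` bounds the height of `y`, which yields the finiteness statements. -/
theorem lorentz_le_of_mem_future (x : Fin 4 → ℝ) {y : Fin 4 → ℝ} (hy : y ∈ future) :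
    lorentz x y ≤ -(x 0 - √(x 1 ^ 2 + x 2 ^ 2 + x 3 ^ 2)) * y 0 := by
  have h := dot_le_sqrt_mul_sqrt x y
  have h' := mul_le_mul_of_nonneg_left (sqrt_sum_lt_of_mem_future hy).le
    (Real.sqrt_nonneg (x 1 ^ 2 + x 2 ^ 2 + x 3 ^ 2))
  unfold lorentz
  linarith

theorem lorentz_neg_of_mem_future {x y : Fin 4 → ℝ} (hx : x ∈ future) (hy : y ∈ future) :
    lorentz x y < 0 := by
  have := mul_pos (sub_pos.2 (sqrt_sum_lt_of_mem_future hx)) hy.2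
  linarith [lorentz_le_of_mem_future x hy]

/-- The height of a reflected vector is minus its pairing with the centre, that is, minus the
pairing of the vector with the reflected centre. The latter is future because its height is `1 + 2
(sideVec s 0)²`. -/
theorem map_mem_future {g} (hg : g ∈ cuboctGroup) {x : Fin 4 → ℝ} (hx : x ∈ future) :
    g x ∈ future := by
  refine cuboctGroup_induction (p := fun g => g x ∈ future) hx ?_ hg
  intro s g hg
  have key : ∀ x y, quad3 (sideReflection s x) = quad3 x ∧
      lorentz (sideReflection s x) y = lorentz x (sideReflection s y) := by
    intro x y
    refine ⟨?_, ?_⟩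
    · rw [← lorentz_self, ← lorentz_self, lorentz_sideReflection]
    · rw [← lorentz_sideReflection s x, sideReflection_sideReflection]
  have hc : sideReflection s (latticeVec center) ∈ future := by
    refine ⟨?_, ?_⟩
    · rw [(key _ 0).1]
      exact center_mem_future.1
    · rw [sideReflection_apply, lorentz_comm, lorentz_center]
      have : (latticeVec center) 0 = 1 := by simp [latticeVec, center]
      simp only [Pi.sub_apply, Pi.smul_apply, smul_eq_mul, this]
      nlinarith [sq_nonneg (sideVec s 0)]
  refine ⟨?_, ?_⟩
  · exact (key (g x) 0).1.trans_lt hg.1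
  · have h1 := lorentz_neg_of_mem_future hg hc
    rw [← (key _ _).2, lorentz_comm, lorentz_center] at h1
    exact neg_lt_zero.1 h1

/-- The norm equation reads `e² + 2e(a + b) - (a - b)² - 2c² = 1`. Since `a - b ≤ e` and `c ≤ b, e`,
the left side is at least `e² + e a + e b`, which exceeds 1 as soon as `e, a ≥ 1`. -/
theorem eq_zero_of_center_ineq {e a b c p : ℤ} (he : Odd e) (hp : p = e + a + b) (hc : 0 ≤ c)
    (hcb : c ≤ b) (hba : b ≤ a) (hce : c ≤ e) (hae : a ≤ e + b)
    (h : p ^ 2 - 2 * (a ^ 2 + b ^ 2 + c ^ 2) = 1) : a = 0 := by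
  have he1 : 1 ≤ e := by
    rcases he with ⟨k, rfl⟩
    omega
  subst hp
  by_contra hne
  have ha : 1 ≤ a := by omega
  nlinarith [mul_nonneg (sub_nonneg.2 hae) (sub_nonneg.2 hba), mul_nonneg hc (sub_nonneg.2 hce),
    mul_nonneg (sub_nonneg.2 hcb) (hc.trans hce), mul_nonneg (sub_nonneg.2 hcb) hc,
    mul_pos (zero_lt_one.trans_le he1) (zero_lt_one.trans_le ha),
    mul_nonneg (sub_nonneg.2 he1) (sub_nonneg.2 ha), mul_nonneg (hc.trans hcb) (hc.trans hce)]

/-- Modulo 2 the time coordinate is odd and the spatial ones are even, so the gap between the time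
coordinate and the two largest spatial ones is odd, in particular nonzero. -/
theorem eq_center_of_mem_sideCone {v : Fin 4 → ℤ} (hmod : ∀ i, (2 : ℤ) ∣ v i - center i)
    (hq : lorentz (latticeVec v) (latticeVec v) = -1) (hv : latticeVec v ∈ sideCone) :
    v = center := by
  have h : √2 * √2 = 2 := Real.mul_self_sqrt (by norm_num)
  have h0 : 0 < √2 := by positivity
  obtain ⟨a₁, a₂, a₃⟩ := sideCone_quad hv
  have a := sideCone_tri hv
  simp only [latticeVec, Matrix.cons_val, abs_mul, abs_of_pos h0, ← mul_assoc, h] at a₁ a₂ a₃ a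
  rw [← mul_add, ← mul_add] at a
  replace a := le_of_mul_le_mul_left a h0
  norm_cast at a₁ a₂ a₃ a
  rw [lorentz_latticeVec, show (-1 : ℝ) = ((-1 : ℤ) : ℝ) by norm_num, Int.cast_inj] at hq
  have m0 := hmod 0
  have m1 := hmod 1
  have m2 := hmod 2
  have m3 := hmod 3
  simp only [center, Matrix.cons_val, sub_zero] at m0 m1 m2 m3
  have n₁ := abs_nonneg (v 1)
  have n₂ := abs_nonneg (v 2)
  have n₃ := abs_nonneg (v 3)
  rw [← dvd_abs] at m1 m2 m3
  have hq' : v 0 ^ 2 - 2 * (|v 1| ^ 2 + |v 2| ^ 2 + |v 3| ^ 2) = 1 := by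
    simp only [sq_abs]
    linarith
  have sorted : ∀ {x y z : ℤ}, 2 ∣ x → 2 ∣ y → 0 ≤ z → z ≤ y → y ≤ x → 2 * x ≤ v 0 →
      x + y + z ≤ v 0 → v 0 ^ 2 - 2 * (x ^ 2 + y ^ 2 + z ^ 2) = 1 → x = 0 ∧ y = 0 ∧ z = 0 := by
    intro x y z hx hy hz hzy hyx h2 h3 h
    have hx0 := eq_zero_of_center_ineq (e := v 0 - x - y) (by rw [Int.odd_iff]; omega)
      (by ring) hz hzy hyx (by linarith) (by linarith) h
    omega
  have hz : |v 1| = 0 ∧ |v 2| = 0 ∧ |v 3| = 0 := by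
    rcases le_total |v 1| |v 2| with u | u <;> rcases le_total |v 1| |v 3| with w | w <;>
      rcases le_total |v 2| |v 3| with z | z
    · have := sorted m3 m2 n₁ u z a₃ (by linarith) (by linarith); tauto
    · have := sorted m2 m3 n₁ w z a₂ (by linarith) (by linarith); tauto
    · have := sorted m3 m2 n₁ u z a₃ (by linarith) (by linarith); tauto
    · have := sorted m2 m1 n₃ w u a₂ (by linarith) (by linarith); tauto
    · have := sorted m3 m1 n₂ u w a₃ (by linarith) (by linarith); tauto
    · have := sorted m3 m1 n₂ u w a₃ (by linarith) (by linarith); tauto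
    · have := sorted m1 m3 n₂ z w a₁ (by linarith) (by linarith); tauto
    · have := sorted m1 m2 n₃ z u a₁ (by linarith) (by linarith); tauto
  simp only [abs_eq_zero] at hz
  have hp : 0 ≤ v 0 := by linarith
  have hv0 : v 0 = 1 := by
    rw [hz.1, hz.2.1, hz.2.2] at hq
    nlinarith
  funext i
  fin_cases i <;> simp [center, hz, hv0]

/-- The diagonal entry `1 + 2 k₁` is odd, so it uses up the whole norm and `k₁` is 0 or -1; the
parity shared with `k₂ = 0` excludes -1. -/
theorem eq_zero_of_unit_column {k₁ k₂ k₃ κ : ℤ}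
    (h : (1 + 2 * k₁) ^ 2 + (2 * k₂) ^ 2 + (2 * k₃) ^ 2 = 1)
    (h₁ : 2 ∣ k₁ - κ) (h₂ : 2 ∣ k₂ - κ) : k₁ = 0 ∧ k₂ = 0 ∧ k₃ = 0 := by
  have hne : 1 + 2 * k₁ ≠ 0 := by omega
  have h1 : 1 ≤ (1 + 2 * k₁) ^ 2 :=
    Int.one_le_abs (pow_ne_zero 2 hne) |>.trans_eq (abs_of_nonneg (sq_nonneg _))
  have hk₂ : k₂ = 0 := by nlinarith [sq_nonneg k₂, sq_nonneg k₃]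
  have hk₃ : k₃ = 0 := by nlinarith [sq_nonneg k₂, sq_nonneg k₃]
  subst hk₂ hk₃
  have hk₁ : k₁ * (k₁ + 1) = 0 := by linarith
  rcases mul_eq_zero.1 hk₁ with h | h <;> omega

/-- Such an element preserves the orthogonal complement of the centre, hence acts on it by an
integral orthogonal matrix congruent to 1 modulo 2, that is, by sign changes; the congruence modulo
4 leaves only the identity. -/
theorem eq_one_of_map_center {g} (hg : g ∈ cuboctGroup)
    (h : g (latticeVec center) = latticeVec center) : g = 1 := by
  obtain ⟨K, κ, hK, hκ⟩ := exists_matrix hg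
  have hcol : ∀ (j : Fin 3), g (latticeVec (Pi.single j.succ 1)) =
      latticeVec (Pi.single j.succ 1) := by
    intro j
    have hq : ∀ u : Fin 4 → ℤ, g (latticeVec (Pi.single j.succ 1)) = latticeVec u →
        u 0 = 0 ∧ u 1 ^ 2 + u 2 ^ 2 + u 3 ^ 2 = 1 := by
      intro u hu
      have hu0 : u 0 = 0 := by
        have : lorentz (latticeVec center) (latticeVec u) = 0 := by
          rw [← hu, ← h, lorentz_map hg, lorentz_center]
          simp [latticeVec, Pi.single_apply]
        rw [lorentz_center] at this
        simpa [latticeVec] using this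
      have : lorentz (latticeVec u) (latticeVec u) = (2 : ℤ) := by
        rw [← hu, lorentz_map hg, lorentz_latticeVec]
        fin_cases j <;> simp
      rw [lorentz_latticeVec, hu0, Int.cast_inj] at this
      exact ⟨hu0, by linarith⟩
    have hk : ∀ i, (Pi.single j.succ 1 + 2 • (K.mulVec (Pi.single j.succ 1)) : Fin 4 → ℤ) i =
        (Pi.single j.succ 1 : Fin 4 → ℤ) i + 2 * K i j.succ := by
      intro i
      simp
    obtain ⟨h0, h1⟩ := hq _ (hK _)
    rw [hK]
    congr 1
    have e1 := hκ 0 j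
    have e2 := hκ 1 j
    have e3 := hκ 2 j
    simp only [hk] at h0 h1
    fin_cases j
    · simp at h0 h1 e1 e2 e3
      have := eq_zero_of_unit_column (by simpa using h1) e1 e2
      funext i
      rw [hk]
      fin_cases i <;> simp [this, h0]
    · simp at h0 h1 e1 e2 e3
      have := eq_zero_of_unit_column (k₁ := K 2 2) (k₂ := K 1 2) (k₃ := K 3 2) (by linarith) e2 e1
      funext i
      rw [hk]
      fin_cases i <;> simp [this, h0]
    · simp at h0 h1 e1 e2 e3
      have := eq_zero_of_unit_column (k₁ := K 3 3) (k₂ := K 1 3) (k₃ := K 2 3) (by linarith) e3 e1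
      funext i
      rw [hk]
      fin_cases i <;> simp [this, h0]
  refine LinearEquiv.ext fun x => ?_
  have hx : x = x 0 • latticeVec center + (x 1 / √2) • latticeVec (Pi.single (Fin.succ 0) 1) +
      (x 2 / √2) • latticeVec (Pi.single (Fin.succ 1) 1) +
      (x 3 / √2) • latticeVec (Pi.single (Fin.succ 2) 1) := by
    funext i
    fin_cases i <;> simp [latticeVec, center]
  rw [hx]
  simp only [map_add, map_smul, hcol, h, LinearEquiv.coe_one, id_eq]

/-! ### The cuboctahedron is a strict fundamental domain -/

theorem sideVec_zero_pos (s : Side) : 0 < sideVec s 0 := by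
  rcases s with i | X
  · simp [sideVec, dualVec, sideNormal]
  · fin_cases X <;> simp [sideVec, dualVec, sideNormal, quadNormal]

theorem sideReflection_apply_zero_lt {s : Side} {x : Fin 4 → ℝ} (h : 0 < lorentz (sideVec s) x) :
    sideReflection s x 0 < x 0 := by
  rw [sideReflection_apply]
  have := mul_pos h (sideVec_zero_pos s)
  simp only [Pi.sub_apply, Pi.smul_apply, smul_eq_mul]
  linarith

theorem center_mem_sideCone : latticeVec center ∈ sideCone := by
  intro s
  rw [lorentz_comm, lorentz_center]
  exact (neg_neg_of_pos (sideVec_zero_pos s)).le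

/-- Every element of the group is obtained from the identity by reflections which increase the
height of the image of the centre. -/
theorem descent_induction {p : ((Fin 4 → ℝ) ≃ₗ[ℝ] (Fin 4 → ℝ)) → Prop} (one : p 1)
    (step : ∀ s, ∀ g ∈ cuboctGroup, 0 < lorentz (sideVec s) (g (latticeVec center)) →
      p (sideReflection s * g) → p g) {g} (hg : g ∈ cuboctGroup) : p g := by
  -- The heights of the images of the centre are positive integers, so a strict decrease is a
  -- decrease by at least 1.
  have main : ∀ n : ℕ, ∀ g ∈ cuboctGroup, g (latticeVec center) 0 ≤ n → p g := by
    intro n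
    induction n with
    | zero =>
      intro g hg h
      have := (map_mem_future hg center_mem_future).2
      norm_num at h
      linarith
    | succ n ih =>
      intro g hg h
      obtain ⟨w, hw, hmod⟩ := exists_latticeVec hg center
      by_cases hc : latticeVec w ∈ sideCone
      · have hwc : w = center := by
          refine eq_center_of_mem_sideCone hmod ?_ hc
          rw [← hw, lorentz_map hg, lorentz_center]
          simp [latticeVec, center]
        rw [eq_one_of_map_center hg (hw.trans (by rw [hwc]))]
        exact one
      · simp only [sideCone, Set.mem_ofPred_eq, not_forall, not_le] at hc
        obtain ⟨s, hs⟩ := hc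
        rw [← hw] at hs
        have hsg := mul_mem (sideReflection_mem s) hg
        refine step s g hg hs (ih _ hsg ?_)
        obtain ⟨w', hw', -⟩ := exists_latticeVec hsg center
        have hlt := sideReflection_apply_zero_lt hs
        change (sideReflection s * g) (latticeVec center) 0 < _ at hlt
        rw [hw', hw] at hlt
        rw [hw] at h
        rw [hw']
        simp only [latticeVec, Matrix.cons_val_zero] at h hlt ⊢
        norm_cast at h hlt ⊢
        omega
  obtain ⟨n, hn⟩ := exists_nat_ge (g (latticeVec center) 0)
  exact main n g hg hn

theorem sideReflection_eq_self {s : Side} {x : Fin 4 → ℝ} (h : lorentz (sideVec s) x = 0) :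
    sideReflection s x = x := by
  rw [sideReflection_apply, h]
  simp

/-- Two points of the cone over the cuboctahedron in the same orbit agree, and the stabilizers are
generated by reflections in the sides. -/
theorem eq_and_mem_closure {x : Fin 4 → ℝ} (hx : x ∈ sideCone) {g} (hg : g ∈ cuboctGroup)
    (hgx : g x ∈ sideCone) : g x = x ∧
      g ∈ Subgroup.closure (sideReflection '' {s | lorentz (sideVec s) x = 0}) := by
  refine descent_induction (p := fun g => g x ∈ sideCone → g x = x ∧
    g ∈ Subgroup.closure (sideReflection '' {s | lorentz (sideVec s) x = 0}))
    (fun _ => ⟨rfl, one_mem _⟩) ?_ hg hgx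
  intro s g hg hs ih hgx
  have hroot : ∀ y, lorentz (g⁻¹ (sideVec s)) y = lorentz (sideVec s) (g y) := fun y => by
    rw [lorentz_map_left (inv_mem hg), inv_inv]
  -- The root `g⁻¹ (sideVec s)` is positive at the centre, hence nonnegative on the whole cone, in
  -- particular at `x`; since `g x` is in the cone, it is also nonpositive there. Thus the
  -- reflection fixes `g x`.
  have h0 : lorentz (sideVec s) (g x) = 0 := by
    rcases root_sign (inv_mem hg) s with h | h
    · have := h _ center_mem_sideCone
      rw [hroot] at this
      exact absurd hs this.not_gt
    · have := h _ hx
      rw [hroot] at this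
      exact le_antisymm (hgx s) this
  have hr : (sideReflection s * g) x = g x := sideReflection_eq_self h0
  obtain ⟨e, m⟩ := ih (hr ▸ hgx)
  rw [hr] at e
  refine ⟨e, ?_⟩
  rw [e] at h0
  have := mul_mem (Subgroup.subset_closure ⟨s, h0, rfl⟩ :
    sideReflection s ∈ Subgroup.closure (sideReflection '' {s | lorentz (sideVec s) x = 0})) m
  rwa [← mul_assoc, sideReflection_mul_self, one_mul] at this

/-- Among the points of an orbit, the one in the cone is the lowest. The height of `g x` is minus
the pairing of `x` with `g⁻¹` of the centre, and each step of the descent does not increase it,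
since the mirror does not separate `x` from the centre. This bound controls which translates meet a
small set. -/
theorem apply_zero_le {x : Fin 4 → ℝ} (hx : x ∈ sideCone) {g} (hg : g ∈ cuboctGroup) :
    x 0 ≤ g x 0 := by
  have key : ∀ g ∈ cuboctGroup, lorentz x (g (latticeVec center)) ≤ -x 0 := by
    intro g hg
    refine descent_induction (p := fun g => lorentz x (g (latticeVec center)) ≤ -x 0) ?_ ?_ hg
    · exact (lorentz_comm _ _).trans_le (lorentz_center x).le
    · intro s g hg hs ih
      change lorentz x (sideReflection s (g (latticeVec center))) ≤ -x 0 at ih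
      rw [sideReflection_apply, lorentz_sub_right, lorentz_smul_right,
        lorentz_comm x (sideVec s)] at ih
      have := mul_nonpos_of_nonneg_of_nonpos hs.le (hx s)
      linarith
  have := key _ (inv_mem hg)
  rw [← lorentz_map_left hg, lorentz_comm, lorentz_center] at this
  linarith

/-- The orbit of the centre consists of integral points of a hyperboloid, finitely many of which
have bounded height, and the orbit map is injective because the stabilizer is trivial. -/
theorem finite_height_le (K : ℝ) :
    {g : cuboctGroup | (g : (Fin 4 → ℝ) ≃ₗ[ℝ] (Fin 4 → ℝ)) (latticeVec center) 0 ≤ K}.Finite := by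
  obtain ⟨n, hn⟩ := exists_nat_ge K
  choose w hw using fun g : cuboctGroup => exists_latticeVec g.2 center
  refine Set.Finite.of_finite_image (f := w)
    ((Set.finite_Icc (fun _ => -(n : ℤ)) (fun _ => (n : ℤ))).subset ?_) ?_
  · rintro _ ⟨g, hg, rfl⟩
    have hg' : w g 0 ≤ n := by
      have := hg.trans hn
      rw [(hw g).1] at this
      simp only [latticeVec, Matrix.cons_val_zero] at this
      exact_mod_cast this
    have hpos : 0 < w g 0 := by
      have := (map_mem_future g.2 center_mem_future).2
      rw [(hw g).1] at this
      simp only [latticeVec, Matrix.cons_val_zero] at this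
      exact_mod_cast this
    have hq : lorentz (latticeVec (w g)) (latticeVec (w g)) = ((-1 : ℤ) : ℝ) := by
      rw [← (hw g).1, lorentz_map g.2, lorentz_center]
      simp [latticeVec, center]
    rw [lorentz_latticeVec, Int.cast_inj] at hq
    have hb : ∀ i, |w g i| ≤ n := by
      intro i
      refine (abs_le_of_sq_le_sq ?_ (hpos.le)).trans hg'
      fin_cases i <;> simp <;>
        nlinarith [sq_nonneg (w g 1), sq_nonneg (w g 2), sq_nonneg (w g 3)]
    exact ⟨fun i => (abs_le.1 (hb i)).1, fun i => (abs_le.1 (hb i)).2⟩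
  · intro g _ h _ hgh
    have e : (g : (Fin 4 → ℝ) ≃ₗ[ℝ] (Fin 4 → ℝ)) (latticeVec center) =
        (h : (Fin 4 → ℝ) ≃ₗ[ℝ] (Fin 4 → ℝ)) (latticeVec center) := by
      rw [(hw g).1, (hw h).1, hgh]
    have := eq_one_of_map_center (mul_mem (inv_mem h.2) g.2) (by
      rw [LinearEquiv.mul_apply, e]
      exact h.1.symm_apply_apply _)
    exact Subtype.ext (inv_mul_eq_one.1 this).symm

/-- Choose the image of the centre nearest to `x`, which exists by finiteness. If the transported
point violated a side, reflecting in it would give a nearer image. -/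
theorem exists_map_mem_sideCone {x : Fin 4 → ℝ} (hx : x ∈ future) :
    ∃ g ∈ cuboctGroup, g x ∈ sideCone := by
  set c := x 0 - √(x 1 ^ 2 + x 2 ^ 2 + x 3 ^ 2) with hc
  have hc0 : 0 < c := sub_pos.2 (sqrt_sum_lt_of_mem_future hx)
  have hfin : {g : cuboctGroup |
      -lorentz x ((g : (Fin 4 → ℝ) ≃ₗ[ℝ] (Fin 4 → ℝ)) (latticeVec center)) ≤ x 0}.Finite := by
    refine (finite_height_le (x 0 / c)).subset fun g hg => ?_
    have := lorentz_le_of_mem_future x (map_mem_future g.2 center_mem_future)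
    rw [Set.mem_ofPred_eq, le_div_iff₀ hc0]
    simp only [Set.mem_ofPred_eq, ← hc] at hg this
    linarith
  obtain ⟨g, hg, hmin⟩ := Set.exists_min_image _ (fun g : cuboctGroup =>
    -lorentz x ((g : (Fin 4 → ℝ) ≃ₗ[ℝ] (Fin 4 → ℝ)) (latticeVec center))) hfin ⟨1, by
      rw [Set.mem_ofPred_eq, lorentz_comm]
      exact (neg_eq_iff_eq_neg.2 (lorentz_center x)).le⟩
  have height : ∀ h ∈ cuboctGroup, -lorentz x (h (latticeVec center)) = (h⁻¹ x) 0 := by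
    intro h hh
    rw [lorentz_comm, lorentz_map_left hh, lorentz_center, neg_neg]
  refine ⟨(g : (Fin 4 → ℝ) ≃ₗ[ℝ] (Fin 4 → ℝ))⁻¹, inv_mem g.2, fun s => ?_⟩
  by_contra! hs
  have hlt := sideReflection_apply_zero_lt hs
  have hh := mul_mem g.2 (sideReflection_mem s)
  have e : (sideReflection s) ((g : (Fin 4 → ℝ) ≃ₗ[ℝ] (Fin 4 → ℝ))⁻¹ x) =
      ((g : (Fin 4 → ℝ) ≃ₗ[ℝ] (Fin 4 → ℝ)) * sideReflection s)⁻¹ x := by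
    rw [mul_inv_rev, sideReflection_inv]
    rfl
  rw [e, ← height _ hh, ← height _ g.2] at hlt
  exact hlt.not_ge (hmin ⟨_, hh⟩ (hlt.le.trans hg))

/-! ### The tessellation of hyperbolic space -/

/-- The saturation of an open set is the union of its positive multiples. Openness matters because
open quotient maps remain quotient maps over arbitrary subsets of the sphere. -/
theorem isOpenQuotientMap_ray (M : Type*) [AddCommGroup M] [Module ℝ M] [TopologicalSpace M]
    [ContinuousConstSMul ℝ M] :
    IsOpenQuotientMap (fun v : {v : M // v ≠ 0} => rayOfNeZero ℝ v.1 v.2) := by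
  have hq : Topology.IsQuotientMap (fun v : {v : M // v ≠ 0} => rayOfNeZero ℝ v.1 v.2) :=
    ⟨⟨rfl⟩, fun p => by
      induction p using Module.Ray.ind with
      | h v hv => exact ⟨⟨v, hv⟩, rfl⟩⟩
  refine ⟨hq.surjective, hq.continuous, fun U hU => ?_⟩
  rw [← hq.isOpen_preimage]
  have : (fun v : {v : M // v ≠ 0} => rayOfNeZero ℝ v.1 v.2) ⁻¹'
      ((fun v : {v : M // v ≠ 0} => rayOfNeZero ℝ v.1 v.2) '' U) =
      ⋃ c : {c : ℝ // 0 < c}, (fun v : {v : M // v ≠ 0} =>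
        (⟨c.1 • v.1, smul_ne_zero c.2.ne' v.2⟩ : {v : M // v ≠ 0})) ⁻¹' U := by
    ext v
    simp only [Set.mem_preimage, Set.mem_image, Set.mem_iUnion]
    constructor
    · rintro ⟨u, hu, h⟩
      obtain ⟨c, hc, e⟩ := ((ray_eq_iff _ _).1 h).exists_pos_right u.2 v.2
      exact ⟨⟨c, hc⟩, by convert hu using 1; exact Subtype.ext e.symm⟩
    · rintro ⟨c, hc⟩
      refine ⟨_, hc, (ray_eq_iff _ _).2 (SameRay.sameRay_pos_smul_left _ c.2)⟩
  rw [this]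
  refine isOpen_iUnion fun c => hU.preimage ?_
  exact Continuous.subtype_mk (continuous_subtype_val.const_smul _) _

theorem isOpen_proj {m : ℕ} {S : Set (Fin m → ℝ)} (hS : IsOpen S)
    (hc : ∀ c : ℝ, 0 < c → ∀ x ∈ S, c • x ∈ S) : IsOpen (proj S) := by
  rw [← (isOpenQuotientMap_ray (Fin m → ℝ)).isQuotientMap.isOpen_preimage]
  convert hS.preimage continuous_subtype_val using 1
  ext v
  exact mem_proj hc v.2

theorem isClosed_halfSpace {m : ℕ} (α : Fin m → ℝ) : IsClosed (halfSpace α) := by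
  rw [← (isOpenQuotientMap_ray (Fin m → ℝ)).isQuotientMap.isClosed_preimage]
  have hcont : Continuous fun v : {v : Fin m → ℝ // v ≠ 0} => dotProduct α v.1 :=
    continuous_const.dotProduct continuous_subtype_val
  convert (isClosed_Iic (a := 0)).preimage hcont using 1
  ext v
  exact mem_halfSpace α v.2

theorem continuous_rayMap {m : ℕ} (e : (Fin m → ℝ) ≃ₗ[ℝ] (Fin m → ℝ)) :
    Continuous (Module.Ray.map e) := by
  have hq := (isOpenQuotientMap_ray (Fin m → ℝ)).isQuotientMap
  rw [hq.continuous_iff]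
  have he : Continuous e := LinearMap.continuous_of_finiteDimensional e.toLinearMap
  exact hq.continuous.comp (Continuous.subtype_mk (he.comp continuous_subtype_val)
    fun v => e.map_ne_zero_iff.2 v.2)

theorem smul_rayOfNeZero (g : cuboctGroup) {x : Fin 4 → ℝ} (hx : x ≠ 0) :
    g • rayOfNeZero ℝ x hx = rayOfNeZero ℝ (g.1 x) (g.1.map_ne_zero_iff.2 hx) := rfl

theorem continuous_smul_S3 (g : cuboctGroup) : Continuous fun p : S3 => g • p :=
  continuous_rayMap g.1

theorem mem_H3_iff {x : Fin 4 → ℝ} (hx : x ≠ 0) : rayOfNeZero ℝ x hx ∈ H3 ↔ x ∈ future := mem_H3 hx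

theorem mem_cuboctahedron_iff {x : Fin 4 → ℝ} (hx : x ≠ 0) :
    rayOfNeZero ℝ x hx ∈ cuboctahedron ↔ x ∈ sideCone ∧ x ∈ future := by
  simp only [cuboctahedron, Set.mem_inter_iff, Set.mem_iInter, mem_halfSpace, mem_H3_iff,
    sideCone, Set.mem_ofPred_eq, lorentz_sideVec]

theorem mem_face_iff {x : Fin 4 → ℝ} (hx : x ≠ 0) (s : Side) :
    rayOfNeZero ℝ x hx ∈ face s ↔
      lorentz (sideVec s) x = 0 ∧ rayOfNeZero ℝ x hx ∈ cuboctahedron := by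
  rw [face, Set.mem_inter_iff, mem_hyperplane, lorentz_sideVec]

theorem smul_mem_H3 (g : cuboctGroup) {p : S3} (hp : p ∈ H3) : g • p ∈ H3 := by
  induction p using Module.Ray.ind with
  | h x hx =>
    rw [smul_rayOfNeZero, mem_H3_iff]
    exact map_mem_future g.2 ((mem_H3_iff hx).1 hp)

theorem exists_smul_mem_cuboctahedron {p : S3} (hp : p ∈ H3) :
    ∃ g : cuboctGroup, g • p ∈ cuboctahedron := by
  induction p using Module.Ray.ind with
  | h x hx =>
    rw [mem_H3_iff] at hp
    obtain ⟨g, hg, h⟩ := exists_map_mem_sideCone hp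
    refine ⟨⟨g, hg⟩, ?_⟩
    rw [smul_rayOfNeZero, mem_cuboctahedron_iff]
    exact ⟨h, map_mem_future hg hp⟩

/-- The reflections as elements of the group. -/
noncomputable def sideRefl (s : Side) : cuboctGroup := ⟨sideReflection s, sideReflection_mem s⟩

theorem smul_eq_and_mem_closure {p : S3} (hp : p ∈ cuboctahedron) {g : cuboctGroup}
    (hg : g • p ∈ cuboctahedron) :
    g • p = p ∧ g ∈ Subgroup.closure (sideRefl '' {s | p ∈ face s}) := by
  induction p using Module.Ray.ind with
  | h x hx =>
    rw [smul_rayOfNeZero, mem_cuboctahedron_iff] at hg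
    have hp' := (mem_cuboctahedron_iff hx).1 hp
    obtain ⟨e, m⟩ := eq_and_mem_closure hp'.1 g.2 hg.1
    refine ⟨?_, ?_⟩
    · rw [smul_rayOfNeZero]
      simp only [e]
    · have himg : sideReflection '' {s | lorentz (sideVec s) x = 0} =
          cuboctGroup.subtype '' (sideRefl '' {s | rayOfNeZero ℝ x hx ∈ face s}) := by
        rw [Set.image_image]
        simp only [mem_face_iff, hp, and_true]
        rfl
      rw [himg, ← MonoidHom.map_closure] at m
      obtain ⟨g', hg', e'⟩ := m
      rwa [Subtype.ext e'] at hg'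

theorem sideRefl_smul {s : Side} {p : S3} (hp : p ∈ face s) : sideRefl s • p = p := by
  induction p using Module.Ray.ind with
  | h x hx =>
    have h0 := ((mem_face_iff hx s).1 hp).1
    rw [smul_rayOfNeZero]
    simp only [sideRefl, sideReflection_eq_self h0]

theorem sideRefl_ne_one (s : Side) : sideRefl s ≠ 1 := by
  intro h
  have h1 : sideReflection s (sideVec s) = sideVec s :=
    congrArg (fun g : cuboctGroup => g.1 (sideVec s)) h
  rw [sideReflection_apply, lorentz_sideVec_self] at h1
  have h2 := congrFun h1 0
  have := sideVec_zero_pos s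
  simp only [Pi.sub_apply, Pi.smul_apply, smul_eq_mul] at h2
  linarith

/-- Take a round cone around the time axis with relative gap `c` to the light cone, half the gap of
`x`. If `g w` lies in it with `w` in the cuboctahedron, the reversed Cauchy–Schwarz inequality
bounds the height of `w` below by `c` times the product of the heights of `g w` and of the image of
the centre; as `w` is not higher than `g w`, the latter image has height at most `1 / c`. -/
theorem exists_nhds_finite {p : S3} (hp : p ∈ H3) : ∃ U : Set S3, IsOpen U ∧ p ∈ U ∧
    {g : cuboctGroup | ∃ q ∈ cuboctahedron, g • q ∈ U}.Finite := by
  induction p using Module.Ray.ind with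
  | h x hx =>
    rw [mem_H3_iff] at hp
    have hlt := sqrt_sum_lt_of_mem_future hp
    set c : ℝ := (1 - √(x 1 ^ 2 + x 2 ^ 2 + x 3 ^ 2) / x 0) / 2 with hc
    have hc0 : 0 < c := by
      have := (div_lt_one hp.2).2 hlt
      linarith
    set S : Set (Fin 4 → ℝ) := {u | √(u 1 ^ 2 + u 2 ^ 2 + u 3 ^ 2) < (1 - c) * u 0} with hS
    have hScone : ∀ r : ℝ, 0 < r → ∀ u ∈ S, r • u ∈ S := by
      intro r hr u hu
      simp only [hS, Set.mem_ofPred_eq, Pi.smul_apply, smul_eq_mul] at hu ⊢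
      rw [show (r * u 1) ^ 2 + (r * u 2) ^ 2 + (r * u 3) ^ 2 =
        r ^ 2 * (u 1 ^ 2 + u 2 ^ 2 + u 3 ^ 2) by ring, Real.sqrt_mul (sq_nonneg r),
        Real.sqrt_sq hr.le]
      have := mul_lt_mul_of_pos_left hu hr
      linarith
    refine ⟨proj S, isOpen_proj (isOpen_lt (by fun_prop) (by fun_prop)) hScone, ?_, ?_⟩
    · rw [mem_proj hScone]
      have e : √(x 1 ^ 2 + x 2 ^ 2 + x 3 ^ 2) = (1 - 2 * c) * x 0 := by
        have := hp.2.ne'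
        rw [hc]
        field_simp
        ring
      rw [hS, Set.mem_ofPred_eq, e]
      have := mul_pos hc0 hp.2
      linarith
    · refine (finite_height_le (1 / c)).subset ?_
      rintro g ⟨q, hq, hgq⟩
      induction q using Module.Ray.ind with
      | h w hw =>
        rw [smul_rayOfNeZero, mem_proj hScone] at hgq
        rw [mem_cuboctahedron_iff] at hq
        have h1 := apply_zero_le hq.1 g.2
        have h2 := lorentz_le_of_mem_future (g.1 w) (map_mem_future g.2 center_mem_future)
        rw [lorentz_map g.2, lorentz_comm, lorentz_center] at h2
        have h3 := (map_mem_future g.2 center_mem_future).2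
        have h4 : c * g.1 w 0 * g.1 (latticeVec center) 0 ≤
            (g.1 w 0 - √(g.1 w 1 ^ 2 + g.1 w 2 ^ 2 + g.1 w 3 ^ 2)) * g.1 (latticeVec center) 0 := by
          refine mul_le_mul_of_nonneg_right ?_ h3.le
          simp only [hS, Set.mem_ofPred_eq] at hgq
          linarith
        have h5 := (map_mem_future g.2 hq.2).2
        rw [Set.mem_ofPred_eq, le_div_iff₀ hc0]
        refine le_of_mul_le_mul_right ?_ h5
        linarith

/-- The map from the disjoint union of the translates of the cuboctahedron to hyperbolic space. -/
noncomputable def tile (a : Σ _ : cuboctGroup, cuboctahedron) : H3 :=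
  ⟨a.1 • (a.2 : S3), smul_mem_H3 a.1 a.2.2.2⟩

theorem tile_surjective : Function.Surjective tile := by
  rintro ⟨p, hp⟩
  obtain ⟨g, hg⟩ := exists_smul_mem_cuboctahedron hp
  exact ⟨⟨g⁻¹, ⟨g • p, hg⟩⟩, Subtype.ext (inv_smul_smul g p)⟩

theorem continuous_tile : Continuous tile :=
  Continuous.subtype_mk (continuous_sigma fun g =>
    (continuous_smul_S3 g).comp continuous_subtype_val) _

open Filter Topology in
theorem isProperMap_tile : IsProperMap tile := by
  rw [isProperMap_iff_ultrafilter]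
  refine ⟨continuous_tile, fun 𝒰 y hy => ?_⟩
  obtain ⟨U, hU, hyU, hfin⟩ := exists_nhds_finite y.2
  have hy' : Tendsto (fun a => (tile a : S3)) 𝒰 (𝓝 (y : S3)) :=
    (continuous_subtype_val.tendsto y).comp hy
  have hmem : (⋃ g ∈ {g : cuboctGroup | ∃ q ∈ cuboctahedron, g • q ∈ U},
      {a : Σ _ : cuboctGroup, cuboctahedron | a.1 = g}) ∈ 𝒰 := by
    filter_upwards [hy' (hU.mem_nhds hyU)] with a ha
    exact Set.mem_biUnion (x := a.1) ⟨a.2, a.2.2, ha⟩ rfl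
  -- By local finiteness the ultrafilter lives on a single translate, where convergence can be
  -- pulled back by `g⁻¹`; the limit stays in the cuboctahedron because half-spaces are closed.
  rw [Ultrafilter.finite_biUnion_mem_iff hfin] at hmem
  obtain ⟨g, -, hg⟩ := hmem
  have hlim : Tendsto (fun a => g⁻¹ • (tile a : S3)) 𝒰 (𝓝 (g⁻¹ • (y : S3))) :=
    ((continuous_smul_S3 g⁻¹).tendsto _).comp hy'
  have heq : ∀ᶠ a : Σ _ : cuboctGroup, cuboctahedron in 𝒰, g⁻¹ • (tile a : S3) = a.2 := by
    filter_upwards [hg] with a ha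
    obtain rfl : a.1 = g := ha
    exact inv_smul_smul a.1 (a.2 : S3)
  have hlim' : Tendsto (fun a : Σ _ : cuboctGroup, cuboctahedron => (a.2 : S3)) 𝒰
      (𝓝 (g⁻¹ • (y : S3))) := hlim.congr' heq
  have hmemC : g⁻¹ • (y : S3) ∈ cuboctahedron := by
    refine ⟨?_, smul_mem_H3 _ y.2⟩
    refine (isClosed_iInter fun s => isClosed_halfSpace (sideNormal s)).mem_of_tendsto hlim'
      (Eventually.of_forall fun a => a.2.2.1)
  refine ⟨⟨g, ⟨_, hmemC⟩⟩, Subtype.ext (smul_inv_smul g (y : S3)), ?_⟩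
  rw [Sigma.nhds_mk]
  intro V hV
  rw [mem_map, mem_nhds_subtype] at hV
  obtain ⟨W, hW, hWV⟩ := hV
  filter_upwards [hg, hlim' hW] with a ha haW
  obtain ⟨g', q⟩ := a
  obtain rfl : g' = g := ha
  exact hWV haW

/-! ### The quotient of the tessellated space, times a circle -/

/-- The projection from hyperbolic space to its quotient. -/
noncomputable def toQuotient (Γ : Subgroup cuboctGroup) : H3 → QuotientManifold Γ :=
  @Quotient.mk _ ((MulAction.orbitRel Γ S3).comap (Subtype.val : H3 → S3))

theorem toQuotient_eq_iff {Γ : Subgroup cuboctGroup} {p q : H3} :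
    toQuotient Γ p = toQuotient Γ q ↔ ∃ γ ∈ Γ, γ • (q : S3) = p := by
  refine Quotient.eq.trans ?_
  change (p : S3) ∈ MulAction.orbit Γ (q : S3) ↔ _
  constructor
  · rintro ⟨γ, h⟩
    exact ⟨γ, γ.2, h⟩
  · rintro ⟨γ, hγ, h⟩
    exact ⟨⟨γ, hγ⟩, h⟩

theorem isOpenQuotientMap_toQuotient (Γ : Subgroup cuboctGroup) :
    IsOpenQuotientMap (toQuotient Γ) := by
  have hq : Topology.IsQuotientMap (toQuotient Γ) := isQuotientMap_quot_mk
  refine ⟨hq.surjective, hq.continuous, fun U hU => ?_⟩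
  rw [← hq.isOpen_preimage]
  have : toQuotient Γ ⁻¹' (toQuotient Γ '' U) =
      ⋃ γ : Γ, (fun p : H3 => (⟨(γ : cuboctGroup) • (p : S3), smul_mem_H3 _ p.2⟩ : H3)) ⁻¹' U := by
    ext p
    simp only [Set.mem_preimage, Set.mem_image, Set.mem_iUnion]
    constructor
    · rintro ⟨q, hq, h⟩
      obtain ⟨γ, hγ, h⟩ := toQuotient_eq_iff.1 h
      refine ⟨⟨γ, hγ⟩, ?_⟩
      convert hq
    · rintro ⟨γ, h⟩
      exact ⟨_, h, toQuotient_eq_iff.2 ⟨γ, γ.2, rfl⟩⟩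
  rw [this]
  refine isOpen_iUnion fun γ => hU.preimage ?_
  exact Continuous.subtype_mk ((continuous_smul_S3 _).comp continuous_subtype_val) _

/-! ### The circle as the double of an interval. -/

/-- The two arcs of the circle over the interval. -/
noncomputable def arc (a : Set.Icc (-1 : ℝ) 1 × Bool) : Circle :=
  ⟨⟨a.1, if a.2 then √(1 - (a.1 : ℝ) ^ 2) else -√(1 - (a.1 : ℝ) ^ 2)⟩, by
    have h : 0 ≤ 1 - (a.1 : ℝ) ^ 2 := by
      nlinarith [a.1.2.1, a.1.2.2]
    refine mem_sphere_zero_iff_norm.2 ((sq_eq_sq₀ (norm_nonneg _) zero_le_one).1 ?_)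
    rw [Complex.sq_norm, Complex.normSq_mk]
    split_ifs <;> nlinarith [Real.mul_self_sqrt h]⟩

theorem continuous_arc : Continuous arc := by
  rw [continuous_prod_of_discrete_right]
  intro b
  refine Continuous.subtype_mk ?_ _
  refine Complex.equivRealProdCLM.symm.continuous.comp (Continuous.prodMk (by fun_prop) ?_)
  cases b <;> simp <;> fun_prop

theorem arc_surjective : Function.Surjective arc := by
  intro z
  have hz : (z : ℂ).re ^ 2 + (z : ℂ).im ^ 2 = 1 := by
    have := Complex.sq_norm (z : ℂ)
    rw [Circle.norm_coe, Complex.normSq_apply] at this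
    linarith
  have him : 1 - (z : ℂ).re ^ 2 = (z : ℂ).im ^ 2 := by linarith
  have hre : (z : ℂ).re ∈ Set.Icc (-1 : ℝ) 1 := by
    rw [Set.mem_Icc, ← abs_le, ← sq_le_one_iff_abs_le_one]
    nlinarith [sq_nonneg (z : ℂ).im]
  rcases le_total 0 (z : ℂ).im with h | h
  · refine ⟨(⟨_, hre⟩, true), Circle.ext (Complex.ext rfl ?_)⟩
    change √(1 - (z : ℂ).re ^ 2) = (z : ℂ).im
    rw [him, Real.sqrt_sq h]
  · refine ⟨(⟨_, hre⟩, false), Circle.ext (Complex.ext rfl ?_)⟩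
    change -√(1 - (z : ℂ).re ^ 2) = (z : ℂ).im
    rw [him, Real.sqrt_sq_eq_abs, abs_of_nonpos h, neg_neg]

theorem arc_eq_iff {j k : Set.Icc (-1 : ℝ) 1} {b c : Bool} :
    arc (j, b) = arc (k, c) ↔ j = k ∧ (b = c ∨ (j : ℝ) ^ 2 = 1) := by
  have hnn : 0 ≤ 1 - (j : ℝ) ^ 2 := by
    nlinarith [j.2.1, j.2.2]
  constructor
  · intro h
    have hre : (j : ℝ) = k := congrArg (fun z : Circle => (z : ℂ).re) h
    obtain rfl : j = k := Subtype.ext hre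
    refine ⟨rfl, ?_⟩
    have him : (if b then √(1 - (j : ℝ) ^ 2) else -√(1 - (j : ℝ) ^ 2)) =
        if c then √(1 - (j : ℝ) ^ 2) else -√(1 - (j : ℝ) ^ 2) :=
      congrArg (fun z : Circle => (z : ℂ).im) h
    by_cases hbc : b = c
    · exact Or.inl hbc
    · right
      have h0 : √(1 - (j : ℝ) ^ 2) = 0 := by
        cases b <;> cases c <;> simp at hbc him <;> linarith
      rw [Real.sqrt_eq_zero hnn] at h0
      linarith
  · rintro ⟨rfl, rfl | h⟩
    · rfl
    · have h0 : √(1 - (j : ℝ) ^ 2) = 0 := by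
        rw [h, sub_self, Real.sqrt_zero]
      refine Circle.ext (Complex.ext rfl ?_)
      change (if b then √(1 - (j : ℝ) ^ 2) else -√(1 - (j : ℝ) ^ 2)) =
        if c then √(1 - (j : ℝ) ^ 2) else -√(1 - (j : ℝ) ^ 2)
      rw [h0]
      simp

/-- The map onto the product with the circle from the disjoint union of products of translates of
the cuboctahedron with an interval, taken twice. -/
noncomputable def tileArc (Γ : Subgroup cuboctGroup)
    (a : (Σ _ : cuboctGroup, cuboctahedron) × (Set.Icc (-1 : ℝ) 1 × Bool)) :
    QuotientManifold Γ × Circle :=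
  (toQuotient Γ (tile a.1), arc a.2)

/-- Products of quotient maps need not be quotient maps. Here properness of `tile` and `arc`, and
openness of the projection modulo `Γ`, are the stronger properties that survive products. -/
theorem isQuotientMap_tileArc (Γ : Subgroup cuboctGroup) :
    Topology.IsQuotientMap (tileArc Γ) := by
  have h₁ : IsProperMap (Prod.map tile arc) := isProperMap_tile.prodMap continuous_arc.isProperMap
  have h₂ := h₁.isClosedMap.isQuotientMap h₁.continuous (tile_surjective.prodMap arc_surjective)
  exact ((isOpenQuotientMap_toQuotient Γ).prodMap IsOpenQuotientMap.id).isQuotientMap.comp h₂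

/-! ### Gluing prisms over the cuboctahedron -/

/-- A homeomorphism of a polytope with a prism over the cuboctahedron, such that the facets which
are glued correspond to the sides of the prism, and the unpaired ones to top and bottom. -/
structure PrismChart (P : Set S4) (F : Wall → Set S4) where
  /-- The underlying homeomorphism. -/
  homeo : P ≃ₜ cuboctahedron × Set.Icc (-1 : ℝ) 1
  mem_side_iff : ∀ (p : P) (s : Side), (p : S4) ∈ F (.side s) ↔ ((homeo p).1 : S3) ∈ face s
  mem_pos_iff : ∀ p : P, (∃ i, (p : S4) ∈ F (.pos i)) ↔ ((homeo p).2 : ℝ) ^ 2 = 1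

namespace PrismChart

variable {P : Set S4} {F : Wall → Set S4} (Ψ : PrismChart P F) (Γ : Subgroup cuboctGroup)

/-- The copy of the cuboctahedron of index `Γ g`. -/
noncomputable def mkCopy (Γ : Subgroup cuboctGroup) (g : cuboctGroup) : Copy Γ :=
  @Quotient.mk _ (QuotientGroup.rightRel Γ) g

theorem mkCopy_eq {Γ : Subgroup cuboctGroup} {g h : cuboctGroup} :
    mkCopy Γ g = mkCopy Γ h ↔ h * g⁻¹ ∈ Γ :=
  Quotient.eq.trans QuotientGroup.rightRel_apply

/-- A point of the prism over a translate of the cuboctahedron, in the quotient of hyperbolic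
space. -/
noncomputable def base (a : Pieces Γ P) : QuotientManifold Γ :=
  Quotient.liftOn (s := QuotientGroup.rightRel Γ) a.1
    (fun g => toQuotient Γ (tile ⟨g, (Ψ.homeo a.2).1⟩)) fun g h hgh => by
      replace hgh : h * g⁻¹ ∈ Γ := QuotientGroup.rightRel_apply.1 hgh
      refine (toQuotient_eq_iff.2 ⟨h * g⁻¹, hgh, ?_⟩).symm
      rw [tile, tile, smul_smul, inv_mul_cancel_right]

theorem continuous_base : Continuous (Ψ.base Γ) := by
  refine continuous_sigma fun c => ?_
  induction c using Quotient.ind with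
  | _ g =>
    refine (isOpenQuotientMap_toQuotient Γ).continuous.comp (continuous_tile.comp ?_)
    exact continuous_sigmaMk.comp (continuous_fst.comp Ψ.homeo.continuous)

theorem adjacent_mul_sideRefl (g : cuboctGroup) (s : Side) :
    Adjacent Γ s (mkCopy Γ g) (mkCopy Γ (g * sideRefl s)) := by
  refine ⟨g, g * sideRefl s, rfl, rfl, fun h => sideRefl_ne_one s ?_, fun x hx => ?_⟩
  · exact (mul_eq_left.1 h.symm)
  · rw [mul_smul, sideRefl_smul hx]

/-- Write `k` as a word in reflections whose faces all contain the base point of `p`; each letter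
crosses one such face, and the point is glued to its copy on the other side. -/
theorem mk_mul_eq {p : P} {k : cuboctGroup}
    (hk : k ∈ Subgroup.closure (sideRefl '' {s | ((Ψ.homeo p).1 : S3) ∈ face s}))
    (g : cuboctGroup) :
    (Quot.mk _ ⟨mkCopy Γ (g * k), p⟩ : Glued Γ P F) = Quot.mk _ ⟨mkCopy Γ g, p⟩ := by
  induction hk using Subgroup.closure_induction generalizing g with
  | mem k hk =>
    obtain ⟨s, hs, rfl⟩ := hk
    exact (Quot.sound ⟨s, adjacent_mul_sideRefl Γ g s, (Ψ.mem_side_iff p s).2 hs, rfl⟩).symm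
  | one => rw [mul_one]
  | mul k l _ _ ihk ihl => rw [← mul_assoc, ihl, ihk]
  | inv k _ ih =>
    have := ih (g * k⁻¹)
    rwa [inv_mul_cancel_right, eq_comm] at this

theorem base_eq_of_glueRel {a b : Pieces Γ P} (h : GlueRel Γ P F a b) :
    Ψ.base Γ a = Ψ.base Γ b ∧ (Ψ.homeo a.2).2 = (Ψ.homeo b.2).2 := by
  obtain ⟨c, p⟩ := a
  obtain ⟨d, q⟩ := b
  obtain ⟨s, ⟨g, h, rfl, rfl, -, hgh⟩, hs, hqp⟩ := h
  obtain rfl : q = p := Subtype.ext hqp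
  refine ⟨?_, rfl⟩
  change toQuotient Γ (tile ⟨g, _⟩) = toQuotient Γ (tile ⟨h, _⟩)
  congr 1
  exact Subtype.ext (hgh _ ((Ψ.mem_side_iff q s).1 hs))

/-- The map from the glued space to the quotient of hyperbolic space, times the interval. -/
noncomputable def gluedMap : Glued Γ P F → QuotientManifold Γ × Set.Icc (-1 : ℝ) 1 :=
  Quot.lift (fun a => (Ψ.base Γ a, (Ψ.homeo a.2).2)) fun _ _ h =>
    Prod.ext (Ψ.base_eq_of_glueRel Γ h).1 (Ψ.base_eq_of_glueRel Γ h).2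

theorem continuous_gluedMap : Continuous (Ψ.gluedMap Γ) := by
  refine continuous_quot_lift _ ((Ψ.continuous_base Γ).prodMk (continuous_sigma fun c => ?_))
  exact continuous_snd.comp Ψ.homeo.continuous

/-- If two prism points have the same image, then, after a change by `Γ`, an element takes one base
point in the cuboctahedron to the other. By the strict fundamental domain property the base points
agree and this element is a word in reflections in the faces through the point, so the gluing
already identifies the two. -/
theorem gluedMap_injective : Function.Injective (Ψ.gluedMap Γ) := by
  rintro ⟨c, p⟩ ⟨d, q⟩ h
  induction c using Quotient.ind with
  | _ g =>
  induction d using Quotient.ind with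
  | _ h' =>
  obtain ⟨hbase, hj⟩ := Prod.ext_iff.1 h
  obtain ⟨γ, hγ, e⟩ := toQuotient_eq_iff.1
    (show toQuotient Γ (tile ⟨g, (Ψ.homeo p).1⟩) = toQuotient Γ (tile ⟨h', (Ψ.homeo q).1⟩) from
      hbase)
  change γ • h' • ((Ψ.homeo q).1 : S3) = g • ((Ψ.homeo p).1 : S3) at e
  have e' : (g⁻¹ * (γ * h')) • ((Ψ.homeo q).1 : S3) = (Ψ.homeo p).1 := by
    rw [mul_smul, mul_smul, e, inv_smul_smul]
  obtain ⟨hfix, hcl⟩ := smul_eq_and_mem_closure (Ψ.homeo q).1.2 (e' ▸ (Ψ.homeo p).1.2)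
  obtain rfl : p = q := by
    refine Ψ.homeo.injective (Prod.ext (Subtype.ext ?_) hj)
    rw [← e', hfix]
  have := Ψ.mk_mul_eq Γ hcl g
  rw [mul_inv_cancel_left] at this
  have hcopy : mkCopy Γ (γ * h') = mkCopy Γ h' := by
    rw [mkCopy_eq, mul_inv_rev, mul_inv_cancel_left]
    exact inv_mem hγ
  rw [hcopy] at this
  exact this.symm

theorem mem_unpaired_iff (y : Glued Γ P F) :
    y ∈ unpaired Γ P F ↔ ((Ψ.gluedMap Γ y).2 : ℝ) ^ 2 = 1 := by
  constructor
  · rintro ⟨a, rfl, ha⟩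
    exact (Ψ.mem_pos_iff a.2).1 ha
  · induction y using Quot.ind with
    | mk a => exact fun h => ⟨a, rfl, (Ψ.mem_pos_iff a.2).2 h⟩

/-- The map from the double of the glued space to the product with a circle. -/
noncomputable def doubleMap :
    Double (Glued Γ P F) (unpaired Γ P F) → QuotientManifold Γ × Circle :=
  Quot.lift (fun y => ((Ψ.gluedMap Γ y.1).1, arc ((Ψ.gluedMap Γ y.1).2, y.2))) (by
    rintro ⟨y, b⟩ ⟨y', c⟩ ⟨rfl, hy⟩
    exact Prod.ext rfl (arc_eq_iff.2 ⟨rfl, Or.inr ((Ψ.mem_unpaired_iff Γ y).1 hy)⟩))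

theorem continuous_doubleMap : Continuous (Ψ.doubleMap Γ) := by
  have h := (Ψ.continuous_gluedMap Γ).comp (continuous_fst (Y := Bool))
  exact continuous_quot_lift _ ((continuous_fst.comp h).prodMk
    (continuous_arc.comp ((continuous_snd.comp h).prodMk continuous_snd)))

theorem doubleMap_injective : Function.Injective (Ψ.doubleMap Γ) := by
  rintro ⟨y, b⟩ ⟨y', c⟩ h
  obtain ⟨h₁, h₂⟩ := Prod.ext_iff.1 h
  obtain ⟨hj, hb⟩ := arc_eq_iff.1
    (show arc ((Ψ.gluedMap Γ y).2, b) = arc ((Ψ.gluedMap Γ y').2, c) from h₂)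
  obtain rfl : y = y' := Ψ.gluedMap_injective Γ (Prod.ext h₁ hj)
  rcases hb with rfl | hb
  · rfl
  · exact Quot.sound ⟨rfl, (Ψ.mem_unpaired_iff Γ y).2 hb⟩

/-- The parametrization of the double of the glued space by translates of the cuboctahedron. -/
noncomputable def tileDouble
    (a : (Σ _ : cuboctGroup, cuboctahedron) × (Set.Icc (-1 : ℝ) 1 × Bool)) :
    Double (Glued Γ P F) (unpaired Γ P F) :=
  Quot.mk _ (Quot.mk _ ⟨mkCopy Γ a.1.1, Ψ.homeo.symm (a.1.2, a.2.1)⟩, a.2.2)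

theorem continuous_tileDouble : Continuous (Ψ.tileDouble Γ) := by
  refine continuous_quot_mk.comp (Continuous.prodMk (continuous_quot_mk.comp ?_)
    (continuous_snd.comp continuous_snd))
  have h : Continuous fun a : Σ _ : cuboctGroup, cuboctahedron × (Set.Icc (-1 : ℝ) 1 × Bool) =>
      (⟨mkCopy Γ a.1, Ψ.homeo.symm (a.2.1, a.2.2.1)⟩ : Σ _ : Copy Γ, P) :=
    continuous_sigma fun g => (continuous_sigmaMk (σ := fun _ : Copy Γ => P)
      (i := mkCopy Γ g)).comp (Ψ.homeo.symm.continuous.comp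
      (continuous_fst.prodMk (continuous_fst.comp continuous_snd)))
  exact h.comp Homeomorph.sigmaProdDistrib.continuous

theorem doubleMap_tileDouble : Ψ.doubleMap Γ ∘ Ψ.tileDouble Γ = tileArc Γ := by
  funext ⟨⟨g, x⟩, j, b⟩
  change (toQuotient Γ (tile ⟨g, (Ψ.homeo (Ψ.homeo.symm (x, j))).1⟩),
    arc ((Ψ.homeo (Ψ.homeo.symm (x, j))).2, b)) = _
  rw [Homeomorph.apply_symm_apply]
  rfl

/-- The double of the space obtained by gluing prisms is a product with the circle. -/
theorem nonempty_homeomorph {P : Set S4} {F : Wall → Set S4} (Ψ : PrismChart P F)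
    (Γ : Subgroup cuboctGroup) :
    Nonempty (Double (Glued Γ P F) (unpaired Γ P F) ≃ₜ QuotientManifold Γ × Circle) := by
  have hq := isQuotientMap_tileArc Γ
  have hsurj : Function.Surjective (Ψ.doubleMap Γ) := by
    have := hq.surjective
    rw [← Ψ.doubleMap_tileDouble Γ] at this
    exact this.of_comp
  let e := Equiv.ofBijective _ ⟨Ψ.doubleMap_injective Γ, hsurj⟩
  refine ⟨⟨e, Ψ.continuous_doubleMap Γ, ?_⟩⟩
  change Continuous e.symm
  -- Pulled back along the quotient map `tileArc`, the inverse becomes `tileDouble`, which is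
  -- visibly continuous.
  rw [hq.continuous_iff]
  convert Ψ.continuous_tileDouble Γ using 1
  funext a
  rw [Function.comp_apply, Equiv.symm_apply_eq]
  exact (congrFun (Ψ.doubleMap_tileDouble Γ) a).symm

end PrismChart

/-! ### Shifting the coordinates of a vector -/

/-- The smallest absolute value of a coordinate. -/
noncomputable def minAbs (y : Fin 3 → ℝ) : ℝ := min |y 0| (min |y 1| |y 2|)

/-- The sum of the two largest absolute values of coordinates. -/
noncomputable def topTwo (y : Fin 3 → ℝ) : ℝ := |y 0| + |y 1| + |y 2| - minAbs y

/-- The smallest absolute value of a coordinate, with the sign of the product of coordinates. -/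
noncomputable def signedMin (y : Fin 3 → ℝ) : ℝ :=
  if 0 ≤ y 0 * y 1 * y 2 then minAbs y else -minAbs y

/-- The signs of the coordinates, times the smallest absolute value. -/
noncomputable def clampVec (y : Fin 3 → ℝ) : Fin 3 → ℝ :=
  fun j => max (-minAbs y) (min (minAbs y) (y j))

/-- Multiplication of the smallest absolute value of a coordinate by `κ`, preserving the differences
of absolute values. -/
noncomputable def shift (κ : ℝ) (y : Fin 3 → ℝ) : Fin 3 → ℝ := y + (κ - 1) • clampVec y

theorem minAbs_le (y : Fin 3 → ℝ) (j : Fin 3) : minAbs y ≤ |y j| := by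
  fin_cases j
  · exact min_le_left _ _
  · exact (min_le_right _ _).trans (min_le_left _ _)
  · exact (min_le_right _ _).trans (min_le_right _ _)

theorem minAbs_nonneg (y : Fin 3 → ℝ) : 0 ≤ minAbs y :=
  le_min (abs_nonneg _) (le_min (abs_nonneg _) (abs_nonneg _))

theorem minAbs_eq_zero {y : Fin 3 → ℝ} {j : Fin 3} (h : y j = 0) : minAbs y = 0 :=
  le_antisymm ((minAbs_le y j).trans_eq (by rw [h, abs_zero])) (minAbs_nonneg y)

theorem minAbs_eq_zero_of_prod {y : Fin 3 → ℝ} (h : y 0 * y 1 * y 2 = 0) : minAbs y = 0 := by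
  rcases mul_eq_zero.1 h with h | h
  · rcases mul_eq_zero.1 h with h | h <;> exact minAbs_eq_zero h
  · exact minAbs_eq_zero h

theorem exists_abs_eq_minAbs (y : Fin 3 → ℝ) : ∃ j, |y j| = minAbs y := by
  unfold minAbs
  rcases min_choice |y 0| (min |y 1| |y 2|) with h | h
  · exact ⟨0, h.symm⟩
  · rw [h]
    rcases min_choice |y 1| |y 2| with h | h
    · exact ⟨1, h.symm⟩
    · exact ⟨2, h.symm⟩

theorem abs_signedMin (y : Fin 3 → ℝ) : |signedMin y| = minAbs y := by
  unfold signedMin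
  split_ifs
  · exact abs_of_nonneg (minAbs_nonneg y)
  · rw [abs_neg, abs_of_nonneg (minAbs_nonneg y)]

theorem topTwo_nonneg (y : Fin 3 → ℝ) : 0 ≤ topTwo y := by
  have := minAbs_le y 0
  have h1 := abs_nonneg (y 1)
  have h2 := abs_nonneg (y 2)
  unfold topTwo
  linarith

theorem clampVec_of_nonneg {y : Fin 3 → ℝ} {j : Fin 3} (h : 0 ≤ y j) :
    clampVec y j = minAbs y := by
  have h1 := minAbs_le y j
  rw [abs_of_nonneg h] at h1
  have h2 := minAbs_nonneg y
  rw [clampVec, min_eq_left h1, max_eq_right (by linarith)]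

theorem clampVec_of_nonpos {y : Fin 3 → ℝ} {j : Fin 3} (h : y j ≤ 0) :
    clampVec y j = -minAbs y := by
  have h1 := minAbs_le y j
  rw [abs_of_nonpos h] at h1
  have h2 := minAbs_nonneg y
  rw [clampVec, min_eq_right (by linarith), max_eq_left (by linarith)]

theorem continuous_minAbs : Continuous minAbs := by unfold minAbs; fun_prop

theorem continuous_topTwo : Continuous topTwo := by
  have := continuous_minAbs
  unfold topTwo; fun_prop

theorem continuous_clampVec : Continuous clampVec := by
  have := continuous_minAbs
  unfold clampVec; fun_prop

/-- The sign can only jump where a coordinate vanishes, and there the smallest absolute value is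
zero. -/
theorem continuous_signedMin : Continuous signedMin := by
  have := continuous_minAbs
  refine Continuous.if_le continuous_minAbs continuous_minAbs.neg continuous_const (by fun_prop) ?_
  intro y h
  rw [minAbs_eq_zero_of_prod h.symm, neg_zero]

section Shift

variable {κ : ℝ}

theorem shift_of_nonneg {y : Fin 3 → ℝ} {j : Fin 3} (h : 0 ≤ y j) :
    shift κ y j = y j + (κ - 1) * minAbs y := by
  rw [shift, Pi.add_apply, Pi.smul_apply, clampVec_of_nonneg h, smul_eq_mul]

theorem shift_of_nonpos {y : Fin 3 → ℝ} {j : Fin 3} (h : y j ≤ 0) :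
    shift κ y j = y j - (κ - 1) * minAbs y := by
  rw [shift, Pi.add_apply, Pi.smul_apply, clampVec_of_nonpos h, smul_eq_mul]
  ring

theorem shift_nonneg (hκ : 0 ≤ κ) {y : Fin 3 → ℝ} {j : Fin 3} (h : 0 ≤ y j) : 0 ≤ shift κ y j := by
  rw [shift_of_nonneg h]
  have h1 := minAbs_le y j
  rw [abs_of_nonneg h] at h1
  have h2 := mul_nonneg hκ (minAbs_nonneg y)
  linarith

theorem shift_nonpos (hκ : 0 ≤ κ) {y : Fin 3 → ℝ} {j : Fin 3} (h : y j ≤ 0) : shift κ y j ≤ 0 := by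
  rw [shift_of_nonpos h]
  have h1 := minAbs_le y j
  rw [abs_of_nonpos h] at h1
  have h2 := mul_nonneg hκ (minAbs_nonneg y)
  linarith

theorem abs_shift (hκ : 0 ≤ κ) (y : Fin 3 → ℝ) (j : Fin 3) :
    |shift κ y j| = |y j| + (κ - 1) * minAbs y := by
  rcases le_total 0 (y j) with h | h
  · rw [abs_of_nonneg (shift_nonneg hκ h), abs_of_nonneg h, shift_of_nonneg h]
  · rw [abs_of_nonpos (shift_nonpos hκ h), abs_of_nonpos h, shift_of_nonpos h]
    ring

theorem minAbs_shift (hκ : 0 ≤ κ) (y : Fin 3 → ℝ) : minAbs (shift κ y) = κ * minAbs y := by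
  rw [minAbs, abs_shift hκ, abs_shift hκ, abs_shift hκ, min_add_add_right, min_add_add_right]
  change minAbs y + _ = _
  ring

theorem topTwo_shift (hκ : 0 ≤ κ) (y : Fin 3 → ℝ) :
    topTwo (shift κ y) = topTwo y + 2 * ((κ - 1) * minAbs y) := by
  rw [topTwo, abs_shift hκ, abs_shift hκ, abs_shift hκ, minAbs_shift hκ, topTwo]
  ring

theorem clampVec_shift (y : Fin 3 → ℝ) (hκ : 0 ≤ κ) : clampVec (shift κ y) = κ • clampVec y := by
  funext j
  rw [Pi.smul_apply, smul_eq_mul]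
  rcases le_total 0 (y j) with h | h
  · rw [clampVec_of_nonneg (shift_nonneg hκ h), clampVec_of_nonneg h, minAbs_shift hκ]
  · rw [clampVec_of_nonpos (shift_nonpos hκ h), clampVec_of_nonpos h, minAbs_shift hκ]
    ring

theorem shift_shift (y : Fin 3 → ℝ) (hκ : 0 ≤ κ) (κ' : ℝ) :
    shift κ' (shift κ y) = shift (κ' * κ) y := by
  rw [shift, clampVec_shift y hκ, shift, shift]
  module

theorem shift_one (y : Fin 3 → ℝ) : shift 1 y = y := by simp [shift]

/-- For `κ > 0` no coordinate changes sign or becomes zero, so `shift` respects the sign of the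
product of the coordinates. -/
theorem exists_shift_eq_mul (y : Fin 3 → ℝ) (hκ : 0 < κ) (j : Fin 3) :
    ∃ r : ℝ, 0 < r ∧ shift κ y j = r * y j := by
  rcases eq_or_ne (y j) 0 with h | h
  · refine ⟨1, one_pos, ?_⟩
    rw [shift_of_nonneg h.ge, minAbs_eq_zero h]
    ring
  · have habs := abs_pos.2 h
    refine ⟨(|y j| + (κ - 1) * minAbs y) / |y j|, div_pos ?_ habs, ?_⟩
    · have h1 := minAbs_le y j
      rcases (minAbs_nonneg y).eq_or_lt with h0 | h0
      · rw [← h0]; linarith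
      · have := mul_pos hκ h0
        linarith
    · rcases le_total 0 (y j) with h' | h'
      · rw [shift_of_nonneg h']
        rw [abs_of_nonneg h'] at habs ⊢
        field_simp
      · rw [shift_of_nonpos h']
        rw [abs_of_nonpos h'] at habs ⊢
        field_simp
        ring

theorem prod_shift_nonneg_iff (y : Fin 3 → ℝ) (hκ : 0 < κ) :
    0 ≤ shift κ y 0 * shift κ y 1 * shift κ y 2 ↔ 0 ≤ y 0 * y 1 * y 2 := by
  obtain ⟨r, hr, er⟩ := exists_shift_eq_mul y hκ 0
  obtain ⟨s, hs, es⟩ := exists_shift_eq_mul y hκ 1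
  obtain ⟨t, ht, et⟩ := exists_shift_eq_mul y hκ 2
  rw [er, es, et, show r * y 0 * (s * y 1) * (t * y 2) = r * s * t * (y 0 * y 1 * y 2) by ring,
    mul_nonneg_iff_of_pos_left (by positivity)]

theorem signedMin_shift (hκ : 0 ≤ κ) (y : Fin 3 → ℝ) : signedMin (shift κ y) = κ * signedMin y := by
  rcases hκ.eq_or_lt with rfl | hκ
  · have := abs_signedMin (shift 0 y)
    rw [minAbs_shift le_rfl, zero_mul, abs_eq_zero] at this
    rw [this, zero_mul]
  · simp only [signedMin, prod_shift_nonneg_iff y hκ, minAbs_shift hκ.le]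
    split_ifs <;> ring

end Shift

/-! ### The linear forms with coefficients `±1` -/

/-- The linear form with coefficients `cubeSign i`. -/
noncomputable def signDot (i : Fin 8) (y : Fin 3 → ℝ) : ℝ :=
  cubeSign i 0 * y 0 + cubeSign i 1 * y 1 + cubeSign i 2 * y 2

theorem cubeSign_eq (i : Fin 8) (j : Fin 3) : cubeSign i j = 1 ∨ cubeSign i j = -1 := by
  fin_cases i <;> fin_cases j <;> simp [cubeSign]

/-- This makes the alternating signs in the last entries of the walls a function of the sign vector.
-/
theorem cubeSign_prod (i : Fin 8) :
    cubeSign i 0 * cubeSign i 1 * cubeSign i 2 = (-1) ^ (i : ℕ) := by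
  fin_cases i <;> simp [cubeSign, pow_succ]

theorem exists_cubeSign_eq {a b c : ℝ} (ha : a = 1 ∨ a = -1) (hb : b = 1 ∨ b = -1)
    (hc : c = 1 ∨ c = -1) : ∃ i, cubeSign i 0 = a ∧ cubeSign i 1 = b ∧ cubeSign i 2 = c := by
  rcases ha with rfl | rfl <;> rcases hb with rfl | rfl <;> rcases hc with rfl | rfl
  · exact ⟨0, rfl, rfl, rfl⟩
  · exact ⟨3, rfl, rfl, rfl⟩
  · exact ⟨1, rfl, rfl, rfl⟩
  · exact ⟨2, rfl, rfl, rfl⟩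
  · exact ⟨5, rfl, rfl, rfl⟩
  · exact ⟨4, rfl, rfl, rfl⟩
  · exact ⟨6, rfl, rfl, rfl⟩
  · exact ⟨7, rfl, rfl, rfl⟩

theorem neg_one_pow_eq (i : Fin 8) : (-1 : ℝ) ^ (i : ℕ) = 1 ∨ (-1 : ℝ) ^ (i : ℕ) = -1 :=
  neg_one_pow_eq_or ℝ i

/-- If the parity of `i` is the sign of the product of the coordinates, the bound is the full sum of
absolute values. If it is opposite, some term is negative, which costs at least twice the smallest
absolute value. -/
theorem signDot_le (i : Fin 8) (y : Fin 3 → ℝ) :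
    signDot i y ≤ topTwo y + (-1) ^ (i : ℕ) * signedMin y := by
  have hz : ∀ j, cubeSign i j * y j ≤ |y j| ∧ (cubeSign i j * y j < 0 →
      cubeSign i j * y j = -|y j|) := by
    intro j
    have e : |cubeSign i j * y j| = |y j| := by
      rw [abs_mul]
      rcases cubeSign_eq i j with h | h <;> simp [h]
    rw [← e]
    exact ⟨le_abs_self _, fun h => by rw [abs_of_neg h, neg_neg]⟩
  obtain ⟨a0, b0⟩ := hz 0
  obtain ⟨a1, b1⟩ := hz 1
  obtain ⟨a2, b2⟩ := hz 2
  have m0 := minAbs_le y 0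
  have m1 := minAbs_le y 1
  have m2 := minAbs_le y 2
  have key : (-1) ^ (i : ℕ) * signedMin y = minAbs y ∨ (-1) ^ (i : ℕ) * signedMin y = -minAbs y ∧
      (cubeSign i 0 * y 0) * (cubeSign i 1 * y 1) * (cubeSign i 2 * y 2) < 0 := by
    rw [show (cubeSign i 0 * y 0) * (cubeSign i 1 * y 1) * (cubeSign i 2 * y 2) =
      cubeSign i 0 * cubeSign i 1 * cubeSign i 2 * (y 0 * y 1 * y 2) by ring, cubeSign_prod]
    unfold signedMin
    rcases neg_one_pow_eq i with h | h <;> rw [h] <;> split_ifs with hp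
    · simp
    · exact Or.inr ⟨by ring, by linarith⟩
    · rcases hp.eq_or_lt with h0 | h0
      · rw [minAbs_eq_zero_of_prod h0.symm]; simp
      · exact Or.inr ⟨by ring, by linarith⟩
    · simp
  unfold signDot topTwo
  rcases key with h | ⟨h, hneg⟩
  · linarith
  · have : cubeSign i 0 * y 0 < 0 ∨ cubeSign i 1 * y 1 < 0 ∨ cubeSign i 2 * y 2 < 0 := by
      by_contra! hc
      exact hneg.not_ge (mul_nonneg (mul_nonneg hc.1 hc.2.1) hc.2.2)
    rcases this with h' | h' | h'
    · have := b0 h'; linarith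
    · have := b1 h'; linarith
    · have := b2 h'; linarith

/-- Align all signs with the coordinates; if this gives the wrong parity, flip the sign at a
coordinate of smallest absolute value. -/
theorem exists_signDot_eq (y : Fin 3 → ℝ) {ε : ℝ} (hε : ε = 1 ∨ ε = -1) :
    ∃ i : Fin 8, (-1) ^ (i : ℕ) = ε ∧ signDot i y = topTwo y + ε * signedMin y := by
  have hs : ∀ j, ∃ a : ℝ, (a = 1 ∨ a = -1) ∧ a * y j = |y j| := by
    intro j
    rcases le_total 0 (y j) with h | h
    · exact ⟨1, Or.inl rfl, by rw [abs_of_nonneg h, one_mul]⟩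
    · exact ⟨-1, Or.inr rfl, by rw [abs_of_nonpos h, neg_one_mul]⟩
  obtain ⟨a, ha, ea⟩ := hs 0
  obtain ⟨b, hb, eb⟩ := hs 1
  obtain ⟨c, hc, ec⟩ := hs 2
  have hP : signedMin y = a * b * c * minAbs y := by
    have hprod : a * b * c * (y 0 * y 1 * y 2) = |y 0| * |y 1| * |y 2| := by
      rw [← ea, ← eb, ← ec]; ring
    have hnn : 0 ≤ |y 0| * |y 1| * |y 2| := by positivity
    have habc : a * b * c = 1 ∨ a * b * c = -1 := by
      rcases ha with rfl | rfl <;> rcases hb with rfl | rfl <;> rcases hc with rfl | rfl <;>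
        norm_num
    unfold signedMin
    rcases habc with h | h <;> rw [h] at hprod ⊢ <;> split_ifs with hp
    · ring
    · linarith
    · rw [minAbs_eq_zero_of_prod (le_antisymm (by linarith) hp)]; ring
    · ring
  have habc : a * b * c = ε ∨ a * b * c = -ε := by
    rcases ha with rfl | rfl <;> rcases hb with rfl | rfl <;> rcases hc with rfl | rfl <;>
      rcases hε with rfl | rfl <;> norm_num
  have hεε : ε * ε = 1 := by rcases hε with rfl | rfl <;> norm_num
  have hneg : ∀ {a : ℝ}, a = 1 ∨ a = -1 → -a = 1 ∨ -a = -1 := by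
    rintro a (rfl | rfl) <;> norm_num
  have fin : ∀ {a' b' c' : ℝ}, (a' = 1 ∨ a' = -1) → (b' = 1 ∨ b' = -1) → (c' = 1 ∨ c' = -1) →
      a' * b' * c' = ε → a' * y 0 + b' * y 1 + c' * y 2 = topTwo y + ε * signedMin y →
      ∃ i : Fin 8, (-1) ^ (i : ℕ) = ε ∧ signDot i y = topTwo y + ε * signedMin y := by
    intro a' b' c' ha hb hc h h'
    obtain ⟨i, i0, i1, i2⟩ := exists_cubeSign_eq ha hb hc
    exact ⟨i, by rw [← cubeSign_prod, i0, i1, i2, h], by rw [signDot, i0, i1, i2, h']⟩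
  rcases habc with h | h
  · refine fin ha hb hc h ?_
    rw [hP, h, ← mul_assoc, hεε, ea, eb, ec, topTwo]
    ring
  · have e : topTwo y + ε * signedMin y = |y 0| + |y 1| + |y 2| - 2 * minAbs y := by
      rw [hP, h, topTwo]
      linear_combination (-minAbs y) * hεε
    rw [e] at fin ⊢
    obtain ⟨j, hj⟩ := exists_abs_eq_minAbs y
    fin_cases j
    · exact fin (hneg ha) hb hc (by linarith) (by simp at hj; linarith)
    · exact fin ha (hneg hb) hc (by linarith) (by simp at hj; linarith)
    · exact fin ha hb (hneg hc) (by linarith) (by simp at hj; linarith)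

theorem signDot_shift (i : Fin 8) (κ : ℝ) (y : Fin 3 → ℝ) :
    signDot i (shift κ y) = signDot i y + (κ - 1) * signDot i (clampVec y) := by
  simp only [signDot, shift, Pi.add_apply, Pi.smul_apply, smul_eq_mul]
  ring

/-- Both sides are affine in `κ ≥ 0`, one bounds the other, and they agree at the interior point `κ
= 1`. Hence they agree throughout; the values 0 and 2 give the two inequalities between the slopes.
-/
theorem signDot_shift_eq {i : Fin 8} {κ : ℝ} (hκ : 0 ≤ κ) {y : Fin 3 → ℝ}
    (h : signDot i y = topTwo y + (-1) ^ (i : ℕ) * signedMin y) :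
    signDot i (shift κ y) = topTwo (shift κ y) + (-1) ^ (i : ℕ) * signedMin (shift κ y) := by
  have h0 := signDot_le i (shift 0 y)
  have h2 := signDot_le i (shift 2 y)
  rw [signDot_shift, topTwo_shift le_rfl, signedMin_shift le_rfl] at h0
  rw [signDot_shift, topTwo_shift zero_le_two, signedMin_shift zero_le_two] at h2
  have hu : signDot i (clampVec y) = 2 * minAbs y + (-1) ^ (i : ℕ) * signedMin y := by
    apply le_antisymm <;> linarith
  rw [signDot_shift, topTwo_shift hκ, signedMin_shift hκ, hu, h]
  ring

theorem signDot_shift_eq_iff {i : Fin 8} {κ : ℝ} (hκ : 0 < κ) {y : Fin 3 → ℝ} :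
    signDot i (shift κ y) = topTwo (shift κ y) + (-1) ^ (i : ℕ) * signedMin (shift κ y) ↔
      signDot i y = topTwo y + (-1) ^ (i : ℕ) * signedMin y := by
  refine ⟨fun h => ?_, signDot_shift_eq hκ.le⟩
  have := signDot_shift_eq (inv_pos.2 hκ).le h
  rwa [shift_shift y hκ.le, inv_mul_cancel₀ hκ.ne', shift_one] at this

/-! ### Models of the polytopes -/

/-- Multiplication of the smallest absolute value of a coordinate by a factor depending on the sign
of the product of coordinates. -/
noncomputable def fold (κ₁ κ₂ : ℝ) (y : Fin 3 → ℝ) : Fin 3 → ℝ :=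
  if 0 ≤ y 0 * y 1 * y 2 then shift κ₁ y else shift κ₂ y

theorem fold_fold {κ₁ κ₂ κ₁' κ₂' : ℝ} (h₁ : 0 < κ₁) (h₂ : 0 < κ₂) (y : Fin 3 → ℝ) :
    fold κ₁' κ₂' (fold κ₁ κ₂ y) = fold (κ₁' * κ₁) (κ₂' * κ₂) y := by
  unfold fold
  split_ifs with h h' h'
  · exact shift_shift y h₁.le _
  · exact absurd ((prod_shift_nonneg_iff y h₁).2 h) h'
  · exact absurd ((prod_shift_nonneg_iff y h₂).1 h') h
  · exact shift_shift y h₂.le _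

theorem fold_one (y : Fin 3 → ℝ) : fold 1 1 y = y := by
  unfold fold
  rw [shift_one, ite_self]

/-- The two branches meet where the product of the coordinates vanishes, and there `clampVec` is
zero. -/
theorem continuous_fold :
    Continuous fun a : ℝ × ℝ × (Fin 3 → ℝ) => fold a.1 a.2.1 a.2.2 := by
  have := continuous_clampVec
  unfold fold shift
  refine Continuous.if_le (by fun_prop) (by fun_prop) continuous_const (by fun_prop) ?_
  intro a h
  have : clampVec a.2.2 = 0 := by
    funext j
    have h0 := minAbs_eq_zero_of_prod h.symm
    simp [clampVec, h0]
  rw [this, smul_zero, smul_zero]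

/-- The cuboctahedron without its vertices, with a normalization which moves the vertices to
infinity. -/
def baseModel : Set (Fin 3 → ℝ) :=
  {y | |signedMin y| ≤ 1 ∧ ∀ j, 2 * |y j| ≤ 1 + topTwo y}

/-- The rescaled polytope with a similar normalization. -/
def prismModel (s : ℝ) : Set ((Fin 3 → ℝ) × ℝ) :=
  {z | |signedMin z.1 + z.2| ≤ 1 ∧ |signedMin z.1 - s * z.2| ≤ 1 ∧
    ∀ j, 2 * |z.1 j| ≤ 1 + topTwo z.1}

/-- The factor relating the sections at height `h` of the polytope and of the prism. -/
noncomputable def foldFactor (s h : ℝ) : ℝ := (1 + s) / (1 + s * h)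

section Model

variable {s h : ℝ}

theorem one_add_mul_pos (hs : |s| < 1) (hh : |h| ≤ 1) : 0 < 1 + s * h := by
  have : |s * h| < 1 := by
    rw [abs_mul]
    exact (mul_le_of_le_one_right (abs_nonneg s) hh).trans_lt hs
  linarith [(abs_lt.1 this).1]

theorem foldFactor_pos (hs : |s| < 1) (hh : |h| ≤ 1) : 0 < foldFactor s h :=
  div_pos (by linarith [(abs_lt.1 hs).1]) (one_add_mul_pos hs hh)

/-- The section at height `h`: the images under `fold`. -/
theorem exists_fold_eq (hs : |s| < 1) (hh : |h| ≤ 1) (y : Fin 3 → ℝ) :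
    ∃ κ, 0 < κ ∧ fold (foldFactor s h) (foldFactor s (-h)) y = shift κ y ∧
    (∀ ε : ℝ, ε = 1 ∨ ε = -1 → (ε * (signedMin y - s * (h - signedMin y)) ≤ 1 ↔
      ε * (κ * signedMin y) ≤ 1)) ∧
    (∀ ε : ℝ, ε = 1 ∨ ε = -1 → (ε * (signedMin y - s * (h - signedMin y)) = 1 ↔
      ε * (κ * signedMin y) = 1)) := by
  have hm := minAbs_nonneg y
  have hh' : |-h| ≤ 1 := by rwa [abs_neg]
  have p₁ := one_add_mul_pos hs hh
  have p₂ := one_add_mul_pos hs hh'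
  have q₁ := foldFactor_pos hs hh
  have q₂ := foldFactor_pos hs hh'
  have e₁ : (1 + s * h) * foldFactor s h = 1 + s := by
    unfold foldFactor; exact mul_div_cancel₀ _ p₁.ne'
  have e₂ : (1 + s * -h) * foldFactor s (-h) = 1 + s := by
    unfold foldFactor; exact mul_div_cancel₀ _ p₂.ne'
  by_cases hp : 0 ≤ y 0 * y 1 * y 2
  · refine ⟨foldFactor s h, q₁, if_pos hp, ?_⟩
    have hd : signedMin y = minAbs y := if_pos hp
    rw [hd]
    have hk := mul_nonneg q₁.le hm
    have hpk := mul_nonneg p₁.le hk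
    -- Relative to the bound 1, the two quantities differ by the positive factor `1 + s * h`. The
    -- opposite bound -1 holds strictly on both sides, so it can be ignored; the other sign of the
    -- product is symmetric under `h ↦ -h`.
    have e : minAbs y - s * (h - minAbs y) = 1 + (1 + s * h) * (foldFactor s h * minAbs y - 1) := by
      linear_combination (-minAbs y) * e₁
    rw [e]
    refine ⟨?_, ?_⟩
    · rintro ε (rfl | rfl)
      · rw [one_mul, one_mul, add_le_iff_nonpos_right, mul_nonpos_iff_pos_imp_nonpos]
        exact ⟨fun h => sub_nonpos.1 (h.1 p₁), fun h => ⟨fun _ => sub_nonpos.2 h,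
          fun h' => p₁.le⟩⟩
      · exact ⟨fun _ => by linarith, fun _ => by linarith⟩
    · rintro ε (rfl | rfl)
      · rw [one_mul, one_mul, add_eq_left, mul_eq_zero, sub_eq_zero]
        exact ⟨fun h => h.resolve_left p₁.ne', Or.inr⟩
      · exact ⟨fun _ => by linarith, fun _ => by linarith⟩
  · refine ⟨foldFactor s (-h), q₂, if_neg hp, ?_⟩
    have hd : signedMin y = -minAbs y := if_neg hp
    rw [hd]
    have hk := mul_nonneg q₂.le hm
    have hpk := mul_nonneg p₂.le hk
    have e : -minAbs y - s * (h - -minAbs y) =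
        -(1 + (1 + s * -h) * (foldFactor s (-h) * minAbs y - 1)) := by
      linear_combination (minAbs y) * e₂
    rw [e]
    refine ⟨?_, ?_⟩
    · rintro ε (rfl | rfl)
      · exact ⟨fun _ => by linarith, fun _ => by linarith⟩
      · rw [neg_one_mul, neg_neg, add_le_iff_nonpos_right, mul_nonpos_iff_pos_imp_nonpos]
        exact ⟨fun h => by linarith [h.1 p₂], fun h => ⟨fun _ => by linarith,
          fun h' => p₂.le⟩⟩
    · rintro ε (rfl | rfl)
      · exact ⟨fun _ => by linarith, fun _ => by linarith⟩
      · rw [neg_one_mul, neg_neg, add_eq_left, mul_eq_zero, sub_eq_zero]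
        exact ⟨fun h => by linarith [h.resolve_left p₂.ne'], fun h => Or.inr (by linarith)⟩

end Model

theorem abs_le_one_iff_sign {x : ℝ} : |x| ≤ 1 ↔ ∀ ε : ℝ, ε = 1 ∨ ε = -1 → ε * x ≤ 1 := by
  rw [abs_le']
  constructor
  · rintro ⟨h₁, h₂⟩ ε (rfl | rfl) <;> linarith
  · intro h
    have h₁ := h 1 (Or.inl rfl)
    have h₂ := h (-1) (Or.inr rfl)
    constructor <;> linarith

/-- `fold` turns the triangle bound at height `h` into the one of the cuboctahedron. The
quadrilateral bounds are unaffected, since `2 |y j|` and `topTwo y` change by the same amount. -/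
theorem fold_mem_baseModel_iff {s : ℝ} (hs : |s| < 1) {h : ℝ} (hh : |h| ≤ 1) (y : Fin 3 → ℝ) :
    fold (foldFactor s h) (foldFactor s (-h)) y ∈ baseModel ↔
      (y, h - signedMin y) ∈ prismModel s := by
  obtain ⟨κ, hκ, e, h₁, -⟩ := exists_fold_eq hs hh y
  have hd : |κ * signedMin y| ≤ 1 ↔ |signedMin y - s * (h - signedMin y)| ≤ 1 := by
    rw [abs_le_one_iff_sign, abs_le_one_iff_sign]
    exact forall₂_congr fun ε hε => (h₁ ε hε).symm
  have hj : ∀ j, 2 * |shift κ y j| ≤ 1 + topTwo (shift κ y) ↔ 2 * |y j| ≤ 1 + topTwo y := by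
    intro j
    rw [abs_shift hκ.le, topTwo_shift hκ.le]
    constructor <;> intro <;> linarith
  rw [e]
  simp only [baseModel, prismModel, Set.mem_ofPred_eq, signedMin_shift hκ.le, hd, hj,
    add_sub_cancel, hh, true_and]

/-- The polytope is homeomorphic to a prism over the cuboctahedron. -/
noncomputable def modelHomeo {s : ℝ} (hs : |s| < 1) :
    prismModel s ≃ₜ baseModel × Set.Icc (-1 : ℝ) 1 where
  toFun z := (⟨fold (foldFactor s (signedMin z.1.1 + z.1.2))
      (foldFactor s (-(signedMin z.1.1 + z.1.2))) z.1.1,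
      (fold_mem_baseModel_iff hs z.2.1 z.1.1).2 (by rw [add_sub_cancel_left]; exact z.2)⟩,
    ⟨signedMin z.1.1 + z.1.2, abs_le.1 z.2.1⟩)
  invFun w := ⟨(fold (foldFactor s w.2)⁻¹ (foldFactor s (-w.2))⁻¹ w.1.1,
      w.2 - signedMin (fold (foldFactor s w.2)⁻¹ (foldFactor s (-w.2))⁻¹ w.1.1)), by
    have hh : |(w.2 : ℝ)| ≤ 1 := abs_le.2 w.2.2
    have hh' : |-(w.2 : ℝ)| ≤ 1 := by rwa [abs_neg]
    have p₁ := foldFactor_pos hs hh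
    have p₂ := foldFactor_pos hs hh'
    rw [← fold_mem_baseModel_iff hs hh, fold_fold (inv_pos.2 p₁) (inv_pos.2 p₂),
      mul_inv_cancel₀ p₁.ne', mul_inv_cancel₀ p₂.ne', fold_one]
    exact w.1.2⟩
  left_inv z := by
    have hh : |signedMin z.1.1 + z.1.2| ≤ 1 := z.2.1
    have hh' : |-(signedMin z.1.1 + z.1.2)| ≤ 1 := by rwa [abs_neg]
    have p₁ := foldFactor_pos hs hh
    have p₂ := foldFactor_pos hs hh'
    have e : fold (foldFactor s (signedMin z.1.1 + z.1.2))⁻¹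
        (foldFactor s (-(signedMin z.1.1 + z.1.2)))⁻¹
        (fold (foldFactor s (signedMin z.1.1 + z.1.2))
          (foldFactor s (-(signedMin z.1.1 + z.1.2))) z.1.1) = z.1.1 := by
      rw [fold_fold p₁ p₂, inv_mul_cancel₀ p₁.ne', inv_mul_cancel₀ p₂.ne', fold_one]
    refine Subtype.ext (Prod.ext e ?_)
    simp only [e, add_sub_cancel_left]
  right_inv w := by
    have hh : |(w.2 : ℝ)| ≤ 1 := abs_le.2 w.2.2
    have hh' : |-(w.2 : ℝ)| ≤ 1 := by rwa [abs_neg]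
    have p₁ := foldFactor_pos hs hh
    have p₂ := foldFactor_pos hs hh'
    refine Prod.ext (Subtype.ext ?_) (Subtype.ext ?_)
    · simp only [add_sub_cancel]
      rw [fold_fold (inv_pos.2 p₁) (inv_pos.2 p₂),
        mul_inv_cancel₀ p₁.ne', mul_inv_cancel₀ p₂.ne', fold_one]
    · simp only [add_sub_cancel]
  continuous_toFun := by
    have hc := continuous_signedMin
    have c0 : Continuous fun z : prismModel s => signedMin z.1.1 + z.1.2 := by fun_prop
    have c₁ : Continuous fun z : prismModel s => foldFactor s (signedMin z.1.1 + z.1.2) :=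
      continuous_const.div (by fun_prop) fun z => (one_add_mul_pos hs z.2.1).ne'
    have c₂ : Continuous fun z : prismModel s => foldFactor s (-(signedMin z.1.1 + z.1.2)) :=
      continuous_const.div (by fun_prop) fun z =>
        (one_add_mul_pos hs (by rw [abs_neg]; exact z.2.1)).ne'
    refine Continuous.prodMk (Continuous.subtype_mk ?_ _) (Continuous.subtype_mk c0 _)
    exact continuous_fold.comp (c₁.prodMk (c₂.prodMk (by fun_prop)))
  continuous_invFun := by
    have hc := continuous_signedMin
    have c₁ : Continuous fun w : baseModel × Set.Icc (-1 : ℝ) 1 => (foldFactor s w.2)⁻¹ :=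
      (continuous_const.div (by fun_prop) fun w =>
        (one_add_mul_pos hs (abs_le.2 w.2.2)).ne').inv₀
        fun w => (foldFactor_pos hs (abs_le.2 w.2.2)).ne'
    have c₂ : Continuous fun w : baseModel × Set.Icc (-1 : ℝ) 1 => (foldFactor s (-w.2))⁻¹ :=
      (continuous_const.div (by fun_prop) fun w =>
        (one_add_mul_pos hs (by rw [abs_neg]; exact abs_le.2 w.2.2)).ne').inv₀
        fun w => (foldFactor_pos hs (by rw [abs_neg]; exact abs_le.2 w.2.2)).ne'
    have c₃ : Continuous fun w : baseModel × Set.Icc (-1 : ℝ) 1 =>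
        fold (foldFactor s w.2)⁻¹ (foldFactor s (-w.2))⁻¹ w.1.1 :=
      continuous_fold.comp (c₁.prodMk (c₂.prodMk (by fun_prop)))
    exact Continuous.subtype_mk (c₃.prodMk
      ((by fun_prop : Continuous fun w : baseModel × Set.Icc (-1 : ℝ) 1 => (w.2 : ℝ)).sub
        (hc.comp c₃))) _

/-- Equality on wall `i` splits into two equalities: `signDot i` is maximal for its parity, and the
bound on the signed minimum is attained with that sign. Each is preserved by `fold`. -/
theorem modelHomeo_tri_iff {s : ℝ} (hs : |s| < 1) (z : prismModel s) (i : Fin 8) :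
    signDot i z.1.1 - (-1) ^ (i : ℕ) * s * z.1.2 = 1 + topTwo z.1.1 ↔
      signDot i (modelHomeo hs z).1.1 = 1 + topTwo (modelHomeo hs z).1.1 := by
  obtain ⟨⟨y, ω⟩, hz⟩ := z
  have hh : |signedMin y + ω| ≤ 1 := hz.1
  have hb := (modelHomeo hs ⟨(y, ω), hz⟩).1.2
  change signDot i y - (-1) ^ (i : ℕ) * s * ω = 1 + topTwo y ↔
    signDot i (fold (foldFactor s (signedMin y + ω)) (foldFactor s (-(signedMin y + ω))) y) =
      1 + topTwo (fold (foldFactor s (signedMin y + ω)) (foldFactor s (-(signedMin y + ω))) y)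
  change fold (foldFactor s (signedMin y + ω)) (foldFactor s (-(signedMin y + ω))) y ∈ _ at hb
  obtain ⟨κ, hκ, e, -, h₂⟩ := exists_fold_eq hs hh y
  rw [e] at hb ⊢
  have hd := abs_le_one_iff_sign.1 hz.2.1 _ (neg_one_pow_eq i)
  have hd' := abs_le_one_iff_sign.1 hb.1 _ (neg_one_pow_eq i)
  have hle := signDot_le i y
  have hle' := signDot_le i (shift κ y)
  have k₂ := h₂ _ (neg_one_pow_eq i)
  rw [add_sub_cancel_left] at k₂
  rw [signedMin_shift hκ.le] at hd' hle'
  have k₁ := signDot_shift_eq_iff (i := i) hκ (y := y)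
  rw [signedMin_shift hκ.le] at k₁
  constructor
  · intro h
    have := k₁.2 (le_antisymm hle (by linarith))
    have := k₂.1 (le_antisymm hd (by linarith))
    linarith
  · intro h
    have := k₁.1 (le_antisymm hle' (by linarith))
    have := k₂.2 (le_antisymm hd' (by linarith))
    linarith

/-- On such a wall `σ * y j` is positive, so it equals `|y j|` and is shifted by half of the change
of `topTwo`. -/
theorem shift_quad_iff {κ : ℝ} (hκ : 0 < κ) {y : Fin 3 → ℝ} (j : Fin 3) {σ : ℝ}
    (hσ : σ = 1 ∨ σ = -1) :
    2 * (σ * shift κ y j) = 1 + topTwo (shift κ y) ↔ 2 * (σ * y j) = 1 + topTwo y := by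
  have key : ∀ {κ : ℝ} {y : Fin 3 → ℝ}, 0 < κ → 2 * (σ * y j) = 1 + topTwo y →
      2 * (σ * shift κ y j) = 1 + topTwo (shift κ y) := by
    intro κ y hκ h
    have hpos : 0 < σ * y j := by linarith [topTwo_nonneg y]
    rw [topTwo_shift hκ.le]
    rcases hσ with rfl | rfl
    · rw [shift_of_nonneg (by linarith)]
      linarith
    · rw [shift_of_nonpos (by linarith)]
      linarith
  refine ⟨fun h => ?_, key hκ⟩
  have := key (inv_pos.2 hκ) h
  rwa [shift_shift y hκ.le, inv_mul_cancel₀ hκ.ne', shift_one] at this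

theorem modelHomeo_quad_iff {s : ℝ} (hs : |s| < 1) (z : prismModel s) (j : Fin 3) {σ : ℝ}
    (hσ : σ = 1 ∨ σ = -1) :
    2 * (σ * z.1.1 j) = 1 + topTwo z.1.1 ↔
      2 * (σ * (modelHomeo hs z).1.1 j) = 1 + topTwo (modelHomeo hs z).1.1 := by
  obtain ⟨κ, hκ, e, -⟩ := exists_fold_eq hs z.2.1 z.1.1
  change _ ↔ 2 * (σ * fold (foldFactor s (signedMin z.1.1 + z.1.2))
    (foldFactor s (-(signedMin z.1.1 + z.1.2))) z.1.1 j) = 1 + topTwo (fold (foldFactor s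
      (signedMin z.1.1 + z.1.2)) (foldFactor s (-(signedMin z.1.1 + z.1.2))) z.1.1)
  rw [e]
  exact (shift_quad_iff hκ j hσ).symm

/-- Top and bottom correspond to the two parities: the walls of even `i` bound the height by 1,
those of odd `i` by -1, and some form of each parity is maximal. -/
theorem modelHomeo_pos_iff {s : ℝ} (hs : |s| < 1) (z : prismModel s) :
    (∃ i : Fin 8, signDot i z.1.1 + (-1) ^ (i : ℕ) * z.1.2 = 1 + topTwo z.1.1) ↔
      ((modelHomeo hs z).2 : ℝ) ^ 2 = 1 := by
  change _ ↔ (signedMin z.1.1 + z.1.2) ^ 2 = 1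
  rw [sq, mul_self_eq_one_iff]
  have hd := abs_le_one_iff_sign.1 z.2.1
  constructor
  · rintro ⟨i, h⟩
    have h₁ := hd _ (neg_one_pow_eq i)
    have h₂ := signDot_le i z.1.1
    rcases neg_one_pow_eq i with e | e <;> rw [e] at h h₁ h₂
    · exact Or.inl (by linarith)
    · exact Or.inr (by linarith)
  · rintro (h | h)
    · obtain ⟨i, e, hi⟩ := exists_signDot_eq z.1.1 (Or.inl rfl)
      exact ⟨i, by rw [hi, e]; linarith⟩
    · obtain ⟨i, e, hi⟩ := exists_signDot_eq z.1.1 (Or.inr rfl)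
      exact ⟨i, by rw [hi, e]; linarith⟩

/-! ### Homogeneous coordinates -/

theorem minAbs_smul {c : ℝ} (hc : 0 ≤ c) (y : Fin 3 → ℝ) : minAbs (c • y) = c * minAbs y := by
  simp only [minAbs, Pi.smul_apply, smul_eq_mul, abs_mul, abs_of_nonneg hc,
    mul_min_of_nonneg _ _ hc]

theorem topTwo_smul {c : ℝ} (hc : 0 ≤ c) (y : Fin 3 → ℝ) : topTwo (c • y) = c * topTwo y := by
  rw [topTwo, minAbs_smul hc, topTwo]
  simp only [Pi.smul_apply, smul_eq_mul, abs_mul, abs_of_nonneg hc]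
  ring

theorem signedMin_smul {c : ℝ} (hc : 0 < c) (y : Fin 3 → ℝ) :
    signedMin (c • y) = c * signedMin y := by
  have h : 0 ≤ (c • y) 0 * (c • y) 1 * (c • y) 2 ↔ 0 ≤ y 0 * y 1 * y 2 := by
    simp only [Pi.smul_apply, smul_eq_mul]
    rw [show c * y 0 * (c * y 1) * (c * y 2) = c ^ 3 * (y 0 * y 1 * y 2) by ring,
      mul_nonneg_iff_of_pos_left (by positivity)]
  simp only [signedMin, h, minAbs_smul hc.le]
  split_ifs <;> ring

/-- The absolute values of the coordinates, sorted. -/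
theorem exists_sorted (y : Fin 3 → ℝ) : ∃ a b c, 0 ≤ c ∧ c ≤ b ∧ b ≤ a ∧ topTwo y = a + b ∧
    minAbs y = c ∧ y 0 ^ 2 + y 1 ^ 2 + y 2 ^ 2 = a ^ 2 + b ^ 2 + c ^ 2 ∧ ∃ j, |y j| = a := by
  have n0 := abs_nonneg (y 0)
  have n1 := abs_nonneg (y 1)
  have n2 := abs_nonneg (y 2)
  have s0 := sq_abs (y 0)
  have s1 := sq_abs (y 1)
  have s2 := sq_abs (y 2)
  have main : ∀ {a b c : ℝ}, 0 ≤ c → c ≤ b → b ≤ a →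
      |y 0| + |y 1| + |y 2| = a + b + c → y 0 ^ 2 + y 1 ^ 2 + y 2 ^ 2 = a ^ 2 + b ^ 2 + c ^ 2 →
      minAbs y = c → (∃ j, |y j| = a) → ∃ a b c, 0 ≤ c ∧ c ≤ b ∧ b ≤ a ∧ topTwo y = a + b ∧
    minAbs y = c ∧ y 0 ^ 2 + y 1 ^ 2 + y 2 ^ 2 = a ^ 2 + b ^ 2 + c ^ 2 ∧ ∃ j, |y j| = a := by
    intro a b c hc hcb hba h1 h2 hm hj
    exact ⟨a, b, c, hc, hcb, hba, by rw [topTwo, h1, hm]; ring, hm, h2, hj⟩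
  have hm : ∀ {c : ℝ}, c ≤ |y 0| → c ≤ |y 1| → c ≤ |y 2| → (∃ j, |y j| = c) → minAbs y = c := by
    rintro c h0 h1 h2 ⟨j, hj⟩
    exact le_antisymm (hj ▸ minAbs_le y j) (le_min h0 (le_min h1 h2))
  rcases le_total |y 0| |y 1| with u | u <;> rcases le_total |y 0| |y 2| with v | v <;>
    rcases le_total |y 1| |y 2| with w | w
  · exact main n0 u w (by ring) (by linarith) (hm le_rfl u v ⟨0, rfl⟩) ⟨2, rfl⟩
  · exact main n0 v w (by ring) (by linarith) (hm le_rfl u v ⟨0, rfl⟩) ⟨1, rfl⟩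
  · exact main n0 u w (by ring) (by linarith) (hm le_rfl u (u.trans w) ⟨0, rfl⟩) ⟨2, rfl⟩
  · exact main n2 v u (by ring) (by linarith) (hm v w le_rfl ⟨2, rfl⟩) ⟨1, rfl⟩
  · exact main n1 u v (by ring) (by linarith) (hm u le_rfl w ⟨1, rfl⟩) ⟨2, rfl⟩
  · exact main n1 u v (by ring) (by linarith) (hm u le_rfl (u.trans v) ⟨1, rfl⟩) ⟨2, rfl⟩
  · exact main n1 w v (by ring) (by linarith) (hm u le_rfl w ⟨1, rfl⟩) ⟨0, rfl⟩
  · exact main n2 w u (by ring) (by linarith) (hm v w le_rfl ⟨2, rfl⟩) ⟨0, rfl⟩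

/-- Use `k² - s² h² = (k - s h)(k + s h) ≤ 2e |s h + k|` to remove `k`; what remains is `(1 + s)(e²
- 2 s h²)`, positive because `h² ≤ e²` and `s < 1/2`. -/
theorem quad_pos_of_pos {s e h k : ℝ} (hs : -1 < s) (hs' : s ≤ 1 / 3) (he : 0 < e) (hh : |h| ≤ e)
    (hk : |k| ≤ e) : 0 < (1 + s) * e ^ 2 + 4 * e * |s * h + k| - 2 * s * h ^ 2 - 2 * k ^ 2 := by
  have h1 : h ^ 2 ≤ e ^ 2 := sq_le_sq.2 (hh.trans_eq (abs_of_pos he).symm)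
  have h2 : 0 < e ^ 2 - 2 * s * h ^ 2 := by
    have he2 : 0 < e ^ 2 := by positivity
    nlinarith [sq_nonneg h]
  have h3 : |k - s * h| ≤ 2 * e := by
    have hsh : |s * h| ≤ e := by
      rw [abs_mul]
      have : |s| ≤ 1 := abs_le.2 ⟨hs.le, by linarith⟩
      nlinarith [abs_nonneg h]
    linarith [abs_sub k (s * h)]
  have h4 : (k - s * h) * (s * h + k) ≤ 2 * e * |s * h + k| := by
    refine (le_abs_self _).trans ?_
    rw [abs_mul]
    exact mul_le_mul_of_nonneg_right h3 (abs_nonneg _)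
  have h5 := mul_pos (by linarith : 0 < 1 + s) h2
  linarith

/-- The walls bound a region which meets the boundary of the model space only in ideal vertices. -/
theorem quad_neg_iff {s x₀ ω : ℝ} {y : Fin 3 → ℝ} (hs : -1 < s) (hs' : s ≤ 1 / 3)
    (h₁ : |signedMin y + ω| ≤ x₀ - topTwo y) (h₂ : |signedMin y - s * ω| ≤ x₀ - topTwo y)
    (h₃ : ∀ j, 2 * |y j| ≤ x₀) :
    -x₀ ^ 2 + 2 * (y 0 ^ 2 + y 1 ^ 2 + y 2 ^ 2 + s * ω ^ 2) < 0 ↔ 0 < x₀ - topTwo y := by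
  obtain ⟨a, b, c, hc, hcb, hba, hM, hm, hsq, j, hj⟩ := exists_sorted y
  have ha := h₃ j
  have hd := abs_signedMin y
  rw [hm] at hd
  have hd2 : signedMin y ^ 2 = c ^ 2 := by rw [← hd, sq_abs]
  rw [hsq]
  generalize signedMin y = d at *
  rw [hM] at h₁ h₂ ⊢
  rw [hj] at ha
  obtain ⟨e, rfl⟩ : ∃ e, x₀ = e + a + b := ⟨x₀ - a - b, by ring⟩
  rw [show e + a + b - (a + b) = e by ring] at h₁ h₂ ⊢
  have he0 : 0 ≤ e := (abs_nonneg _).trans h₁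
  have hab : a - b ≤ e := by linarith
  constructor
  · intro h
    -- With zero gap all inequalities become equalities, forcing `ω = 0` and `a = b`, so the form
    -- takes the value `2 c² ≥ 0`.
    refine he0.lt_of_ne' fun he => ?_
    subst he
    have e₁ := abs_nonpos_iff.1 h₁
    have e₂ := abs_nonpos_iff.1 h₂
    have hω : (1 + s) * ω = 0 := by linarith
    have hω0 : ω = 0 := (mul_eq_zero.1 hω).resolve_left (by linarith)
    obtain rfl : a = b := by linarith
    rw [hω0] at h
    nlinarith [sq_nonneg c]
  · intro he
    have key := quad_pos_of_pos hs hs' he h₁ h₂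
    have e₁ : s * (d + ω) + (d - s * ω) = (1 + s) * d := by ring
    have e₂ : 2 * s * (d + ω) ^ 2 + 2 * (d - s * ω) ^ 2 =
        (1 + s) * (2 * (c ^ 2 + s * ω ^ 2)) := by
      rw [← hd2]; ring
    rw [e₁, abs_mul, hd, abs_of_pos (by linarith : 0 < 1 + s)] at key
    have k' : 0 < (1 + s) * (e ^ 2 + 4 * e * c - 2 * (c ^ 2 + s * ω ^ 2)) := by linarith
    have k := (mul_pos_iff_of_pos_left (by linarith : 0 < 1 + s)).1 k'
    -- Negated, the form is `e² + 2e(a + b) - (a - b)² - 2(c² + s ω²)`. As `0 ≤ a - b ≤ e` and `c ≤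
    -- b ≤ a`, the part without `c² + s ω²` is at least `e² + 4 e c`, and `k` applies.
    nlinarith [mul_nonneg (sub_nonneg.2 hba) (sub_nonneg.2 hab),
      mul_nonneg he.le (sub_nonneg.2 hba), mul_nonneg he.le (sub_nonneg.2 hcb)]

theorem forall_signDot_le_iff {x₀ c : ℝ} {y : Fin 3 → ℝ} :
    (∀ i : Fin 8, signDot i y + (-1) ^ (i : ℕ) * c ≤ x₀) ↔ |signedMin y + c| ≤ x₀ - topTwo y := by
  rw [abs_le']
  constructor
  · intro h
    obtain ⟨i, e, hi⟩ := exists_signDot_eq y (Or.inl rfl)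
    obtain ⟨j, e', hj⟩ := exists_signDot_eq y (Or.inr rfl)
    have h₁ := h i
    have h₂ := h j
    rw [hi, e] at h₁
    rw [hj, e'] at h₂
    constructor <;> linarith
  · rintro ⟨h₁, h₂⟩ i
    have := signDot_le i y
    rcases neg_one_pow_eq i with e | e <;> rw [e] at this ⊢ <;> linarith

/-- The coordinate which does not vanish in the normal of a quadrilateral side. -/
def quadIndex : Fin 6 → Fin 3 := ![0, 1, 2, 2, 1, 0]

/-- The sign of that coordinate. -/
noncomputable def quadSgn : Fin 6 → ℝ := ![1, 1, 1, -1, -1, -1]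

theorem quadSgn_eq (X : Fin 6) : quadSgn X = 1 ∨ quadSgn X = -1 := by
  fin_cases X <;> simp [quadSgn]

theorem forall_quad_le_iff {x₀ : ℝ} {y : Fin 3 → ℝ} :
    (∀ X, 2 * (quadSgn X * y (quadIndex X)) ≤ x₀) ↔ ∀ j, 2 * |y j| ≤ x₀ := by
  constructor
  · intro h j
    have key : ∀ X X', quadIndex X = j → quadIndex X' = j → quadSgn X = 1 → quadSgn X' = -1 →
        2 * |y j| ≤ x₀ := by
      intro X X' e e' q q'
      have h₁ := h X
      have h₂ := h X'
      rw [e, q] at h₁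
      rw [e', q'] at h₂
      rcases abs_cases (y j) with ⟨a, -⟩ | ⟨a, -⟩ <;> rw [a] <;> linarith
    fin_cases j
    · exact key 0 5 rfl rfl rfl rfl
    · exact key 1 4 rfl rfl rfl rfl
    · exact key 2 3 rfl rfl rfl rfl
  · intro h X
    have h₁ := h (quadIndex X)
    have h₂ := le_abs_self (y (quadIndex X))
    have h₃ := neg_abs_le (y (quadIndex X))
    rcases quadSgn_eq X with e | e <;> rw [e] <;> linarith

/-! ### Charts of subsets of projective spheres -/

/-- A homeomorphism of a set of rays with a model, given by homogeneous maps. -/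
theorem exists_homeomorph_of_homogeneous {m : ℕ} {V : Type*} [TopologicalSpace V]
    {S : Set (Module.Ray ℝ (Fin m → ℝ))} {X : Set V} {a : (Fin m → ℝ) → V} {b : V → Fin m → ℝ}
    {e : (Fin m → ℝ) → ℝ} (hS : ∀ x hx, rayOfNeZero ℝ x hx ∈ S ↔ 0 < e x ∧ a x ∈ X)
    (ha : ContinuousOn a {x | 0 < e x}) (hb : Continuous b) (hb₀ : ∀ z, b z ≠ 0)
    (heb : ∀ z, 0 < e (b z)) (hab : ∀ z, a (b z) = z)
    (hba : ∀ x, 0 < e x → ∃ c : ℝ, 0 < c ∧ b (a x) = c • x)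
    (hsmul : ∀ c : ℝ, 0 < c → ∀ x, a (c • x) = a x) :
    ∃ f : S ≃ₜ X, ∀ z : X, (f.symm z : Module.Ray ℝ (Fin m → ℝ)) = rayOfNeZero ℝ (b z) (hb₀ z) := by
  -- By homogeneity the chosen representative of a ray does not matter.
  have hlift : ∀ x hx, a (rayOfNeZero ℝ x hx).someVector = a x := by
    intro x hx
    have := (rayOfNeZero ℝ x hx).someVector_ray
    obtain ⟨c, hc, h⟩ := ((ray_eq_iff _ _).1 this).exists_pos_right
      (rayOfNeZero ℝ x hx).someVector_ne_zero hx
    rw [h, hsmul c hc]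
  have hX : ∀ p ∈ S, a p.someVector ∈ X := by
    intro p hp
    rw [← p.someVector_ray, hS] at hp
    exact hp.2
  have hq : Topology.IsQuotientMap (S.restrictPreimage
      (fun v : {v : Fin m → ℝ // v ≠ 0} => rayOfNeZero ℝ v.1 v.2)) := by
    exact ((isOpenQuotientMap_ray (Fin m → ℝ)).restrictPreimage S).isQuotientMap
  refine ⟨⟨⟨fun p => ⟨a (p : Module.Ray ℝ (Fin m → ℝ)).someVector, hX p p.2⟩,
    fun z => ⟨rayOfNeZero ℝ (b z) (hb₀ z), (hS _ _).2 ⟨heb z, by rw [hab]; exact z.2⟩⟩,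
    ?_, ?_⟩, ?_, ?_⟩, fun z => rfl⟩
  · rintro ⟨p, hp⟩
    refine Subtype.ext ?_
    rw [← p.someVector_ray, hS] at hp
    obtain ⟨c, hc, h⟩ := hba _ hp.1
    refine Eq.trans ?_ p.someVector_ray
    refine (ray_eq_iff _ _).2 ?_
    change SameRay ℝ (b (a p.someVector)) _
    rw [h]
    exact SameRay.sameRay_pos_smul_left _ hc
  · rintro ⟨z, hz⟩
    exact Subtype.ext ((hlift _ _).trans (hab z))
  · refine Continuous.subtype_mk ?_ _
    rw [hq.continuous_iff]
    have : ((fun p : S => a (p : Module.Ray ℝ (Fin m → ℝ)).someVector) ∘ S.restrictPreimage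
        (fun v : {v : Fin m → ℝ // v ≠ 0} => rayOfNeZero ℝ v.1 v.2)) = fun v => a v.1.1 := by
      funext v
      exact hlift _ _
    rw [this]
    refine ha.comp_continuous (continuous_subtype_val.comp continuous_subtype_val) fun v => ?_
    exact ((hS _ _).1 v.2).1
  · refine Continuous.subtype_mk ((isOpenQuotientMap_ray (Fin m → ℝ)).continuous.comp
      (Continuous.subtype_mk (hb.comp continuous_subtype_val) fun z => hb₀ z)) _

/-! ### The chart of the cuboctahedron -/

/-- The vector with coordinates divided by `√2`. -/
noncomputable def halved (a b c : ℝ) : Fin 3 → ℝ := ![a / √2, b / √2, c / √2]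

theorem continuous_halved {X : Type*} [TopologicalSpace X] {f g h : X → ℝ} (hf : Continuous f)
    (hg : Continuous g) (hh : Continuous h) : Continuous fun x => halved (f x) (g x) (h x) := by
  refine continuous_pi fun j => ?_
  fin_cases j <;> simp [halved] <;> fun_prop

theorem halved_smul (c a₁ a₂ a₃ : ℝ) : halved (c * a₁) (c * a₂) (c * a₃) = c • halved a₁ a₂ a₃ := by
  funext j
  fin_cases j <;> simp [halved] <;> ring

theorem halved_mul (y : Fin 3 → ℝ) : halved (√2 * y 0) (√2 * y 1) (√2 * y 2) = y := by
  funext j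
  fin_cases j <;> simp [halved]

theorem sq_halved (a b c : ℝ) : a ^ 2 + b ^ 2 + c ^ 2 =
    2 * (halved a b c 0 ^ 2 + halved a b c 1 ^ 2 + halved a b c 2 ^ 2) := by
  simp only [halved, Matrix.cons_val, div_pow, Real.sq_sqrt zero_le_two]
  ring

theorem sideNormal_tri_dot (i : Fin 8) (x : Fin 4 → ℝ) : dotProduct (sideNormal (.tri i)) x =
    √2 * (signDot i (halved (x 1) (x 2) (x 3)) - x 0) := by
  simp [sideNormal, dotProduct, Fin.sum_univ_four, signDot, halved]
  field_simp
  ring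

theorem quadNormal_dot (X : Fin 6) (x₀ x₁ x₂ x₃ : ℝ) :
    quadNormal X 0 * x₀ + quadNormal X 1 * x₁ + quadNormal X 2 * x₂ + quadNormal X 3 * x₃ =
      2 * (quadSgn X * halved x₁ x₂ x₃ (quadIndex X)) - x₀ := by
  have h : ∀ a : ℝ, √2 * a = 2 * (a / √2) := by
    intro a
    rw [mul_div_left_comm, mul_comm, Real.div_sqrt]
  fin_cases X <;> simp [quadNormal, quadSgn, quadIndex, halved] <;>
    linarith [h x₁, h x₂, h x₃]

theorem sideNormal_quad_dot (X : Fin 6) (x : Fin 4 → ℝ) :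
    dotProduct (sideNormal (.quad X)) x =
      2 * (quadSgn X * halved (x 1) (x 2) (x 3) (quadIndex X)) - x 0 := by
  rw [← quadNormal_dot]
  simp [sideNormal, dotProduct, Fin.sum_univ_four]

theorem inv_smul_quad_iff {x₀ : ℝ} {y : Fin 3 → ℝ} (he : 0 < x₀ - topTwo y) (j : Fin 3) :
    2 * |((x₀ - topTwo y)⁻¹ • y) j| ≤ 1 + topTwo ((x₀ - topTwo y)⁻¹ • y) ↔ 2 * |y j| ≤ x₀ := by
  have hi := inv_pos.2 he
  rw [topTwo_smul hi.le, Pi.smul_apply, smul_eq_mul, abs_mul, abs_of_pos hi,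
    show (1 : ℝ) + (x₀ - topTwo y)⁻¹ * topTwo y = (x₀ - topTwo y)⁻¹ * x₀ by
      rw [← inv_mul_cancel₀ he.ne']; ring, mul_left_comm, mul_le_mul_iff_right₀ hi]

theorem inv_mul_abs_le_one_iff {e x : ℝ} (he : 0 < e) : |e⁻¹ * x| ≤ 1 ↔ |x| ≤ e := by
  rw [abs_mul, abs_of_pos (inv_pos.2 he), inv_mul_le_iff₀ he, mul_one]

/-- The chart of the cuboctahedron, on vectors. -/
noncomputable def baseCoord (x : Fin 4 → ℝ) : Fin 3 → ℝ :=
  (x 0 - topTwo (halved (x 1) (x 2) (x 3)))⁻¹ • halved (x 1) (x 2) (x 3)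

/-- A representative of the point with given coordinates. -/
noncomputable def basePoint (y : Fin 3 → ℝ) : Fin 4 → ℝ :=
  ![1 + topTwo y, √2 * y 0, √2 * y 1, √2 * y 2]

/-- This is the case `s = 0`, `ω = 0` of the inequalities for the polytope; positivity of `x 0`
follows from the gap. -/
theorem mem_cuboctahedron_iff_gap {x : Fin 4 → ℝ} (hx : x ≠ 0) :
    rayOfNeZero ℝ x hx ∈ cuboctahedron ↔
      0 < x 0 - topTwo (halved (x 1) (x 2) (x 3)) ∧ baseCoord x ∈ baseModel := by
  have hsides : (∀ s, dotProduct (sideNormal s) x ≤ 0) ↔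
      |signedMin (halved (x 1) (x 2) (x 3))| ≤ x 0 - topTwo (halved (x 1) (x 2) (x 3)) ∧
      ∀ j, 2 * |halved (x 1) (x 2) (x 3) j| ≤ x 0 := by
    have h₁ := forall_signDot_le_iff (x₀ := x 0) (c := 0) (y := halved (x 1) (x 2) (x 3))
    rw [add_zero] at h₁
    rw [← h₁, ← forall_quad_le_iff]
    constructor
    · intro h
      refine ⟨fun i => ?_, fun X => ?_⟩
      · have := h (.tri i)
        rw [sideNormal_tri_dot, mul_nonpos_iff_pos_imp_nonpos] at this
        linarith [this.1 (by positivity)]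
      · have := h (.quad X)
        rw [sideNormal_quad_dot] at this
        linarith
    · rintro ⟨h, h'⟩ (i | X)
      · rw [sideNormal_tri_dot]
        refine mul_nonpos_of_nonneg_of_nonpos (Real.sqrt_nonneg 2) ?_
        linarith [h i]
      · rw [sideNormal_quad_dot]
        linarith [h' X]
  have hq : quad3 x = -x 0 ^ 2 + 2 * (halved (x 1) (x 2) (x 3) 0 ^ 2 +
      halved (x 1) (x 2) (x 3) 1 ^ 2 + halved (x 1) (x 2) (x 3) 2 ^ 2 + 0 * 0 ^ 2) := by
    have := sq_halved (x 1) (x 2) (x 3)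
    unfold quad3
    linarith
  simp only [cuboctahedron, Set.mem_inter_iff, Set.mem_iInter, mem_halfSpace, mem_H3, hsides, hq,
    baseModel, baseCoord, Set.mem_ofPred_eq]
  set y := halved (x 1) (x 2) (x 3)
  have hM := topTwo_nonneg y
  constructor
  · rintro ⟨⟨h₁, h₂⟩, h₃, -⟩
    have he := (quad_neg_iff (s := 0) (ω := 0) (by norm_num) (by norm_num) (by simpa using h₁)
      (by simpa using h₁) h₂).1 h₃
    refine ⟨he, ?_, fun j => (inv_smul_quad_iff he j).2 (h₂ j)⟩
    rwa [signedMin_smul (inv_pos.2 he), inv_mul_abs_le_one_iff he]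
  · rintro ⟨he, h₁, h₂⟩
    rw [signedMin_smul (inv_pos.2 he), inv_mul_abs_le_one_iff he] at h₁
    have h₃ := fun j => (inv_smul_quad_iff he j).1 (h₂ j)
    exact ⟨⟨h₁, h₃⟩, (quad_neg_iff (s := 0) (ω := 0) (by norm_num) (by norm_num)
      (by simpa using h₁) (by simpa using h₁) h₃).2 he, by linarith⟩

theorem basePoint_ne_zero (y : Fin 3 → ℝ) : basePoint y ≠ 0 := by
  intro h
  have := congrFun h 0
  simp only [basePoint, Matrix.cons_val_zero, Pi.zero_apply] at this
  linarith [topTwo_nonneg y]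

theorem halved_basePoint (y : Fin 3 → ℝ) :
    halved (basePoint y 1) (basePoint y 2) (basePoint y 3) = y := halved_mul y

theorem exists_cuboctahedron_chart : ∃ f : cuboctahedron ≃ₜ baseModel,
    ∀ z : baseModel, (f.symm z : S3) = rayOfNeZero ℝ (basePoint z) (basePoint_ne_zero z) := by
  have hM := continuous_topTwo
  have hy : Continuous fun x : Fin 4 → ℝ => halved (x 1) (x 2) (x 3) :=
    continuous_halved (by fun_prop) (by fun_prop) (by fun_prop)
  refine exists_homeomorph_of_homogeneous (a := baseCoord)
    (e := fun x => x 0 - topTwo (halved (x 1) (x 2) (x 3)))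
    (fun x hx => mem_cuboctahedron_iff_gap hx)
    ?_ ?_ basePoint_ne_zero ?_ ?_ ?_ ?_
  · have h : ContinuousOn (fun x : Fin 4 → ℝ => x 0 - topTwo (halved (x 1) (x 2) (x 3)))
        {x | 0 < x 0 - topTwo (halved (x 1) (x 2) (x 3))} :=
      ((continuous_apply 0).sub (hM.comp hy)).continuousOn
    exact (h.inv₀ fun x hx => (Set.mem_ofPred_eq ▸ hx).ne').smul hy.continuousOn
  · refine continuous_pi fun j => ?_
    fin_cases j <;> simp [basePoint] <;> fun_prop
  · intro z
    rw [halved_basePoint]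
    simp [basePoint]
  · intro z
    rw [baseCoord, halved_basePoint]
    simp [basePoint]
  · intro x he
    refine ⟨_, inv_pos.2 he, ?_⟩
    have hi := inv_pos.2 he
    funext j
    fin_cases j
    · simp only [basePoint, baseCoord, topTwo_smul hi.le]
      simp only [Fin.zero_eta, Matrix.cons_val_zero, Pi.smul_apply, smul_eq_mul]
      field_simp
      ring
    all_goals
      simp [basePoint, baseCoord, halved]
      field_simp
  · intro c hc x
    simp only [baseCoord, Pi.smul_apply, smul_eq_mul, halved_smul, topTwo_smul hc.le, smul_smul]
    congr 1
    rw [← mul_sub, mul_inv]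
    field_simp

theorem basePoint_mem_face_tri_iff {y : Fin 3 → ℝ}
    (hy : rayOfNeZero ℝ (basePoint y) (basePoint_ne_zero y) ∈ cuboctahedron) (i : Fin 8) :
    rayOfNeZero ℝ (basePoint y) (basePoint_ne_zero y) ∈ face (.tri i) ↔
      signDot i y = 1 + topTwo y := by
  rw [face, Set.mem_inter_iff, and_iff_left hy, mem_hyperplane, sideNormal_tri_dot,
    halved_basePoint, mul_eq_zero, or_iff_right (by positivity), sub_eq_zero]
  rfl

theorem basePoint_mem_face_quad_iff {y : Fin 3 → ℝ}
    (hy : rayOfNeZero ℝ (basePoint y) (basePoint_ne_zero y) ∈ cuboctahedron) (X : Fin 6) :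
    rayOfNeZero ℝ (basePoint y) (basePoint_ne_zero y) ∈ face (.quad X) ↔
      2 * (quadSgn X * y (quadIndex X)) = 1 + topTwo y := by
  rw [face, Set.mem_inter_iff, and_iff_left hy, mem_hyperplane, sideNormal_quad_dot,
    halved_basePoint, sub_eq_zero]
  rfl

/-! ### The chart of the polytope -/

theorem rescaledWall_pos_dot (t : ℝ) (i : Fin 8) (x : Fin 5 → ℝ) :
    dotProduct (rescaledWall t (.pos i)) x =
      √2 * (signDot i (halved (x 1) (x 2) (x 3)) + (-1) ^ (i : ℕ) * (x 4 / √2) - x 0) := by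
  simp [rescaledWall, dotProduct, Fin.sum_univ_five, signDot, halved]
  field_simp
  ring

theorem rescaledWall_tri_dot (t : ℝ) (i : Fin 8) (x : Fin 5 → ℝ) :
    dotProduct (rescaledWall t (.side (.tri i))) x =
      √2 * (signDot i (halved (x 1) (x 2) (x 3)) -
        (-1) ^ (i : ℕ) * (t * |t|) * (x 4 / √2) - x 0) := by
  simp [rescaledWall, dotProduct, Fin.sum_univ_five, signDot, halved]
  field_simp
  ring

theorem rescaledWall_quad_dot (t : ℝ) (X : Fin 6) (x : Fin 5 → ℝ) :
    dotProduct (rescaledWall t (.side (.quad X))) x =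
      2 * (quadSgn X * halved (x 1) (x 2) (x 3) (quadIndex X)) - x 0 := by
  rw [← quadNormal_dot]
  simp [rescaledWall, dotProduct, Fin.sum_univ_five]

/-- The chart of the rescaled polytope, on vectors. -/
noncomputable def prismCoord (x : Fin 5 → ℝ) : (Fin 3 → ℝ) × ℝ :=
  (x 0 - topTwo (halved (x 1) (x 2) (x 3)))⁻¹ • (halved (x 1) (x 2) (x 3), x 4 / √2)

/-- A representative of the point with given coordinates. -/
noncomputable def prismPoint (z : (Fin 3 → ℝ) × ℝ) : Fin 5 → ℝ :=
  ![1 + topTwo z.1, √2 * z.1 0, √2 * z.1 1, √2 * z.1 2, √2 * z.2]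

/-- The time condition, present or absent according to the sign of `t`, is implied by a positive
gap, so all three geometries can be treated alike. -/
theorem mem_modelSpace_iff {t : ℝ} {x : Fin 5 → ℝ} (hx : x ≠ 0) {e : ℝ} (hx₀ : 0 < e → 0 < x 0)
    (hq : quad4 (t * |t|) x < 0 ↔ 0 < e) : rayOfNeZero ℝ x hx ∈ modelSpace t ↔ 0 < e := by
  unfold modelSpace
  split_ifs with h h'
  · rw [mem_cone_pos, hq]
    exact and_iff_left_of_imp hx₀
  · rw [mem_cone, hq]
  · obtain rfl : t = 0 := by linarith
    rw [zero_mul] at hq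
    rw [HP4, mem_proj]
    · change quad4 0 x < 0 ∧ 0 ≤ x 0 ↔ _
      rw [hq]
      exact and_iff_left_of_imp fun h => (hx₀ h).le
    · rintro c hc y ⟨hy, hy0⟩
      refine ⟨?_, mul_nonneg hc.le hy0⟩
      rw [quad4_smul]
      exact mul_neg_of_pos_of_neg (by positivity) hy

theorem mem_rescaledPolytope_iff_gap {t : ℝ} (hs : -1 < t * |t|) (hs' : t * |t| ≤ 1 / 3)
    {x : Fin 5 → ℝ} (hx : x ≠ 0) :
    rayOfNeZero ℝ x hx ∈ rescaledPolytope t ↔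
      0 < x 0 - topTwo (halved (x 1) (x 2) (x 3)) ∧ prismCoord x ∈ prismModel (t * |t|) := by
  have h2 : 0 < √2 := by positivity
  have hwalls : (∀ w, dotProduct (rescaledWall t w) x ≤ 0) ↔
      |signedMin (halved (x 1) (x 2) (x 3)) + x 4 / √2| ≤
        x 0 - topTwo (halved (x 1) (x 2) (x 3)) ∧
      |signedMin (halved (x 1) (x 2) (x 3)) - t * |t| * (x 4 / √2)| ≤
        x 0 - topTwo (halved (x 1) (x 2) (x 3)) ∧
      ∀ j, 2 * |halved (x 1) (x 2) (x 3) j| ≤ x 0 := by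
    have h₁ := forall_signDot_le_iff (x₀ := x 0) (c := -(t * |t| * (x 4 / √2)))
      (y := halved (x 1) (x 2) (x 3))
    rw [← sub_eq_add_neg] at h₁
    rw [← h₁, ← forall_quad_le_iff, ← forall_signDot_le_iff]
    constructor
    · intro h
      refine ⟨fun i => ?_, fun i => ?_, fun X => ?_⟩
      · have := h (.pos i)
        rw [rescaledWall_pos_dot, mul_nonpos_iff_pos_imp_nonpos] at this
        linarith [this.1 h2]
      · have := h (.side (.tri i))
        rw [rescaledWall_tri_dot, mul_nonpos_iff_pos_imp_nonpos] at this
        linarith [this.1 h2]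
      · have := h (.side (.quad X))
        rw [rescaledWall_quad_dot] at this
        linarith
    · rintro ⟨h, h', h''⟩ (i | i | X)
      · rw [rescaledWall_pos_dot]
        exact mul_nonpos_of_nonneg_of_nonpos h2.le (by linarith [h i])
      · rw [rescaledWall_tri_dot]
        exact mul_nonpos_of_nonneg_of_nonpos h2.le (by linarith [h' i])
      · rw [rescaledWall_quad_dot]
        linarith [h'' X]
  have hq : quad4 (t * |t|) x = -x 0 ^ 2 + 2 * (halved (x 1) (x 2) (x 3) 0 ^ 2 +
      halved (x 1) (x 2) (x 3) 1 ^ 2 + halved (x 1) (x 2) (x 3) 2 ^ 2 +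
        t * |t| * (x 4 / √2) ^ 2) := by
    have h := sq_halved (x 1) (x 2) (x 3)
    have h4 : x 4 ^ 2 = 2 * (x 4 / √2) ^ 2 := by
      rw [div_pow, Real.sq_sqrt zero_le_two]; ring
    unfold quad4
    rw [h4]
    linarith
  rw [rescaledPolytope, Set.mem_inter_iff, Set.mem_iInter]
  simp only [mem_halfSpace, hwalls, prismModel, prismCoord, Set.mem_ofPred_eq, Prod.smul_fst,
    Prod.smul_snd, smul_eq_mul]
  generalize x 4 / √2 = ω at *
  generalize halved (x 1) (x 2) (x 3) = y at *
  have hM := topTwo_nonneg y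
  have hmodel : |signedMin y + ω| ≤ x 0 - topTwo y → |signedMin y - t * |t| * ω| ≤ x 0 - topTwo y →
      (∀ j, 2 * |y j| ≤ x 0) → (rayOfNeZero ℝ x hx ∈ modelSpace t ↔ 0 < x 0 - topTwo y) := by
    intro h₁ h₂ h₃
    refine mem_modelSpace_iff hx (fun h => by linarith) ?_
    rw [hq]
    exact quad_neg_iff hs hs' h₁ h₂ h₃
  have hscale : 0 < x 0 - topTwo y →
      (|signedMin ((x 0 - topTwo y)⁻¹ • y) + (x 0 - topTwo y)⁻¹ * ω| ≤ 1 ↔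
        |signedMin y + ω| ≤ x 0 - topTwo y) ∧
      (|signedMin ((x 0 - topTwo y)⁻¹ • y) - t * |t| * ((x 0 - topTwo y)⁻¹ * ω)| ≤ 1 ↔
        |signedMin y - t * |t| * ω| ≤ x 0 - topTwo y) := by
    intro he
    rw [signedMin_smul (inv_pos.2 he), ← mul_add, inv_mul_abs_le_one_iff he, mul_left_comm,
      ← mul_sub, inv_mul_abs_le_one_iff he]
    exact ⟨Iff.rfl, Iff.rfl⟩
  constructor
  · rintro ⟨⟨h₁, h₂, h₃⟩, h₄⟩
    have he := (hmodel h₁ h₂ h₃).1 h₄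
    exact ⟨he, (hscale he).1.2 h₁, (hscale he).2.2 h₂, fun j => (inv_smul_quad_iff he j).2 (h₃ j)⟩
  · rintro ⟨he, h₁, h₂, h₃⟩
    have g₁ := (hscale he).1.1 h₁
    have g₂ := (hscale he).2.1 h₂
    have g₃ := fun j => (inv_smul_quad_iff he j).1 (h₃ j)
    exact ⟨⟨g₁, g₂, g₃⟩, (hmodel g₁ g₂ g₃).2 he⟩

theorem prismPoint_ne_zero (z : (Fin 3 → ℝ) × ℝ) : prismPoint z ≠ 0 := by
  intro h
  have := congrFun h 0
  simp only [prismPoint, Matrix.cons_val_zero, Pi.zero_apply] at this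
  linarith [topTwo_nonneg z.1]

theorem halved_prismPoint (z : (Fin 3 → ℝ) × ℝ) :
    halved (prismPoint z 1) (prismPoint z 2) (prismPoint z 3) = z.1 := halved_mul z.1

theorem prismPoint_four (z : (Fin 3 → ℝ) × ℝ) : prismPoint z 4 / √2 = z.2 := by
  simp [prismPoint]

theorem exists_rescaledPolytope_chart {t : ℝ} (hs : -1 < t * |t|) (hs' : t * |t| ≤ 1 / 3) :
    ∃ f : rescaledPolytope t ≃ₜ prismModel (t * |t|), ∀ z : prismModel (t * |t|),
      (f.symm z : S4) = rayOfNeZero ℝ (prismPoint z) (prismPoint_ne_zero z) := by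
  have hM := continuous_topTwo
  have hy : Continuous fun x : Fin 5 → ℝ => halved (x 1) (x 2) (x 3) :=
    continuous_halved (by fun_prop) (by fun_prop) (by fun_prop)
  refine exists_homeomorph_of_homogeneous (a := prismCoord)
    (e := fun x => x 0 - topTwo (halved (x 1) (x 2) (x 3)))
    (fun x hx => mem_rescaledPolytope_iff_gap hs hs' hx)
    ?_ ?_ prismPoint_ne_zero ?_ ?_ ?_ ?_
  · have h : ContinuousOn (fun x : Fin 5 → ℝ => x 0 - topTwo (halved (x 1) (x 2) (x 3)))
        {x | 0 < x 0 - topTwo (halved (x 1) (x 2) (x 3))} :=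
      ((continuous_apply 0).sub (hM.comp hy)).continuousOn
    have h4 : Continuous fun x : Fin 5 → ℝ => x 4 / √2 := by fun_prop
    exact (h.inv₀ fun x hx => (Set.mem_ofPred_eq ▸ hx).ne').smul (hy.prodMk h4).continuousOn
  · refine continuous_pi fun j => ?_
    fin_cases j <;> simp [prismPoint] <;> fun_prop
  · intro z
    rw [halved_prismPoint]
    simp [prismPoint]
  · intro z
    rw [prismCoord, halved_prismPoint, prismPoint_four]
    simp [prismPoint]
  · intro x he
    refine ⟨_, inv_pos.2 he, ?_⟩
    have hi := inv_pos.2 he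
    funext j
    fin_cases j
    · simp only [prismPoint, prismCoord, Prod.smul_fst, topTwo_smul hi.le]
      simp only [Fin.zero_eta, Matrix.cons_val_zero, Pi.smul_apply, smul_eq_mul]
      field_simp
      ring
    all_goals
      simp [prismPoint, prismCoord, halved]
      field_simp
  · intro c hc x
    simp only [prismCoord, Pi.smul_apply, smul_eq_mul, halved_smul, topTwo_smul hc.le,
      mul_div_assoc]
    rw [← mul_sub, mul_inv, mul_comm c⁻¹, mul_smul]
    congr 1
    refine Prod.ext ?_ ?_
    · exact inv_smul_smul₀ hc.ne' _
    · exact inv_mul_cancel_left₀ hc.ne' _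

/-- The rescaled polytope is a prism over the cuboctahedron. -/
theorem nonempty_prismChart_rescaled {t : ℝ} (hs : -1 < t * |t|) (hs' : t * |t| ≤ 1 / 3) :
    Nonempty (PrismChart (rescaledPolytope t) (rescaledFacet t)) := by
  obtain ⟨f, hf⟩ := exists_rescaledPolytope_chart hs hs'
  obtain ⟨g, hg⟩ := exists_cuboctahedron_chart
  have habs : |(t * |t|)| < 1 := abs_lt.2 ⟨hs, by linarith⟩
  have hwall : ∀ (z : prismModel (t * |t|)) (w : Wall), (f.symm z : S4) ∈ rescaledFacet t w ↔
      dotProduct (rescaledWall t w) (prismPoint z) = 0 := by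
    intro z w
    rw [rescaledFacet, Set.mem_inter_iff, and_iff_left (f.symm z).2, hf, mem_hyperplane]
  have h0 : ∀ z : prismModel (t * |t|), prismPoint z 0 = 1 + topTwo z.1.1 := fun _ => rfl
  refine ⟨⟨(f.trans (modelHomeo habs)).trans (g.symm.prodCongr (Homeomorph.refl _)), ?_, ?_⟩⟩
  · intro p s
    obtain ⟨z, rfl⟩ := f.symm.surjective p
    have e : (((f.trans (modelHomeo habs)).trans (g.symm.prodCongr (Homeomorph.refl _)))
        (f.symm z)).1 = g.symm (modelHomeo habs z).1 := by
      simp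
    have hmem := (g.symm (modelHomeo habs z).1).2
    rw [e, hwall, hg]
    rw [hg] at hmem
    rcases s with i | X
    · rw [rescaledWall_tri_dot, halved_prismPoint, prismPoint_four, h0, mul_eq_zero,
        or_iff_right (by positivity), sub_eq_zero, basePoint_mem_face_tri_iff hmem,
        modelHomeo_tri_iff habs]
    · rw [rescaledWall_quad_dot, halved_prismPoint, h0, sub_eq_zero,
        basePoint_mem_face_quad_iff hmem, modelHomeo_quad_iff habs _ _ (quadSgn_eq X)]
  · intro p
    obtain ⟨z, rfl⟩ := f.symm.surjective p
    have e : (((f.trans (modelHomeo habs)).trans (g.symm.prodCongr (Homeomorph.refl _)))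
        (f.symm z)).2 = (modelHomeo habs z).2 := by
      simp
    rw [e, ← modelHomeo_pos_iff habs z]
    refine exists_congr fun i => ?_
    rw [hwall, rescaledWall_pos_dot, halved_prismPoint, prismPoint_four, h0, mul_eq_zero,
      or_iff_right (by positivity), sub_eq_zero]

/-! ### Transfer from the rescaled polytope to the polytope. -/

/-- The projective map induced by a linear equivalence, as a homeomorphism. -/
noncomputable def rayHomeomorph {m : ℕ} (e : (Fin m → ℝ) ≃ₗ[ℝ] (Fin m → ℝ)) :
    Module.Ray ℝ (Fin m → ℝ) ≃ₜ Module.Ray ℝ (Fin m → ℝ) where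
  toEquiv := Module.Ray.map e
  continuous_toFun := continuous_rayMap e
  continuous_invFun := continuous_rayMap e.symm

/-- The polytope is a prism over the cuboctahedron. -/
theorem nonempty_prismChart {t : ℝ} (ht : t ≠ 0) (hs : -1 < t * |t|) (hs' : t * |t| ≤ 1 / 3) :
    Nonempty (PrismChart (polytope t) (facet t)) := by
  obtain ⟨Ψ⟩ := nonempty_prismChart_rescaled hs hs'
  let e : polytope t ≃ₜ rescaledPolytope t :=
    ((rayHomeomorph (rescaling t ht)).image (polytope t)).trans
      (Homeomorph.setCongr (rescaledPolytope_eq t ht).symm)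
  have hfacet : ∀ (p : polytope t) (w : Wall), (p : S4) ∈ facet t w ↔
      (e p : S4) ∈ rescaledFacet t w := by
    intro p w
    rw [rescaledFacet_eq t ht]
    exact ((Module.Ray.map (rescaling t ht)).injective.mem_set_image).symm
  refine ⟨⟨e.trans Ψ.homeo, fun p s => ?_, fun p => ?_⟩⟩
  · rw [hfacet]
    exact Ψ.mem_side_iff (e p) s
  · simp only [hfacet]
    exact Ψ.mem_pos_iff (e p)

/-- The endpoint `1 / √3` becomes `1 / 3`, and the open endpoint `-1` keeps `1 + s` positive. -/
theorem mul_abs_bounds {t : ℝ} (ht : t ∈ Set.Ioc (-1 : ℝ) (1 / √3)) :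
    -1 < t * |t| ∧ t * |t| ≤ 1 / 3 := by
  rcases le_total 0 t with h | h
  · have h3 : (1 / √3) * (1 / √3) = (1 / 3 : ℝ) := by
      rw [div_mul_div_comm, Real.mul_self_sqrt (by norm_num), one_mul]
    rw [abs_of_nonneg h]
    exact ⟨by nlinarith, h3 ▸ mul_self_le_mul_self h ht.2⟩
  · rw [abs_of_nonpos h]
    constructor <;> nlinarith [ht.1]

end Transition

open Transition

/-- The argument does not use that `Γ` is torsion-free: the hypothesis ensures that the quotient is
a manifold. -/
theorem proposition6p15 (Γ : Subgroup cuboctGroup)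
    (hΓ : ∀ g ∈ Γ, IsOfFinOrder g → g = 1) :
    (∀ t ∈ Set.Ioc (-1 : ℝ) (1 / √3), t ≠ 0 →
      Nonempty (ConeSpace Γ t ≃ₜ QuotientManifold Γ × Circle)) ∧
    (∀ t ∈ Set.Ioc (-1 : ℝ) (1 / √3),
      Nonempty (RescaledConeSpace Γ t ≃ₜ QuotientManifold Γ × Circle)) := by
  refine ⟨fun t ht ht0 => ?_, fun t ht => ?_⟩
  · obtain ⟨Ψ⟩ := nonempty_prismChart ht0 (mul_abs_bounds ht).1 (mul_abs_bounds ht).2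
    exact Ψ.nonempty_homeomorph Γ
  · obtain ⟨Ψ⟩ := nonempty_prismChart_rescaled (mul_abs_bounds ht).1 (mul_abs_bounds ht).2
    exact Ψ.nonempty_homeomorph Γ
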